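/- **Setting.** Let $v:\mathbb R\to\mathbb R^q$, $q=2\rho$, solve $\dot v=Ev$ with $E=\mathrm{bdiag}\begin{bmatrix}0&w_r\\-w_r&0\end{bmatrix}$, where $w_1,\dots,w_\rho>0$ are distinct. For $i=1,\dots,N$ let follower $i$ be $\dot x_i=A_ix_i+B_iu_i+D_iv$, $e_i=C_ix_i+F_iv$, with $x_i\in\mathbb R^{n_i}$, $u_i\in\mathbb R^{m_i}$, $e_i\in\mathbb R^{p_i}$. Assume: $(A_i,B_i)$ is stabilizable and $(C_i,A_i)$ observable; $\mathrm{rank}\begin{bmatrix}A_i-\lambda I&B_i\\C_i&0\end{bmatrix}=n_i+p_i$ for all $\lambda\in\sigma(E)$; the followers' communication graph, with weights $a_{ij}=a_{ji}\ge0$, $a_{ii}=0$, is connected; the set $\mathcal T$ of followers in contact with the leader is nonempty ($m_{ii}=1$ if $i\in\mathcal T$ and $m_{ii}=0$ otherwise). Let $Q_i\succeq0$ and $R_i\succ0$ be symmetric with $(\sqrt{Q_i}C_i,A_i)$ observable. *Observer.* For gains $\kappa_r>0$ and $\mathbb A_m=-\mathrm{bdiag}(a_rI_2)$, $a_r>0$,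 the observer is $$\dot\eta_i=\hat E_i\eta_i+(\mathbb A_m-\hat E_i)\epsilon_i,\qquad \dot{(\hat w_r)}_i=\kappa_r\big(\eta_{i,2r-1}\epsilon_{i,2r}-\eta_{i,2r}\epsilon_{i,2r-1}\big),$$ where $\epsilon_i=\sum_ja_{ij}(\eta_i-\eta_j)+m_{ii}(\eta_i-v)$ and $\hat E_i=\mathrm{bdiag}\begin{bmatrix}0&(\hat w_r)_i\\-(\hat w_r)_i&0\end{bmatrix}$, with given initial values of $\eta_i$ and $(\hat w_r)_i$. *Data.* On $[t_0,t_s]$, $t_0<t_1<\dots<t_s$, the input $u_i=-K_{i,0}x_i+\zeta_i$ is applied, where $A_i-B_iK_{i,0}$ is Hurwitz and $\zeta_i$ is essentially bounded. Let $X_{i0}=0$, $C_iX_{i1}+F_i=0$, and let $\mathrm{vec}(X_{i2}),\dots,\mathrm{vec}(X_{i,h_i+1})$ be a basis of $\ker(I_q\otimes C_i)$. For an exostate signal $z_i$ used by follower $i$ put $\bar x_{ij}=x_i-X_{ij}z_i$. Let $\Gamma_{a,b}$ be the matrix with rows $\big(\int_{t_l}^{t_{l+1}}a\otimes b\,d\tau\big)^T$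 and $\delta_a$ the matrix with rows $\big(\mathrm{vecv}(a(t_{l+1}))-\mathrm{vecv}(a(t_l))\big)^T$, where $\mathrm{vecv}(x)=(x_1^2,x_1x_2,\dots,x_1x_n,x_2^2,\dots,x_n^2)^T$ and, for a symmetric $P$, $\mathrm{vecs}(P)=(p_{11},2p_{12},\dots,2p_{1n},p_{22},\dots,p_{nn})^T$. *Learning.* Starting from $K_{i,0}$, for $k=0,1,\dots$ the algorithm solves, in the sense of least squares, for a symmetric $P_{i,k}$, for $K_{i,k+1}$ and for $W$ in $$\big[\delta_{\bar x_{ij}},\;-2\Gamma_{\bar x_{ij},\bar x_{ij}}(I\otimes K_{i,k}^TR_i)-2\Gamma_{\bar x_{ij},u_i}(I\otimes R_i),\;-2\Gamma_{\bar x_{ij},z_i}\big]\begin{bmatrix}\mathrm{vecs}(P_{i,k})\\\mathrm{vec}(K_{i,k+1})\\\mathrm{vec}(W)\end{bmatrix}=-\Gamma_{\bar x_{ij},\bar x_{ij}}\mathrm{vec}(C_i^TQ_iC_i+K_{i,k}^TR_iK_{i,k}).$$ **Theorem.** Suppose that with $z_i=v$ the rank condition $$\mathrm{rank}\,[\Gamma_{\bar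 x_{ij},\bar x_{ij}},\Gamma_{\bar x_{ij},u_i},\Gamma_{\bar x_{ij},v}]=\tfrac{n_i(n_i+1)}2+(m_i+q)n_i$$ holds for all $i=1,\dots,N$ and $j=0,\dots,h_i+1$. Then for every $i$ the Riccati equation $A_i^TP+PA_i+C_i^TQ_iC_i-PB_iR_i^{-1}B_i^TP=0$ has a unique symmetric stabilizing solution $P_i^\star$. Put $K_i^\star=R_i^{-1}B_i^TP_i^\star$. For every $c>0$ there are observer gains $\kappa_r>0$ $(r=1,\dots,\rho)$ and an index $k^\star\ge0$ such that, with the induced Euclidean norm, for all $i$ and $j$ the learned matrices at step $k^\star$ satisfy $$|P_{i,k^\star}-P_i^\star|<c,\qquad|K_{i,k^\star}-K_i^\star|<c$$ in both of the following cases: (a) the learning uses the exostate itself, $z_i=v$; (b) the learning uses the observer's estimates, $z_i=\eta_i$, where the observer is started from its given initial values at time $t_0-T$ and $T\ge T^\star$, for some $T^\star\ge0$. -/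

import Mathlib

open MeasureTheory
open scoped Matrix Kronecker MatrixOrder Matrix.Norms.L2Operator

noncomputable section

/-- A real square matrix is Hurwitz if all its complex eigenvalues have negative real part. -/
def IsHurwitz {n : ℕ} (A : Matrix (Fin n) (Fin n) ℝ) : Prop :=
  ∀ μ ∈ spectrum ℂ (A.map (algebraMap ℝ ℂ)), μ.re < 0

/-- `K` is a stabilizing feedback gain for the pair `(A, B)`. -/
def IsStabilizingGain {n m : ℕ} (A : Matrix (Fin n) (Fin n) ℝ) (B : Matrix (Fin n) (Fin m) ℝ)
    (K : Matrix (Fin m) (Fin n) ℝ) : Prop :=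
  IsHurwitz (A - B * K)

def IsStabilizable {n m : ℕ} (A : Matrix (Fin n) (Fin n) ℝ) (B : Matrix (Fin n) (Fin m) ℝ) : Prop :=
  ∃ K, IsStabilizingGain A B K

/-- Observability of the pair `(C, A)`: the only unobservable state is `0`. -/
def IsObservable {n p : ℕ} (C : Matrix (Fin p) (Fin n) ℝ) (A : Matrix (Fin n) (Fin n) ℝ) : Prop :=
  ∀ x : Fin n → ℝ, (∀ k : ℕ, (C * A ^ k) *ᵥ x = 0) → x = 0

/-- `P` is the (symmetric) stabilizing solution of the algebraic Riccati equation
`AᵀP + PA + CᵀQC - PBR⁻¹BᵀP = 0`. -/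
def IsStabilizingRiccatiSolution {n m p : ℕ} (A : Matrix (Fin n) (Fin n) ℝ)
    (B : Matrix (Fin n) (Fin m) ℝ) (C : Matrix (Fin p) (Fin n) ℝ)
    (Q : Matrix (Fin p) (Fin p) ℝ) (R : Matrix (Fin m) (Fin m) ℝ)
    (P : Matrix (Fin n) (Fin n) ℝ) : Prop :=
  P.IsSymm ∧ Aᵀ * P + P * A + Cᵀ * Q * C - P * B * R⁻¹ * Bᵀ * P = 0 ∧
    IsStabilizingGain A B (R⁻¹ * Bᵀ * P)

/-! The exosystem and the adaptive observer -/

/-- Coordinates of the exostate, `q = 2ρ`: `(0, r)` and `(1, r)` are the first and the second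
coordinate of the `r`-th oscillator. -/
abbrev ExoIdx (ρ : ℕ) : Type := Fin 2 × Fin ρ

/-- The block diagonal matrix with the blocks `[0, w r; -w r, 0]`. -/
def oscillatorMatrix {ρ : ℕ} (w : Fin ρ → ℝ) : Matrix (ExoIdx ρ) (ExoIdx ρ) ℝ :=
  Matrix.blockDiagonal fun r => !![0, w r; -w r, 0]

/-- The matrix `-bdiag(a r • I₂)`. -/
def observerMatrix {ρ : ℕ} (a : Fin ρ → ℝ) : Matrix (ExoIdx ρ) (ExoIdx ρ) ℝ :=
  -Matrix.blockDiagonal fun r => a r • (1 : Matrix (Fin 2) (Fin 2) ℝ)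

/-- `v` solves `v' = E v` on the whole line. -/
def IsExosystemTrajectory {ρ : ℕ} (w : Fin ρ → ℝ) (v : ℝ → ExoIdx ρ → ℝ) : Prop :=
  ∀ t, HasDerivAt v (oscillatorMatrix w *ᵥ v t) t

/-- The communication graph without the leader: symmetric nonnegative weights, no loops,
connected. -/
def IsConnectedWeights {N : ℕ} (adj : Matrix (Fin N) (Fin N) ℝ) : Prop :=
  adj.IsSymm ∧ (∀ i, adj i i = 0) ∧ (∀ i j, 0 ≤ adj i j) ∧
    (SimpleGraph.fromRel fun i j => 0 < adj i j).Connected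

/-- The local observation error `ε_i = ∑ j, a_ij (η_i - η_j) + m_ii (η_i - v)`, where `m_ii` is `1`
if follower `i` has direct contact with the leader and `0` otherwise. -/
def localError {N ρ : ℕ} (adj : Matrix (Fin N) (Fin N) ℝ) (target : Finset (Fin N))
    (η : Fin N → ExoIdx ρ → ℝ) (v : ExoIdx ρ → ℝ) (i : Fin N) : ExoIdx ρ → ℝ :=
  ∑ j, adj i j • (η i - η j) + (if i ∈ target then (1 : ℝ) else 0) • (η i - v)

/-- `(η, ω)` is a trajectory on `[t₁, t₂]` of the distributed adaptive observer with gains `κ`,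
started at time `t₁` from `(η₀, ω₀)`:
`η_i' = Ê_i η_i + (A_m - Ê_i) ε_i` and `ω_{i,r}' = κ_r (η_{i,(0,r)} ε_{i,(1,r)} - η_{i,(1,r)} ε_{i,(0,r)})`,
where `Ê_i` is the oscillator matrix of the estimated frequencies `ω_i`. -/
def IsObserverTrajectory {N ρ : ℕ} (adj : Matrix (Fin N) (Fin N) ℝ) (target : Finset (Fin N))
    (a κ : Fin ρ → ℝ) (v : ℝ → ExoIdx ρ → ℝ) (η₀ : Fin N → ExoIdx ρ → ℝ) (ω₀ : Fin N → Fin ρ → ℝ)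
    (t₁ t₂ : ℝ) (η : Fin N → ℝ → ExoIdx ρ → ℝ) (ω : Fin N → ℝ → Fin ρ → ℝ) : Prop :=
  (∀ i, η i t₁ = η₀ i) ∧ (∀ i, ω i t₁ = ω₀ i) ∧
  ∀ i, ∀ t ∈ Set.Icc t₁ t₂,
    let ε : ExoIdx ρ → ℝ := localError adj target (fun j => η j t) (v t) i
    let Ehat := oscillatorMatrix (ω i t)
    HasDerivWithinAt (η i) (Ehat *ᵥ η i t + (observerMatrix a - Ehat) *ᵥ ε) (Set.Icc t₁ t₂) t ∧
    HasDerivWithinAt (ω i)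
      (fun r => κ r * (η i t (0, r) * ε (1, r) - η i t (1, r) * ε (0, r))) (Set.Icc t₁ t₂) t

/-! The followers and the collected data -/

/-- `x` is a (Carathéodory) solution on `[t₁, t₂]` of `x' = A x + B u + D v`. -/
def IsFollowerTrajectory {n m ρ : ℕ} (A : Matrix (Fin n) (Fin n) ℝ) (B : Matrix (Fin n) (Fin m) ℝ)
    (D : Matrix (Fin n) (ExoIdx ρ) ℝ) (u : ℝ → Fin m → ℝ) (v : ℝ → ExoIdx ρ → ℝ)
    (t₁ t₂ : ℝ) (x : ℝ → Fin n → ℝ) : Prop :=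
  ContinuousOn x (Set.Icc t₁ t₂) ∧
    ∀ t ∈ Set.Icc t₁ t₂, x t = x t₁ + ∫ τ in t₁..t, (A *ᵥ x τ + B *ᵥ u τ + D *ᵥ v τ)

/-- The trial matrices: `X_0 = 0`, `C X_1 + F = 0`, and `vec X_2, …, vec X_{h+1}` is a basis of the
kernel of `I_q ⊗ C`. -/
def IsTrialFamily {n p ρ h : ℕ} (C : Matrix (Fin p) (Fin n) ℝ) (F : Matrix (Fin p) (ExoIdx ρ) ℝ)
    (X : Fin (h + 2) → Matrix (Fin n) (ExoIdx ρ) ℝ) : Prop :=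
  X 0 = 0 ∧ C * X 1 + F = 0 ∧
  LinearIndependent ℝ (fun j : Fin h => (X j.succ.succ).vec) ∧
  Submodule.span ℝ (Set.range fun j : Fin h => (X j.succ.succ).vec) =
    LinearMap.ker (((1 : Matrix (ExoIdx ρ) (ExoIdx ρ) ℝ) ⊗ₖ C).mulVecLin)

/-- The signal `x̄ = x - X z`, where `z` is the exostate signal that the follower uses. -/
def barSignal {n ρ : ℕ} (X : Matrix (Fin n) (ExoIdx ρ) ℝ) (x : ℝ → Fin n → ℝ)
    (z : ℝ → ExoIdx ρ → ℝ) : ℝ → Fin n → ℝ :=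
  fun t => x t - X *ᵥ z t

/-- Index type of the entries on and above the diagonal of a symmetric `n × n` matrix. -/
abbrev SymIdx (n : ℕ) : Type := {ab : Fin n × Fin n // ab.1 ≤ ab.2}

/-- `vecs P = (p₁₁, 2p₁₂, …, 2p₁ₙ, p₂₂, 2p₂₃, …, pₙₙ)`. -/
def vecs {n : ℕ} (P : Matrix (Fin n) (Fin n) ℝ) : SymIdx n → ℝ :=
  fun ab => if ab.1.1 = ab.1.2 then P ab.1.1 ab.1.2 else 2 * P ab.1.1 ab.1.2

/-- `vecv x = (x₁², x₁x₂, …, x₁xₙ, x₂², x₂x₃, …, xₙ²)`, so that `vecv x ⬝ᵥ vecs P = xᵀ P x`. -/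
def vecv {n : ℕ} (x : Fin n → ℝ) : SymIdx n → ℝ :=
  fun ab => x ab.1.1 * x ab.1.2

/-- The data matrix `δ_b`, with the rows `vecv (b (t_{l+1})) - vecv (b (t_l))`. -/
def deltaData {n s : ℕ} (t : Fin (s + 1) → ℝ) (b : ℝ → Fin n → ℝ) :
    Matrix (Fin s) (SymIdx n) ℝ :=
  Matrix.of fun l => vecv (b (t l.succ)) - vecv (b (t l.castSucc))

/-- The data matrix `Γ_{b,d}`, with the rows `∫ b ⊗ d` over `[t_l, t_{l+1}]`. -/
def gammaData {s : ℕ} {α β : Type} (t : Fin (s + 1) → ℝ) (b : ℝ → α → ℝ) (d : ℝ → β → ℝ) :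
    Matrix (Fin s) (α × β) ℝ :=
  Matrix.of fun l ab => ∫ τ in (t l.castSucc)..(t l.succ), b τ ab.1 * d τ ab.2

/-- The rank condition: `[Γ_{x̄x̄}, Γ_{x̄u}, Γ_{x̄z}]` has rank `n(n+1)/2 + (m+q)n`. -/
def DataRankCondition {n m ρ s : ℕ} (t : Fin (s + 1) → ℝ) (b : ℝ → Fin n → ℝ) (u : ℝ → Fin m → ℝ)
    (z : ℝ → ExoIdx ρ → ℝ) : Prop :=
  (Matrix.fromCols (gammaData t b b) (Matrix.fromCols (gammaData t b u) (gammaData t b z))).rank =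
    n * (n + 1) / 2 + (m + 2 * ρ) * n

/-- The regression matrix `Ψ_k` for the gain `K = K_k`. -/
def regressor {n m ρ s : ℕ} (R : Matrix (Fin m) (Fin m) ℝ) (t : Fin (s + 1) → ℝ)
    (b : ℝ → Fin n → ℝ) (u : ℝ → Fin m → ℝ) (z : ℝ → ExoIdx ρ → ℝ)
    (K : Matrix (Fin m) (Fin n) ℝ) :
    Matrix (Fin s) (SymIdx n ⊕ (Fin n × Fin m ⊕ Fin n × ExoIdx ρ)) ℝ :=
  Matrix.fromCols (deltaData t b) (Matrix.fromCols
    (-(2 : ℝ) • (gammaData t b b * ((1 : Matrix (Fin n) (Fin n) ℝ) ⊗ₖ (Kᵀ * R)))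
      - (2 : ℝ) • (gammaData t b u * ((1 : Matrix (Fin n) (Fin n) ℝ) ⊗ₖ R)))
    (-(2 : ℝ) • gammaData t b z))

/-- The right-hand side `Φ_k` of the regression for the gain `K = K_k`. -/
def regressand {n m p s : ℕ} (C : Matrix (Fin p) (Fin n) ℝ) (Q : Matrix (Fin p) (Fin p) ℝ)
    (R : Matrix (Fin m) (Fin m) ℝ) (t : Fin (s + 1) → ℝ) (b : ℝ → Fin n → ℝ)
    (K : Matrix (Fin m) (Fin n) ℝ) : Fin s → ℝ :=
  -(gammaData t b b *ᵥ (Cᵀ * Q * C + Kᵀ * R * K).vec)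

/-- `θ` solves `Ψ θ = Φ` in the sense of least square errors. -/
def IsLeastSquaresSolution {s : ℕ} {α : Type} [Fintype α] (Ψ : Matrix (Fin s) α ℝ)
    (Φ : Fin s → ℝ) (θ : α → ℝ) : Prop :=
  ∀ θ' : α → ℝ, (Ψ *ᵥ θ - Φ) ⬝ᵥ (Ψ *ᵥ θ - Φ) ≤ (Ψ *ᵥ θ' - Φ) ⬝ᵥ (Ψ *ᵥ θ' - Φ)

/-- `P_0, …, P_k` and `K_0, …, K_{k+1}` are learned by data-driven policy iteration, started from
the gain `K₀`, from the data `x̄ = b`, `u` and the exostate signal `z`: at each step `P_j`, `K_{j+1}`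
and a matrix `W` (which stands for `(D - S(X))ᵀ P_j`) are obtained by solving
`Ψ_j [vecs P_j; vec K_{j+1}; vec W] = Φ_j`. -/
def IsLearned {n m p ρ s : ℕ} (C : Matrix (Fin p) (Fin n) ℝ) (Q : Matrix (Fin p) (Fin p) ℝ)
    (R : Matrix (Fin m) (Fin m) ℝ) (t : Fin (s + 1) → ℝ) (b : ℝ → Fin n → ℝ) (u : ℝ → Fin m → ℝ)
    (z : ℝ → ExoIdx ρ → ℝ) (K₀ : Matrix (Fin m) (Fin n) ℝ) (k : ℕ)
    (P : ℕ → Matrix (Fin n) (Fin n) ℝ) (K : ℕ → Matrix (Fin m) (Fin n) ℝ) : Prop :=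
  K 0 = K₀ ∧ ∀ j ≤ k, (P j).IsSymm ∧ ∃ W : Matrix (ExoIdx ρ) (Fin n) ℝ,
    IsLeastSquaresSolution (regressor R t b u z (K j)) (regressand C Q R t b (K j))
      (Sum.elim (vecs (P j)) (Sum.elim (K (j + 1)).vec W.vec))

/-- Policy iteration from these data can be carried out up to step `k`, and whatever it returns at
step `k` is within `c`, in the operator norm, of `Pstar` and of `Kstar`. -/
def LearnsWithin {n m p ρ s : ℕ} (C : Matrix (Fin p) (Fin n) ℝ) (Q : Matrix (Fin p) (Fin p) ℝ)
    (R : Matrix (Fin m) (Fin m) ℝ) (t : Fin (s + 1) → ℝ) (b : ℝ → Fin n → ℝ) (u : ℝ → Fin m → ℝ)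
    (z : ℝ → ExoIdx ρ → ℝ) (K₀ : Matrix (Fin m) (Fin n) ℝ) (k : ℕ) (c : ℝ)
    (Pstar : Matrix (Fin n) (Fin n) ℝ) (Kstar : Matrix (Fin m) (Fin n) ℝ) : Prop :=
  (∃ P K, IsLearned C Q R t b u z K₀ k P K) ∧
    ∀ P K, IsLearned C Q R t b u z K₀ k P K → ‖P k - Pstar‖ < c ∧ ‖K k - Kstar‖ < c

end

open Filter Topology

/-! The model behind the learning is Kleinman's policy iteration: evaluate a stabilizing gain `K` by
a Lyapunov equation, replace it by `R⁻¹BᵀP`, repeat. Completing the square shows that the new gain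
is again stabilizing and that the values decrease in the Loewner order; they stay positive
semidefinite, so they converge, and the limit is the stabilizing Riccati solution
(`exists_policyIteration`).

With `z = v`, the signal `x - X v` obeys a linear equation driven by `u` and `v`. Integrating the
derivative of its quadratic forms gives an identity between the data matrices
(`deltaData_mulVec_vecs_eq`). By this identity Kleinman's step solves the regression exactly, and
under the rank condition the regressor is injective at every stabilizing gain
(`IsDataIdentity.regressor_injective`). Least squares therefore reproduces Kleinman's iteration,
which settles case (a) for all large `k`.

For estimates `z = η` the identity fails, and the argument is perturbative. Once `k` is fixed, the
first `k` steps are a composition of finitely many maps continuous at the exact data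
(`eventually_learnsWithin`), and the data depend continuously on `z` in the uniform norm. Hence some
`δ > 0` exists such that an error below `δ` on the data window suffices.

It remains to bring the observer within `δ` by time `t 0`, for every sufficiently early start. Unit
gains suffice. The observer splits into one error system per oscillator, with an energy that never
increases. If the oscillator has positive amplitude, subtracting a correlation term from a multiple
of the energy gives a strict Lyapunov function, and a settling time uniform in the starting phase
(`exists_settlingTime_of_oscillating`). If it is at rest, the frequency error is not controlled, but
the error system is autonomous and each late large state error costs a fixed amount of energy
(`exists_settlingTime_of_rest`). -/

/-! ### Hurwitz matrices, Sylvester and Lyapunov equations -/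

theorem isHurwitz_iff_eigenvector {n : ℕ} {A : Matrix (Fin n) (Fin n) ℝ} :
    IsHurwitz A ↔ ∀ (μ : ℂ) (x : Fin n → ℂ), x ≠ 0 →
      (A.map (algebraMap ℝ ℂ)) *ᵥ x = μ • x → μ.re < 0 := by
  constructor
  · intro h μ x hx hAx
    apply h
    rw [← Matrix.spectrum_toLin', ← Module.End.hasEigenvalue_iff_mem_spectrum]
    exact Module.End.hasEigenvalue_of_hasEigenvector
      (Module.End.hasEigenvector_iff.2 ⟨Module.End.mem_eigenspace_iff.2 (by simpa using hAx), hx⟩)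
  · intro h μ hμ
    rw [← Matrix.spectrum_toLin', ← Module.End.hasEigenvalue_iff_mem_spectrum] at hμ
    obtain ⟨x, hx⟩ := hμ.exists_hasEigenvector
    exact h μ x hx.2 (by simpa using hx.apply_eq_smul)

/-- Gelfand's formula: the `k`-th root of `‖S ^ k‖` tends to the spectral radius, so `‖S ^ k‖` is
eventually below `r ^ k` for a fixed `r < 1`. -/
theorem tendsto_matrix_pow_zero {n : ℕ} {S : Matrix (Fin n) (Fin n) ℂ}
    (h : ∀ μ ∈ spectrum ℂ S, ‖μ‖ < 1) : Tendsto (fun k : ℕ => S ^ k) atTop (𝓝 0) := by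
  rcases subsingleton_or_nontrivial (Matrix (Fin n) (Fin n) ℂ) with hs | hs
  · exact tendsto_const_nhds.congr fun k => Subsingleton.elim _ _
  have h1 : spectralRadius ℂ S < ((1 : NNReal) : ENNReal) :=
    spectrum.spectralRadius_lt_of_forall_lt S fun z hz => by
      exact_mod_cast h z hz
  obtain ⟨r, hr1, hr2⟩ := ENNReal.lt_iff_exists_nnreal_btwn.1 h1
  have h2 := (spectrum.pow_nnnorm_pow_one_div_tendsto_nhds_spectralRadius S).eventually_lt_const hr1
  rw [tendsto_zero_iff_norm_tendsto_zero]
  have hr2' : (r : ℝ) < 1 := by exact_mod_cast hr2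
  refine squeeze_zero' (Eventually.of_forall fun _ => norm_nonneg _) ?_
    (tendsto_pow_atTop_nhds_zero_of_lt_one r.2 hr2')
  filter_upwards [h2, eventually_gt_atTop 0] with k hk hk0
  have hk' : (0 : ℝ) < k := by exact_mod_cast hk0
  have h3 := ENNReal.rpow_lt_rpow hk hk'
  rw [← ENNReal.rpow_mul, one_div, inv_mul_cancel₀ hk'.ne', ENNReal.rpow_one,
    ENNReal.rpow_natCast] at h3
  exact_mod_cast h3.le

/-- The number 1 has positive real part, so it is not an eigenvalue. This makes the Cayley transform
`(1 - A)⁻¹(1 + A)` available, whose powers do the work of the exponential `exp(tA)` below. -/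
theorem IsHurwitz.isUnit_one_sub {n : ℕ} {A : Matrix (Fin n) (Fin n) ℝ} (hA : IsHurwitz A) :
    IsUnit (1 - A) := by
  rw [Matrix.isUnit_iff_isUnit_det, isUnit_iff_ne_zero]
  intro h
  obtain ⟨x, hx, hx0⟩ := Matrix.exists_mulVec_eq_zero_iff.2 h
  have := isHurwitz_iff_eigenvector.1 hA 1 (fun i => (x i : ℂ))
    (fun h => hx (funext fun i => by simpa using congrFun h i)) (by
      rw [Matrix.sub_mulVec, Matrix.one_mulVec, sub_eq_zero] at hx0
      ext i
      have := congrFun hx0 i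
      rw [one_smul]
      conv_rhs => rw [this]
      simp [Matrix.mulVec, dotProduct])
  norm_num at this

/-- The Cayley transform of a Hurwitz matrix is a Schur matrix. -/
theorem IsHurwitz.tendsto_cayley_pow {n : ℕ} {A : Matrix (Fin n) (Fin n) ℝ} (hA : IsHurwitz A) :
    Tendsto (fun k : ℕ => ((1 - A)⁻¹ * (1 + A)) ^ k) atTop (𝓝 0) := by
  set S := (1 - A)⁻¹ * (1 + A) with hS
  have hu := hA.isUnit_one_sub
  have hu' := (Matrix.isUnit_iff_isUnit_det _).1 hu
  have hmul : (1 - A) * S = 1 + A := by rw [hS, Matrix.mul_nonsing_inv_cancel_left _ _ hu']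
  let φ : Matrix (Fin n) (Fin n) ℝ →+* Matrix (Fin n) (Fin n) ℂ := (algebraMap ℝ ℂ).mapMatrix
  have hφ : ∀ M, φ M = M.map (algebraMap ℝ ℂ) := fun M => rfl
  have hmul' : (1 - φ A) * φ S = 1 + φ A := by
    have := congrArg φ hmul
    simpa only [map_mul, map_add, map_sub, map_one] using this
  have key : Tendsto (fun k : ℕ => (φ S) ^ k) atTop (𝓝 0) := by
    apply tendsto_matrix_pow_zero
    intro μ hμ
    rw [← Matrix.spectrum_toLin', ← Module.End.hasEigenvalue_iff_mem_spectrum] at hμ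
    obtain ⟨x, hx⟩ := hμ.exists_hasEigenvector
    have hSx : φ S *ᵥ x = μ • x := by simpa using hx.apply_eq_smul
    have h1 : (1 + φ A) *ᵥ x = μ • ((1 - φ A) *ᵥ x) := by
      rw [← hmul', ← Matrix.mulVec_mulVec, hSx, Matrix.mulVec_smul]
    have h2 : (1 + μ) • (φ A *ᵥ x) = (μ - 1) • x := by
      rw [Matrix.add_mulVec, Matrix.sub_mulVec, Matrix.one_mulVec, smul_sub] at h1
      rw [add_smul, sub_smul, one_smul, one_smul]
      linear_combination h1
    have h3 : 1 + μ ≠ 0 := by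
      intro h0
      have h4 : μ = -1 := by linear_combination h0
      rw [h0, zero_smul, h4] at h2
      have : (-1 - 1 : ℂ) ≠ 0 := by norm_num
      exact hx.2 ((smul_eq_zero.1 h2.symm).resolve_left this)
    -- An eigenvalue `μ` of the transform comes from the eigenvalue `(μ - 1) / (1 + μ)` of `A`,
    -- whose real part has the sign of `|μ|² - 1`.
    have h5 := isHurwitz_iff_eigenvector.1 hA ((μ - 1) / (1 + μ)) x hx.2 (by
      rw [← hφ, div_eq_inv_mul, mul_smul, ← h2, smul_smul, inv_mul_cancel₀ h3, one_smul])
    rw [Complex.div_re] at h5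
    have h6 : 0 < Complex.normSq (1 + μ) := Complex.normSq_pos.2 h3
    have h7 : (μ - 1).re * (1 + μ).re + (μ - 1).im * (1 + μ).im < 0 := by
      rw [← add_div, div_lt_iff₀ h6] at h5
      simpa using h5
    have h8 : ‖μ‖ ^ 2 < 1 := by
      rw [← Complex.normSq_eq_norm_sq, Complex.normSq_apply]
      simp at h7
      nlinarith
    nlinarith [norm_nonneg μ]
  have h9 : ∀ k i j, (((S ^ k) i j : ℝ) : ℂ) = ((φ S) ^ k) i j := fun k i j => by
    rw [← map_pow]; rfl
  refine tendsto_pi_nhds.2 fun i => tendsto_pi_nhds.2 fun j => ?_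
  have h10 : Tendsto (fun k => ((φ S) ^ k) i j) atTop (𝓝 0) :=
    tendsto_pi_nhds.1 (tendsto_pi_nhds.1 key i) j
  have h11 := (Complex.continuous_re.tendsto 0).comp h10
  simpa [Function.comp_def, ← h9] using h11

/-- Expanding `(1 - A)ᵀX(1 - A') - (1 + A)ᵀX(1 + A')` leaves `-2(AᵀX + XA')`. The Sylvester equation
thus becomes a Stein equation, which can be iterated with powers that tend to zero. -/
theorem IsHurwitz.cayley_identity {n m : ℕ} {A : Matrix (Fin n) (Fin n) ℝ}
    {A' : Matrix (Fin m) (Fin m) ℝ} (hA : IsHurwitz A) (hA' : IsHurwitz A')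
    (X : Matrix (Fin n) (Fin m) ℝ) :
    X - ((1 - A)⁻¹ * (1 + A))ᵀ * X * ((1 - A')⁻¹ * (1 + A')) =
      (-2 : ℝ) • (((1 - A)⁻¹)ᵀ * (Aᵀ * X + X * A') * (1 - A')⁻¹) := by
  have hu := (Matrix.isUnit_iff_isUnit_det _).1 hA.isUnit_one_sub
  have hu' := (Matrix.isUnit_iff_isUnit_det _).1 hA'.isUnit_one_sub
  have hc : (1 - A)⁻¹ * (1 + A) = (1 + A) * (1 - A)⁻¹ := by
    have : Commute (1 - A) (1 + A) := by
      simp only [commute_iff_eq]; noncomm_ring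
    calc (1 - A)⁻¹ * (1 + A) = (1 - A)⁻¹ * ((1 + A) * (1 - A)) * (1 - A)⁻¹ := by
          rw [Matrix.mul_assoc, Matrix.mul_assoc, Matrix.mul_nonsing_inv _ hu, Matrix.mul_one]
      _ = _ := by rw [← this.eq, Matrix.nonsing_inv_mul_cancel_left _ _ hu]
  have hc' : (1 - A')⁻¹ * (1 + A') = (1 + A') * (1 - A')⁻¹ := by
    have : Commute (1 - A') (1 + A') := by
      simp only [commute_iff_eq]; noncomm_ring
    calc (1 - A')⁻¹ * (1 + A') = (1 - A')⁻¹ * ((1 + A') * (1 - A')) * (1 - A')⁻¹ := by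
          rw [Matrix.mul_assoc, Matrix.mul_assoc, Matrix.mul_nonsing_inv _ hu', Matrix.mul_one]
      _ = _ := by rw [← this.eq, Matrix.nonsing_inv_mul_cancel_left _ _ hu']
  have hX : X = ((1 - A)⁻¹)ᵀ * ((1 - A)ᵀ * X * (1 - A')) * (1 - A')⁻¹ := by
    have : ((1 - A)⁻¹)ᵀ * (1 - A)ᵀ = 1 := by
      rw [← Matrix.transpose_mul, Matrix.mul_nonsing_inv _ hu, Matrix.transpose_one]
    rw [Matrix.mul_assoc, Matrix.mul_assoc, Matrix.mul_nonsing_inv _ hu', Matrix.mul_one,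
      ← Matrix.mul_assoc, this, Matrix.one_mul]
  have hY : ((1 - A)⁻¹ * (1 + A))ᵀ * X * ((1 - A')⁻¹ * (1 + A')) =
      ((1 - A)⁻¹)ᵀ * ((1 + A)ᵀ * X * (1 + A')) * (1 - A')⁻¹ := by
    rw [hc, hc', Matrix.transpose_mul]
    simp only [Matrix.mul_assoc]
  rw [hY]
  nth_rewrite 1 [hX]
  rw [← Matrix.sub_mul, ← Matrix.mul_sub, ← Matrix.smul_mul, ← Matrix.mul_smul]
  congr 2
  simp only [Matrix.transpose_sub, Matrix.transpose_add, Matrix.transpose_one, Matrix.sub_mul,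
    Matrix.add_mul, Matrix.mul_sub, Matrix.mul_add, Matrix.one_mul, Matrix.mul_one]
  module

/-- A homogeneous Sylvester equation with Hurwitz coefficients has only the zero solution. -/
theorem IsHurwitz.sylvester_eq_zero {n m : ℕ} {A : Matrix (Fin n) (Fin n) ℝ}
    {A' : Matrix (Fin m) (Fin m) ℝ} (hA : IsHurwitz A) (hA' : IsHurwitz A')
    {X : Matrix (Fin n) (Fin m) ℝ} (h : Aᵀ * X + X * A' = 0) : X = 0 := by
  have h1 := hA.cayley_identity hA' X
  rw [h, Matrix.mul_zero, Matrix.zero_mul, smul_zero, sub_eq_zero] at h1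
  have hT := hA.tendsto_cayley_pow
  have hT' := hA'.tendsto_cayley_pow
  generalize (1 - A)⁻¹ * (1 + A) = S at h1 hT
  generalize (1 - A')⁻¹ * (1 + A') = S' at h1 hT'
  -- The homogeneous Stein equation reproduces `X` under iteration, while both outer factors tend to
  -- zero.
  have h2 : ∀ k : ℕ, X = (S ^ k)ᵀ * X * S' ^ k := by
    intro k
    induction k with
    | zero => simp
    | succ k ih =>
      nth_rewrite 1 [h1]
      nth_rewrite 1 [ih]
      rw [pow_succ S', pow_succ S, Matrix.transpose_mul]
      simp only [Matrix.mul_assoc]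
  have h3 : Tendsto (fun k : ℕ => (S ^ k, S' ^ k)) atTop (𝓝 (0, 0)) := hT.prodMk_nhds hT'
  have hc : Continuous fun M : Matrix (Fin n) (Fin n) ℝ × Matrix (Fin m) (Fin m) ℝ =>
      M.1ᵀ * X * M.2 := by fun_prop
  have h4 := (hc.tendsto (0, 0)).comp h3
  simp only [Function.comp_def, ← h2, Matrix.mul_zero] at h4
  exact tendsto_nhds_unique tendsto_const_nhds h4

/-- The solution of the Lyapunov equation `AᵀP + PA = -M` with `M ≥ 0` is `≥ 0`. -/
theorem IsHurwitz.posSemidef_of_lyapunov {n : ℕ} {A : Matrix (Fin n) (Fin n) ℝ} (hA : IsHurwitz A)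
    {P M : Matrix (Fin n) (Fin n) ℝ} (hP : P.IsSymm) (hM : M.PosSemidef)
    (h : Aᵀ * P + P * A = -M) : P.PosSemidef := by
  have h1 := hA.cayley_identity hA P
  have hT := hA.tendsto_cayley_pow
  rw [h] at h1
  generalize (1 - A)⁻¹ * (1 + A) = S at h1 hT
  have h2 : (P - Sᵀ * P * S).PosSemidef := by
    rw [h1]
    have := (hM.conjTranspose_mul_mul_same (1 - A)⁻¹).smul (show (0 : ℝ) ≤ 2 by norm_num)
    simpa [Matrix.conjTranspose_eq_transpose_of_trivial] using this
  -- The form of `P` does not increase along `x, S x, S² x, …`, and it tends to 0 there, so it was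
  -- nonnegative at the start.
  have h3 : ∀ (k : ℕ) (x : Fin n → ℝ), x ⬝ᵥ (((S ^ k)ᵀ * P * S ^ k) *ᵥ x) ≤ x ⬝ᵥ (P *ᵥ x) := by
    intro k
    induction k with
    | zero => simp
    | succ k ih =>
      intro x
      have h4 := ih (S *ᵥ x)
      have h5 : 0 ≤ x ⬝ᵥ ((P - Sᵀ * P * S) *ᵥ x) := by
        simpa using h2.dotProduct_mulVec_nonneg x
      have h6 : ∀ T : Matrix (Fin n) (Fin n) ℝ,
          (S *ᵥ x) ⬝ᵥ (T *ᵥ (S *ᵥ x)) = x ⬝ᵥ ((Sᵀ * T * S) *ᵥ x) := by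
        intro T
        rw [Matrix.mul_assoc, ← Matrix.mulVec_mulVec, ← Matrix.mulVec_mulVec,
          Matrix.dotProduct_mulVec x, Matrix.vecMul_transpose]
      rw [h6, h6] at h4
      rw [Matrix.sub_mulVec, dotProduct_sub] at h5
      rw [pow_succ, Matrix.transpose_mul]
      simp only [Matrix.mul_assoc] at h4 h5 ⊢
      linarith
  refine Matrix.PosSemidef.of_dotProduct_mulVec_nonneg ?_ fun x => ?_
  · rw [Matrix.IsHermitian, Matrix.conjTranspose_eq_transpose_of_trivial]; exact hP
  have h7 : Tendsto (fun k : ℕ => x ⬝ᵥ (((S ^ k)ᵀ * P * S ^ k) *ᵥ x)) atTop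
      (𝓝 (x ⬝ᵥ (((0 : Matrix (Fin n) (Fin n) ℝ)ᵀ * P * (0 : Matrix (Fin n) (Fin n) ℝ)) *ᵥ x))) := by
    have hc : Continuous fun T : Matrix (Fin n) (Fin n) ℝ => x ⬝ᵥ ((Tᵀ * P * T) *ᵥ x) := by
      fun_prop
    exact (hc.tendsto 0).comp hT
  have h8 := le_of_tendsto' h7 fun k => h3 k x
  simpa using h8

/-- The Lyapunov operator is an injective endomorphism of a finite-dimensional space, hence
surjective. -/
theorem IsHurwitz.exists_lyapunov_solution {n : ℕ} {A : Matrix (Fin n) (Fin n) ℝ} (hA : IsHurwitz A)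
    (M : Matrix (Fin n) (Fin n) ℝ) : ∃ P, Aᵀ * P + P * A = -M := by
  let L : Matrix (Fin n) (Fin n) ℝ →ₗ[ℝ] Matrix (Fin n) (Fin n) ℝ :=
    LinearMap.mulLeft ℝ Aᵀ + LinearMap.mulRight ℝ A
  have hL : Function.Injective L := by
    rw [← LinearMap.ker_eq_bot, LinearMap.ker_eq_bot']
    intro P hP
    exact hA.sylvester_eq_zero hA hP
  obtain ⟨P, hP⟩ := (LinearMap.injective_iff_surjective.1 hL) (-M)
  exact ⟨P, hP⟩

/-! ### Policy iteration and the Riccati equation -/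

section
open scoped ComplexOrder

/-- A real matrix, regarded as a complex matrix. -/
noncomputable abbrev Matrix.toComplex {α β : Type*} (M : Matrix α β ℝ) : Matrix α β ℂ := M.map (algebraMap ℝ ℂ)

theorem Matrix.toComplex_mul {α β γ : Type*} [Fintype β] (M : Matrix α β ℝ) (N : Matrix β γ ℝ) :
    (M * N).toComplex = M.toComplex * N.toComplex := Matrix.map_mul

theorem Matrix.toComplex_add {α β : Type*} (M N : Matrix α β ℝ) :
    (M + N).toComplex = M.toComplex + N.toComplex := Matrix.map_add _ (map_add _) _ _

theorem Matrix.toComplex_neg {α β : Type*} (M : Matrix α β ℝ) :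
    (-M).toComplex = -M.toComplex := Matrix.map_neg _ (map_neg _) _

theorem Matrix.toComplex_transpose {α β : Type*} (M : Matrix α β ℝ) :
    Mᵀ.toComplex = M.toComplexᴴ := by
  ext i j; simp [Matrix.conjTranspose_apply]

theorem Matrix.PosSemidef.toComplex {α : Type*} [Fintype α] [DecidableEq α] {M : Matrix α α ℝ}
    (hM : M.PosSemidef) : M.toComplex.PosSemidef := by
  obtain ⟨B, rfl⟩ := CStarAlgebra.nonneg_iff_eq_star_mul_self.1
    (Matrix.nonneg_iff_posSemidef.2 hM)
  rw [Matrix.star_eq_conjTranspose, Matrix.conjTranspose_eq_transpose_of_trivial,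
    Matrix.toComplex_mul, Matrix.toComplex_transpose]
  exact Matrix.posSemidef_conjTranspose_mul_self _

theorem Matrix.toComplex_mulVec_re {α β : Type*} [Fintype β] (M : Matrix α β ℝ) (x : β → ℂ) (i : α) :
    ((M.toComplex *ᵥ x) i).re = (M *ᵥ fun j => (x j).re) i := by
  simp [Matrix.mulVec, dotProduct]

theorem Matrix.toComplex_mulVec_im {α β : Type*} [Fintype β] (M : Matrix α β ℝ) (x : β → ℂ) (i : α) :
    ((M.toComplex *ᵥ x) i).im = (M *ᵥ fun j => (x j).im) i := by
  simp [Matrix.mulVec, dotProduct]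

/-- One direction of the Hautus test: `C A^k x = μ^k C x = 0` for all `k`, so the real and the
imaginary part of `x` are real unobservable states. -/
theorem IsObservable.eq_zero_of_eigenvector {n p : ℕ} {C : Matrix (Fin p) (Fin n) ℝ}
    {A : Matrix (Fin n) (Fin n) ℝ} (h : IsObservable C A) {μ : ℂ} {x : Fin n → ℂ}
    (hA : A.toComplex *ᵥ x = μ • x) (hC : C.toComplex *ᵥ x = 0) : x = 0 := by
  have h1 : ∀ k : ℕ, (C * A ^ k).toComplex *ᵥ x = 0 := by
    intro k
    have h2 : (A ^ k).toComplex *ᵥ x = μ ^ k • x := by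
      induction k with
      | zero => simp [Matrix.toComplex]
      | succ k ih =>
        rw [pow_succ, Matrix.toComplex_mul, ← Matrix.mulVec_mulVec, hA, Matrix.mulVec_smul, ih,
          smul_smul, pow_succ']
    rw [Matrix.toComplex_mul, ← Matrix.mulVec_mulVec, h2, Matrix.mulVec_smul, hC, smul_zero]
  have hre := h (fun j => (x j).re) fun k => funext fun i => by
    rw [← Matrix.toComplex_mulVec_re, h1]; rfl
  have him := h (fun j => (x j).im) fun k => funext fun i => by
    rw [← Matrix.toComplex_mulVec_im, h1]; rfl
  ext j
  exact Complex.ext (congrFun hre j) (congrFun him j)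

section
variable {n m p : ℕ} {A : Matrix (Fin n) (Fin n) ℝ} {B : Matrix (Fin n) (Fin m) ℝ}
  {C : Matrix (Fin p) (Fin n) ℝ} {Q : Matrix (Fin p) (Fin p) ℝ} {R : Matrix (Fin m) (Fin m) ℝ}

/-- Testing the equation on a closed-loop eigenvector `x` equates `2 Re μ · x*Px` with minus a sum
of three nonnegative terms. If `Re μ ≥ 0`, all three vanish; then `K x = 0` and `√Q C x = 0`, so `x`
is an eigenvector of `A` itself and observability kills it. The slack `M` leaves room for the square
that policy improvement produces. -/
theorem isStabilizingGain_of_lyapunov (hQ : Q.PosSemidef) (hR : R.PosDef)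
    (hobs : IsObservable (CFC.sqrt Q * C) A) {K : Matrix (Fin m) (Fin n) ℝ}
    {P M : Matrix (Fin n) (Fin n) ℝ} (hP : P.PosSemidef) (hM : M.PosSemidef)
    (h : (A - B * K)ᵀ * P + P * (A - B * K) = -(Cᵀ * Q * C + Kᵀ * R * K + M)) :
    IsStabilizingGain A B K := by
  refine isHurwitz_iff_eigenvector.2 fun μ x hx hAx => ?_
  by_contra! hμ
  apply hx
  set S := CFC.sqrt Q with hS
  have hSS : S * S = Q := CFC.sqrt_mul_sqrt_self Q (Matrix.nonneg_iff_posSemidef.2 hQ)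
  have hSt : Sᵀ = S := by
    have := (Matrix.nonneg_iff_posSemidef.1 (CFC.sqrt_nonneg Q)).1
    rwa [Matrix.IsHermitian, Matrix.conjTranspose_eq_transpose_of_trivial] at this
  have hQC : Cᵀ * Q * C = (S * C)ᵀ * (S * C) := by
    rw [Matrix.transpose_mul, hSt, ← hSS]; simp only [Matrix.mul_assoc]
  set F := A - B * K with hF
  have h1 : F.toComplexᴴ * P.toComplex + P.toComplex * F.toComplex =
      -(((S * C).toComplexᴴ * (S * C).toComplex) +
        K.toComplexᴴ * R.toComplex * K.toComplex + M.toComplex) := by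
    rw [hQC] at h
    have := congrArg Matrix.toComplex h
    simpa only [Matrix.toComplex_add, Matrix.toComplex_neg, Matrix.toComplex_mul F.transpose,
      Matrix.toComplex_mul P, Matrix.toComplex_mul (S * C).transpose,
      Matrix.toComplex_mul (K.transpose * R), Matrix.toComplex_mul K.transpose,
      Matrix.toComplex_transpose] using this
  have hP' := hP.toComplex.dotProduct_mulVec_nonneg x
  have hT1 := (Matrix.posSemidef_conjTranspose_mul_self (S * C).toComplex)
  have hT2 := hR.posSemidef.toComplex.conjTranspose_mul_mul_same K.toComplex
  have hT3 := hM.toComplex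
  have e1 := hT1.dotProduct_mulVec_nonneg x
  have e2 := hT2.dotProduct_mulVec_nonneg x
  have e3 := hT3.dotProduct_mulVec_nonneg x
  have h2 := congrArg (fun T => star x ⬝ᵥ (T *ᵥ x)) h1
  simp only [Matrix.add_mulVec, Matrix.neg_mulVec, dotProduct_add, dotProduct_neg] at h2
  have h3 : star x ⬝ᵥ ((F.toComplexᴴ * P.toComplex) *ᵥ x) =
      star μ * (star x ⬝ᵥ (P.toComplex *ᵥ x)) := by
    rw [← Matrix.mulVec_mulVec, Matrix.dotProduct_mulVec, ← Matrix.star_mulVec, hAx, star_smul,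
      smul_dotProduct, smul_eq_mul]
  have h4 : star x ⬝ᵥ ((P.toComplex * F.toComplex) *ᵥ x) =
      μ * (star x ⬝ᵥ (P.toComplex *ᵥ x)) := by
    rw [← Matrix.mulVec_mulVec, hAx, Matrix.mulVec_smul, dotProduct_smul, smul_eq_mul]
  rw [h3, h4] at h2
  rw [Complex.le_def] at hP' e1 e2 e3
  have h5 := congrArg Complex.re h2
  simp only [Complex.add_re, Complex.neg_re, Complex.mul_re, Complex.star_def, Complex.conj_re,
    Complex.conj_im, Complex.zero_re, Complex.zero_im] at h5 hP' e1 e2 e3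
  have h6 : 0 ≤ μ.re * (star x ⬝ᵥ (P.toComplex *ᵥ x)).re := mul_nonneg hμ hP'.1
  have z1 : star x ⬝ᵥ (((S * C).toComplexᴴ * (S * C).toComplex) *ᵥ x) = 0 :=
    Complex.ext (by rw [Complex.zero_re]; linarith) e1.2.symm
  have z2 : star x ⬝ᵥ ((K.toComplexᴴ * R.toComplex * K.toComplex) *ᵥ x) = 0 :=
    Complex.ext (by rw [Complex.zero_re]; linarith) e2.2.symm
  rw [hT1.dotProduct_mulVec_zero_iff, Matrix.conjTranspose_mul_self_mulVec_eq_zero] at z1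
  have z3 : K.toComplex *ᵥ x = 0 := by
    rw [← Matrix.mulVec_mulVec, ← Matrix.mulVec_mulVec, Matrix.dotProduct_mulVec,
      ← Matrix.star_mulVec, hR.posSemidef.toComplex.dotProduct_mulVec_zero_iff] at z2
    have hu := (Matrix.isUnit_iff_isUnit_det _).1 hR.isUnit
    have := congrArg (fun y => (R⁻¹).toComplex *ᵥ y) z2
    simp only [Matrix.mulVec_mulVec, Matrix.mulVec_zero] at this
    rw [← Matrix.mul_assoc, ← Matrix.toComplex_mul, Matrix.nonsing_inv_mul _ hu] at this
    simpa [Matrix.toComplex] using this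
  refine hobs.eq_zero_of_eigenvector (μ := μ) ?_ z1
  have h7 : A = F + B * K := by rw [hF]; abel
  rw [h7, Matrix.toComplex_add, Matrix.add_mulVec]
  rw [Matrix.toComplex_mul, ← Matrix.mulVec_mulVec, z3, Matrix.mulVec_zero, add_zero]
  exact hAx

/-- The equation of policy evaluation for the gain `K`. -/
def IsPolicyValue (A : Matrix (Fin n) (Fin n) ℝ) (B : Matrix (Fin n) (Fin m) ℝ)
    (C : Matrix (Fin p) (Fin n) ℝ) (Q : Matrix (Fin p) (Fin p) ℝ) (R : Matrix (Fin m) (Fin m) ℝ)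
    (K : Matrix (Fin m) (Fin n) ℝ) (P : Matrix (Fin n) (Fin n) ℝ) : Prop :=
  (A - B * K)ᵀ * P + P * (A - B * K) = -(Cᵀ * Q * C + Kᵀ * R * K)

theorem Matrix.PosSemidef.transpose_mul_mul {α β : Type*} [Fintype α] [Fintype β]
    {M : Matrix α α ℝ} (hM : M.PosSemidef) (K : Matrix α β ℝ) :
    (Kᵀ * M * K).PosSemidef := by
  simpa [Matrix.conjTranspose_eq_transpose_of_trivial] using hM.conjTranspose_mul_mul_same K

theorem Matrix.PosSemidef.isSymm {α : Type*} {M : Matrix α α ℝ} (hM : M.PosSemidef) :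
    M.IsSymm := by
  have := hM.1
  rwa [Matrix.IsHermitian, Matrix.conjTranspose_eq_transpose_of_trivial] at this

theorem IsStabilizingGain.exists_policyValue {K : Matrix (Fin m) (Fin n) ℝ}
    (hK : IsStabilizingGain A B K) (hQ : Q.PosSemidef) (hR : R.PosDef) :
    ∃ P, P.PosSemidef ∧ IsPolicyValue A B C Q R K P := by
  obtain ⟨P, hP⟩ := IsHurwitz.exists_lyapunov_solution hK (Cᵀ * Q * C + Kᵀ * R * K)
  have hM : (Cᵀ * Q * C + Kᵀ * R * K).PosSemidef :=
    (hQ.transpose_mul_mul C).add (hR.posSemidef.transpose_mul_mul K)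
  refine ⟨P, IsHurwitz.posSemidef_of_lyapunov hK ?_ hM hP, hP⟩
  -- Symmetry comes from uniqueness: `Pᵀ` solves the same Lyapunov equation.
  have h1 := congrArg Matrix.transpose hP
  rw [Matrix.transpose_add, Matrix.transpose_mul, Matrix.transpose_mul, Matrix.transpose_transpose,
    Matrix.transpose_neg, hM.isSymm.eq] at h1
  refine sub_eq_zero.1 (IsHurwitz.sylvester_eq_zero hK hK ?_)
  rw [Matrix.mul_sub, Matrix.sub_mul, sub_add_sub_comm, sub_eq_zero, hP, add_comm, h1]

/-- Completing the square. With `L = R⁻¹BᵀP` one has `BᵀP = RL`, so a gain `X` enters the left side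
only through `-XᵀRL - LᵀRX`; passing from `X = K` to `X = L` releases `(K - L)ᵀR(K - L)`. -/
theorem IsPolicyValue.improved (hR : R.PosDef) {K : Matrix (Fin m) (Fin n) ℝ}
    {P : Matrix (Fin n) (Fin n) ℝ} (hPs : P.IsSymm) (hP : IsPolicyValue A B C Q R K P) :
    (A - B * (R⁻¹ * Bᵀ * P))ᵀ * P + P * (A - B * (R⁻¹ * Bᵀ * P)) =
      -(Cᵀ * Q * C + (R⁻¹ * Bᵀ * P)ᵀ * R * (R⁻¹ * Bᵀ * P) +
        (K - R⁻¹ * Bᵀ * P)ᵀ * R * (K - R⁻¹ * Bᵀ * P)) := by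
  have hu := (Matrix.isUnit_iff_isUnit_det _).1 hR.isUnit
  have hRs : Rᵀ = R := hR.posSemidef.isSymm
  set L := R⁻¹ * Bᵀ * P with hL
  have h1 : Bᵀ * P = R * L := by
    rw [hL, Matrix.mul_assoc, Matrix.mul_nonsing_inv_cancel_left _ _ hu]
  have h2 : P * B = Lᵀ * R := by
    have := congrArg Matrix.transpose h1
    rwa [Matrix.transpose_mul, Matrix.transpose_mul, Matrix.transpose_transpose, hPs.eq, hRs]
      at this
  have h3 : ∀ X : Matrix (Fin m) (Fin n) ℝ, (A - B * X)ᵀ * P + P * (A - B * X) =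
      Aᵀ * P + P * A - Xᵀ * R * L - Lᵀ * R * X := by
    intro X
    rw [Matrix.transpose_sub, Matrix.transpose_mul, Matrix.sub_mul, Matrix.mul_sub,
      Matrix.mul_assoc, h1, ← Matrix.mul_assoc P, h2, Matrix.mul_assoc Xᵀ R L]
    abel
  have h4 := hP
  rw [IsPolicyValue, h3] at h4
  have h5 : Aᵀ * P + P * A = Kᵀ * R * L + Lᵀ * R * K - (Cᵀ * Q * C + Kᵀ * R * K) := by
    rw [← sub_eq_zero] at h4 ⊢
    rw [← h4]; abel
  rw [h3, h5]
  simp only [Matrix.transpose_sub, Matrix.sub_mul, Matrix.mul_sub]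
  abel

theorem IsPolicyValue.isStabilizingGain_improved (hQ : Q.PosSemidef) (hR : R.PosDef)
    (hobs : IsObservable (CFC.sqrt Q * C) A) {K : Matrix (Fin m) (Fin n) ℝ}
    {P : Matrix (Fin n) (Fin n) ℝ} (hPp : P.PosSemidef) (hP : IsPolicyValue A B C Q R K P) :
    IsStabilizingGain A B (R⁻¹ * Bᵀ * P) :=
  isStabilizingGain_of_lyapunov hQ hR hobs hPp (hR.posSemidef.transpose_mul_mul _)
    (hP.improved hR hPp.isSymm)

/-- Both values satisfy Lyapunov equations for the improved closed loop, the old one with the extra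
square. The difference therefore solves a Lyapunov equation whose source is that square. -/
theorem IsPolicyValue.antitone (hQ : Q.PosSemidef) (hR : R.PosDef)
    (hobs : IsObservable (CFC.sqrt Q * C) A) {K : Matrix (Fin m) (Fin n) ℝ}
    {P P' : Matrix (Fin n) (Fin n) ℝ} (hPp : P.PosSemidef) (hP : IsPolicyValue A B C Q R K P)
    (hPp' : P'.PosSemidef) (hP' : IsPolicyValue A B C Q R (R⁻¹ * Bᵀ * P) P') :
    (P - P').PosSemidef := by
  refine IsHurwitz.posSemidef_of_lyapunov (hP.isStabilizingGain_improved hQ hR hobs hPp)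
    (hPp.isSymm.sub hPp'.isSymm)
    (hR.posSemidef.transpose_mul_mul (K - R⁻¹ * Bᵀ * P)) ?_
  have h1 := hP.improved hR hPp.isSymm
  rw [IsPolicyValue] at hP'
  rw [Matrix.mul_sub, Matrix.sub_mul, sub_add_sub_comm, h1, hP']
  abel

/-- A sequence of positive semidefinite matrices that decreases in the Loewner order converges. -/
theorem exists_tendsto_of_posSemidef_sub {P : ℕ → Matrix (Fin n) (Fin n) ℝ}
    (h0 : ∀ k, (P k).PosSemidef) (h : ∀ k, (P k - P (k + 1)).PosSemidef) :
    ∃ L, L.PosSemidef ∧ Tendsto P atTop (𝓝 L) := by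
  have hq : ∀ x : Fin n → ℝ, ∃ l, Tendsto (fun k => x ⬝ᵥ (P k *ᵥ x)) atTop (𝓝 l) := by
    intro x
    refine ⟨_, tendsto_atTop_ciInf (antitone_nat_of_succ_le fun k => ?_) ⟨0, ?_⟩⟩
    · have := (h k).dotProduct_mulVec_nonneg x
      rw [Matrix.sub_mulVec, dotProduct_sub] at this
      simpa using this
    · rintro _ ⟨k, rfl⟩
      simpa using (h0 k).dotProduct_mulVec_nonneg x
  have he : ∀ i j, ∃ l, Tendsto (fun k => P k i j) atTop (𝓝 l) := by
    intro i j
    -- Polarization recovers the entries of a symmetric matrix from its quadratic form.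
    obtain ⟨l1, h1⟩ := hq (Pi.single i 1 + Pi.single j 1)
    obtain ⟨l2, h2⟩ := hq (Pi.single i 1)
    obtain ⟨l3, h3⟩ := hq (Pi.single j 1)
    refine ⟨(l1 - l2 - l3) / 2, (((h1.sub h2).sub h3).div_const 2).congr fun k => ?_⟩
    have hs := (h0 k).isSymm.apply i j
    simp [Matrix.mulVec_add, add_dotProduct, dotProduct_add]
    rw [hs]; ring
  choose L hL using he
  have hT : Tendsto P atTop (𝓝 (Matrix.of L)) :=
    tendsto_pi_nhds.2 fun i => tendsto_pi_nhds.2 fun j => hL i j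
  refine ⟨Matrix.of L, ?_, hT⟩
  refine Matrix.PosSemidef.of_dotProduct_mulVec_nonneg ?_ fun x => ?_
  · rw [Matrix.IsHermitian, Matrix.conjTranspose_eq_transpose_of_trivial]
    ext i j
    exact tendsto_nhds_unique ((hL j i).congr fun k => ((h0 k).isSymm.apply i j)) (hL i j)
  · have hc : Continuous fun T : Matrix (Fin n) (Fin n) ℝ => x ⬝ᵥ (T *ᵥ x) := by fun_prop
    exact ge_of_tendsto' ((hc.tendsto _).comp hT) fun k => by
      simpa using (h0 k).dotProduct_mulVec_nonneg x

/-- Subtracting the two Riccati equations gives a homogeneous Sylvester equation for `P - P'`, with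
the closed loop of `P` on the left and that of `P'` on the right; both are Hurwitz. -/
theorem IsStabilizingRiccatiSolution.unique {P P' : Matrix (Fin n) (Fin n) ℝ} (hR : R.PosDef)
    (hP : IsStabilizingRiccatiSolution A B C Q R P)
    (hP' : IsStabilizingRiccatiSolution A B C Q R P') : P' = P := by
  obtain ⟨hs, he, hst⟩ := hP
  obtain ⟨hs', he', hst'⟩ := hP'
  symm
  refine sub_eq_zero.1 (IsHurwitz.sylvester_eq_zero hst hst' ?_)
  have hRs : (R⁻¹)ᵀ = R⁻¹ := by
    rw [Matrix.transpose_nonsing_inv, hR.posSemidef.isSymm.eq]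
  rw [← sub_eq_zero_of_eq (he.trans he'.symm)]
  simp only [Matrix.transpose_sub, Matrix.transpose_mul, Matrix.transpose_transpose, hRs, hs.eq,
    Matrix.sub_mul, Matrix.mul_sub, ← Matrix.mul_assoc]
  abel

/-- Kleinman's policy iteration: values, with gains `K 0 = K₀` and `K (k + 1) = R⁻¹BᵀP k`. -/
theorem exists_policyIteration (hQ : Q.PosSemidef) (hR : R.PosDef)
    (hobs : IsObservable (CFC.sqrt Q * C) A) {K₀ : Matrix (Fin m) (Fin n) ℝ}
    (hK₀ : IsStabilizingGain A B K₀) :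
    ∃ (P : ℕ → Matrix (Fin n) (Fin n) ℝ) (K : ℕ → Matrix (Fin m) (Fin n) ℝ)
      (Pstar : Matrix (Fin n) (Fin n) ℝ), K 0 = K₀ ∧ (∀ k, K (k + 1) = R⁻¹ * Bᵀ * P k) ∧
      (∀ k, (P k).IsSymm) ∧ (∀ k, IsStabilizingGain A B (K k)) ∧
      (∀ k, IsPolicyValue A B C Q R (K k) (P k)) ∧
      IsStabilizingRiccatiSolution A B C Q R Pstar ∧
      Tendsto P atTop (𝓝 Pstar) ∧ Tendsto K atTop (𝓝 (R⁻¹ * Bᵀ * Pstar)) := by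
  choose! val hval hval' using fun (K : Matrix (Fin m) (Fin n) ℝ) (hK : IsStabilizingGain A B K) =>
    hK.exists_policyValue (C := C) hQ hR
  let K : ℕ → Matrix (Fin m) (Fin n) ℝ := fun k => Nat.rec K₀ (fun _ X => R⁻¹ * Bᵀ * val X) k
  have hKs : ∀ k, K (k + 1) = R⁻¹ * Bᵀ * val (K k) := fun k => rfl
  have hst : ∀ k, IsStabilizingGain A B (K k) := by
    intro k
    induction k with
    | zero => exact hK₀
    | succ k ih =>
      rw [hKs]
      exact (hval' _ ih).isStabilizingGain_improved hQ hR hobs (hval _ ih)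
  obtain ⟨L, hL, hT⟩ := exists_tendsto_of_posSemidef_sub (P := fun k => val (K k))
    (fun k => hval _ (hst k)) fun k => (hval' _ (hst k)).antitone hQ hR hobs (hval _ (hst k))
      (hval _ (hst (k + 1))) (hval' _ (hst (k + 1)))
  have hTK : Tendsto K atTop (𝓝 (R⁻¹ * Bᵀ * L)) := by
    rw [← tendsto_add_atTop_iff_nat 1]
    have hc : Continuous fun T : Matrix (Fin n) (Fin n) ℝ => R⁻¹ * Bᵀ * T := by fun_prop
    exact (hc.tendsto _).comp hT
  have hlim : IsPolicyValue A B C Q R (R⁻¹ * Bᵀ * L) L := by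
    have hc : Continuous fun T : Matrix (Fin m) (Fin n) ℝ × Matrix (Fin n) (Fin n) ℝ =>
        (A - B * T.1)ᵀ * T.2 + T.2 * (A - B * T.1) + (Cᵀ * Q * C + T.1ᵀ * R * T.1) := by fun_prop
    have h1 := (hc.tendsto (R⁻¹ * Bᵀ * L, L)).comp (hTK.prodMk_nhds hT)
    have h2 : ∀ k, (A - B * K k)ᵀ * val (K k) + val (K k) * (A - B * K k) +
        (Cᵀ * Q * C + (K k)ᵀ * R * K k) = 0 := fun k => by
      have := hval' _ (hst k)
      rw [IsPolicyValue] at this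
      rw [this, neg_add_cancel]
    simp only [Function.comp_def, h2] at h1
    exact eq_neg_of_add_eq_zero_left (tendsto_nhds_unique h1 tendsto_const_nhds)
  refine ⟨fun k => val (K k), K, L, rfl, hKs, fun k => (hval _ (hst k)).isSymm, hst,
    fun k => hval' _ (hst k), ⟨hL.isSymm, ?_,
      hlim.isStabilizingGain_improved hQ hR hobs hL⟩, hT, hTK⟩
  have hRs : (R⁻¹)ᵀ = R⁻¹ := by
    rw [Matrix.transpose_nonsing_inv, hR.posSemidef.isSymm.eq]
  have hu := (Matrix.isUnit_iff_isUnit_det _).1 hR.isUnit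
  -- At the limit the gain is the one induced by its own value, and this turns the policy equation
  -- into the Riccati equation.
  have h3 : (R⁻¹ * Bᵀ * L)ᵀ * R * (R⁻¹ * Bᵀ * L) = L * B * R⁻¹ * Bᵀ * L := by
    simp only [Matrix.transpose_mul, Matrix.transpose_transpose, hRs, hL.isSymm.eq,
      Matrix.mul_assoc, Matrix.mul_nonsing_inv_cancel_left _ _ hu]
  have h4 := hlim
  rw [IsPolicyValue, h3, ← sub_eq_zero] at h4
  rw [← h4]
  simp only [Matrix.transpose_sub, Matrix.transpose_mul, Matrix.transpose_transpose, hRs,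
    hL.isSymm.eq, Matrix.sub_mul, Matrix.mul_sub, ← Matrix.mul_assoc]
  abel

end

end

/-! ### The integral identity satisfied by the data -/

theorem intervalIntegrable_finset_sum {ι : Type*} [Fintype ι] {f : ι → ℝ → ℝ} {a b : ℝ}
    (h : ∀ i, IntervalIntegrable (f i) volume a b) :
    IntervalIntegrable (fun τ => ∑ i, f i τ) volume a b := by
  have := IntervalIntegrable.sum Finset.univ fun i _ => h i
  rwa [Finset.sum_fn] at this

/-- Integration by parts on a subinterval for indefinite integrals of integrable functions. -/
theorem integral_mul_of_primitive {a b α β : ℝ} {f g F G : ℝ → ℝ}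
    (hf : IntervalIntegrable f volume a b) (hg : IntervalIntegrable g volume a b)
    (hF : ∀ t ∈ Set.Icc a b, F t = F a + ∫ τ in a..t, f τ)
    (hG : ∀ t ∈ Set.Icc a b, G t = G a + ∫ τ in a..t, g τ)
    (hα : α ∈ Set.Icc a b) (hβ : β ∈ Set.Icc a b) :
    F β * G β - F α * G α = ∫ τ in α..β, f τ * G τ + F τ * g τ := by
  have hab : a ≤ b := hα.1.trans hα.2
  have ha : a ∈ Set.uIcc a b := Set.left_mem_uIcc
  have hsub : Set.uIcc α β ⊆ Set.uIcc a b := by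
    rw [Set.uIcc_of_le hab]; exact Set.uIcc_subset_Icc hα hβ
  -- The densities are merely integrable, so the primitives are differentiable only almost
  -- everywhere; absolute continuity replaces the classical product rule.
  have acF := ((hf.absolutelyContinuousOnInterval_intervalIntegral ha).mono hsub)
  have acG := ((hg.absolutelyContinuousOnInterval_intervalIntegral ha).mono hsub)
  have acC : ∀ c : ℝ, AbsolutelyContinuousOnInterval (fun _ => c) α β := fun c =>
    ((LipschitzWith.const c (α := ℝ)).lipschitzOnWith).absolutelyContinuousOnInterval
  have acF' := (acC (F a)).add acF
  have acG' := (acC (G a)).add acG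
  have key := acF'.integral_deriv_mul_eq_sub acG'
  simp only [Pi.add_apply] at key
  rw [← hF β hβ, ← hF α hα, ← hG β hβ, ← hG α hα] at key
  rw [← key]
  apply intervalIntegral.integral_congr_ae
  filter_upwards [hf.ae_hasDerivAt_integral, hg.ae_hasDerivAt_integral] with x hx1 hx2 hx
  have hx' : x ∈ Set.uIcc a b := hsub (Set.uIoc_subset_uIcc hx)
  have hxI : x ∈ Set.Icc a b := by rwa [Set.uIcc_of_le hab] at hx'
  have e1 := ((hx1 hx' a ha).const_add (F a)).deriv
  have e2 := ((hx2 hx' a ha).const_add (G a)).deriv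
  rw [hF x hxI, hG x hxI]
  have e3 : deriv ((fun _ => F a) + fun y => ∫ τ in a..y, f τ) x = f x := e1
  have e4 : deriv ((fun _ => G a) + fun y => ∫ τ in a..y, g τ) x = g x := e2
  rw [e3, e4]

/-- Folding the lower triangle of a symmetric array onto the upper one doubles the off-diagonal
terms; this is where the factor 2 in `vecs` comes from. -/
theorem sum_symIdx {n : ℕ} {f : Fin n → Fin n → ℝ} (hf : ∀ i j, f i j = f j i) :
    ∑ ab : SymIdx n, (if ab.1.1 = ab.1.2 then f ab.1.1 ab.1.2 else 2 * f ab.1.1 ab.1.2) =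
      ∑ i, ∑ j, f i j := by
  rw [← Fintype.sum_prod_type' f]
  have h1 : ∑ ab : SymIdx n, (if ab.1.1 = ab.1.2 then f ab.1.1 ab.1.2 else 2 * f ab.1.1 ab.1.2) =
      ∑ p : Fin n × Fin n, if p.1 ≤ p.2 then
        (if p.1 = p.2 then f p.1 p.2 else 2 * f p.1 p.2) else 0 := by
    rw [← Finset.sum_filter]
    exact (Finset.sum_subtype _ (by simp)
      fun p : Fin n × Fin n => if p.1 = p.2 then f p.1 p.2 else 2 * f p.1 p.2).symm
  have h2 : ∑ p : Fin n × Fin n, (if p.1 < p.2 then f p.1 p.2 else 0) =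
      ∑ p : Fin n × Fin n, (if p.2 < p.1 then f p.1 p.2 else 0) := by
    rw [← (Equiv.prodComm (Fin n) (Fin n)).sum_comp]
    refine Finset.sum_congr rfl fun p _ => ?_
    simp [hf p.2 p.1]
  have h3 : ∑ p : Fin n × Fin n, f p.1 p.2 =
      ∑ p : Fin n × Fin n, ((if p.1 = p.2 then f p.1 p.2 else 0) +
        (if p.1 < p.2 then f p.1 p.2 else 0) + (if p.2 < p.1 then f p.1 p.2 else 0)) := by
    refine Finset.sum_congr rfl fun p _ => ?_
    rcases lt_trichotomy p.1 p.2 with h | h | h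
    · simp [h, h.ne, h.not_gt]
    · simp [h]
    · simp [h, h.ne', h.not_gt]
  rw [h1, h3]
  simp only [Finset.sum_add_distrib]
  rw [← h2, add_assoc, ← two_mul, Finset.mul_sum, ← Finset.sum_add_distrib]
  refine Finset.sum_congr rfl fun p _ => ?_
  rcases lt_trichotomy p.1 p.2 with h | h | h
  · simp [h, h.ne, h.le]
  · simp [h]
  · simp [h.ne', h.not_ge, h.not_gt]

theorem vecv_dotProduct_vecs {n : ℕ} {P : Matrix (Fin n) (Fin n) ℝ} (hP : P.IsSymm)
    (y : Fin n → ℝ) : vecv y ⬝ᵥ vecs P = y ⬝ᵥ (P *ᵥ y) := by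
  have h := sum_symIdx (f := fun i j => y i * P i j * y j) fun i j => by
    rw [hP.apply j i]; ring
  simp only [dotProduct, Matrix.mulVec, Finset.mul_sum, ← mul_assoc]
  rw [← h]
  refine Finset.sum_congr rfl fun ab _ => ?_
  simp only [vecv, vecs]
  split_ifs <;> ring

/-- The symmetric matrix with a given vector `vecs`. -/
noncomputable def unvecs {n : ℕ} (σ : SymIdx n → ℝ) : Matrix (Fin n) (Fin n) ℝ :=
  Matrix.of fun i j => if i = j then σ ⟨(i, i), le_rfl⟩ else
    if h : i ≤ j then σ ⟨(i, j), h⟩ / 2 else σ ⟨(j, i), (not_le.1 h).le⟩ / 2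

theorem unvecs_isSymm {n : ℕ} (σ : SymIdx n → ℝ) : (unvecs σ).IsSymm := by
  ext i j
  rcases lt_trichotomy i j with h | h | h
  · simp [unvecs, h.ne, h.ne', h.le, h.not_ge]
  · simp [h]
  · simp [unvecs, h.ne, h.ne', h.le, h.not_ge]

theorem vecs_unvecs {n : ℕ} (σ : SymIdx n → ℝ) : vecs (unvecs σ) = σ := by
  funext ⟨⟨i, j⟩, hij⟩
  by_cases h : i = j
  · subst h; simp [vecs, unvecs]
  · simp only [vecs, unvecs, h, Matrix.of_apply, if_false, dif_pos hij]
    ring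

theorem continuous_unvecs {n : ℕ} : Continuous (unvecs (n := n)) := by
  refine continuous_pi fun i => continuous_pi fun j => ?_
  simp only [unvecs, Matrix.of_apply]
  split_ifs <;> fun_prop

theorem vecs_injective {n : ℕ} {P P' : Matrix (Fin n) (Fin n) ℝ} (hP : P.IsSymm) (hP' : P'.IsSymm)
    (h : vecs P = vecs P') : P = P' := by
  have h1 : ∀ i j, i ≤ j → P i j = P' i j := by
    intro i j hij
    have := congrFun h ⟨(i, j), hij⟩
    simp only [vecs] at this
    split_ifs at this
    · exact this
    · linarith
  ext i j
  rcases le_total i j with hij | hij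
  · exact h1 i j hij
  · rw [← hP.apply i j, ← hP'.apply i j]; exact h1 j i hij

theorem deltaData_mulVec_vecs {n s : ℕ} (t : Fin (s + 1) → ℝ) (b : ℝ → Fin n → ℝ)
    {P : Matrix (Fin n) (Fin n) ℝ} (hP : P.IsSymm) (l : Fin s) :
    (deltaData t b *ᵥ vecs P) l = b (t l.succ) ⬝ᵥ (P *ᵥ b (t l.succ)) -
      b (t l.castSucc) ⬝ᵥ (P *ᵥ b (t l.castSucc)) := by
  rw [← vecv_dotProduct_vecs hP, ← vecv_dotProduct_vecs hP, ← sub_dotProduct]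
  rfl

theorem gammaData_mulVec_vec {n s : ℕ} {β : Type} [Fintype β] (t : Fin (s + 1) → ℝ)
    {b : ℝ → Fin n → ℝ} {d : ℝ → β → ℝ} (l : Fin s)
    (h : ∀ i j, IntervalIntegrable (fun τ => b τ i * d τ j) volume (t l.castSucc) (t l.succ))
    (M : Matrix β (Fin n) ℝ) :
    (gammaData t b d *ᵥ M.vec) l = ∫ τ in (t l.castSucc)..(t l.succ), d τ ⬝ᵥ (M *ᵥ b τ) := by
  have h1 : (gammaData t b d *ᵥ M.vec) l = ∑ ab : Fin n × β,
      ∫ τ in (t l.castSucc)..(t l.succ), b τ ab.1 * d τ ab.2 * M ab.2 ab.1 := by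
    simp only [Matrix.mulVec, dotProduct, gammaData, Matrix.of_apply, Matrix.vec,
      intervalIntegral.integral_mul_const]
  rw [h1, ← intervalIntegral.integral_finsetSum fun ab _ => (h ab.1 ab.2).mul_const _]
  refine intervalIntegral.integral_congr fun τ _ => ?_
  simp only [dotProduct, Matrix.mulVec, Finset.mul_sum]
  rw [Fintype.sum_prod_type, Finset.sum_comm]
  refine Finset.sum_congr rfl fun i _ => Finset.sum_congr rfl fun j _ => ?_
  ring

section
variable {n m ρ s : ℕ} {A : Matrix (Fin n) (Fin n) ℝ} {B : Matrix (Fin n) (Fin m) ℝ}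
  {S : Matrix (Fin n) (ExoIdx ρ) ℝ} {t : Fin (s + 1) → ℝ}
  {b : ℝ → Fin n → ℝ} {u : ℝ → Fin m → ℝ} {z : ℝ → ExoIdx ρ → ℝ}

theorem strictMono_mem_Icc (ht : StrictMono t) (l : Fin (s + 1)) :
    t l ∈ Set.Icc (t 0) (t (Fin.last s)) :=
  ⟨ht.monotone (Fin.zero_le l), ht.monotone (Fin.le_last l)⟩

theorem intervalIntegrable_sample (ht : StrictMono t) {f : ℝ → ℝ}
    (hf : IntervalIntegrable f volume (t 0) (t (Fin.last s))) (l l' : Fin (s + 1)) :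
    IntervalIntegrable f volume (t l) (t l') := by
  refine hf.mono_set ?_
  rw [Set.uIcc_of_le (ht.monotone (Fin.zero_le _))]
  exact Set.uIcc_subset_Icc (strictMono_mem_Icc ht l) (strictMono_mem_Icc ht l')

/-- The identity behind the regression: along `b' = A b + B u + S z`, the increments of `bᵀPb` are
linear in the data matrices. -/
theorem deltaData_mulVec_vecs_eq (ht : StrictMono t)
    (hb : ContinuousOn b (Set.Icc (t 0) (t (Fin.last s))))
    (hu : ∀ j, IntervalIntegrable (fun τ => u τ j) volume (t 0) (t (Fin.last s)))
    (hz : ContinuousOn z (Set.Icc (t 0) (t (Fin.last s))))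
    (hode : ∀ i, ∀ τ ∈ Set.Icc (t 0) (t (Fin.last s)), b τ i = b (t 0) i +
      ∫ σ in (t 0)..τ, (A *ᵥ b σ + B *ᵥ u σ + S *ᵥ z σ) i)
    {P : Matrix (Fin n) (Fin n) ℝ} (hP : P.IsSymm) :
    deltaData t b *ᵥ vecs P = gammaData t b b *ᵥ (Aᵀ * P + P * A).vec +
      (2 : ℝ) • (gammaData t b u *ᵥ (Bᵀ * P).vec) + (2 : ℝ) • (gammaData t b z *ᵥ (Sᵀ * P).vec) := by
  have h0 : t 0 ≤ t (Fin.last s) := ht.monotone (Fin.zero_le _)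
  rw [← Set.uIcc_of_le h0] at hb hz
  have hbi : ∀ i, ContinuousOn (fun τ => b τ i) (Set.uIcc (t 0) (t (Fin.last s))) := fun i =>
    (continuous_apply i).comp_continuousOn hb
  have hzi : ∀ i, ContinuousOn (fun τ => z τ i) (Set.uIcc (t 0) (t (Fin.last s))) := fun i =>
    (continuous_apply i).comp_continuousOn hz
  have ibb : ∀ i j l, IntervalIntegrable (fun τ => b τ i * b τ j) volume (t (Fin.castSucc l))
      (t l.succ) := fun i j l =>
    intervalIntegrable_sample ht ((hbi i).mul (hbi j)).intervalIntegrable _ _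
  have ibu : ∀ i j l, IntervalIntegrable (fun τ => b τ i * u τ j) volume (t (Fin.castSucc l))
      (t l.succ) := fun i j l =>
    intervalIntegrable_sample ht ((hu j).continuousOn_mul (hbi i)) _ _
  have ibz : ∀ i j l, IntervalIntegrable (fun τ => b τ i * z τ j) volume (t (Fin.castSucc l))
      (t l.succ) := fun i j l =>
    intervalIntegrable_sample ht ((hbi i).mul (hzi j)).intervalIntegrable _ _
  set f : ℝ → Fin n → ℝ := fun σ => A *ᵥ b σ + B *ᵥ u σ + S *ᵥ z σ with hf
  have hfi : ∀ i, IntervalIntegrable (fun τ => f τ i) volume (t 0) (t (Fin.last s)) := by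
    intro i
    simp only [hf, Pi.add_apply, Matrix.mulVec, dotProduct]
    refine ((intervalIntegrable_finset_sum fun j => ?_).add
      (intervalIntegrable_finset_sum fun j => ?_)).add
      (intervalIntegrable_finset_sum fun j => ?_)
    · exact (hbi j).intervalIntegrable.const_mul _
    · exact (hu j).const_mul _
    · exact (hzi j).intervalIntegrable.const_mul _
  have hquad : ∀ (P : Matrix (Fin n) (Fin n) ℝ) (y : Fin n → ℝ),
      y ⬝ᵥ (P *ᵥ y) = ∑ i, ∑ j, P i j * (y i * y j) := fun P y => by
    simp only [dotProduct, Matrix.mulVec, Finset.mul_sum]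
    exact Finset.sum_congr rfl fun i _ => Finset.sum_congr rfl fun j _ => by ring
  funext l
  have hl1 := strictMono_mem_Icc ht l.castSucc
  have hl2 := strictMono_mem_Icc ht l.succ
  rw [deltaData_mulVec_vecs t b hP, Pi.add_apply, Pi.add_apply, Pi.smul_apply, Pi.smul_apply,
    gammaData_mulVec_vec t l (fun i j => ibb i j l), gammaData_mulVec_vec t l (fun i j => ibu i j l),
    gammaData_mulVec_vec t l (fun i j => ibz i j l), hquad, hquad]
  have hmul : ∀ {β : Type} [Fintype β] {d : ℝ → β → ℝ} (M : Matrix β (Fin n) ℝ)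
      (_ : ∀ i j, IntervalIntegrable (fun τ => b τ i * d τ j) volume (t l.castSucc) (t l.succ)),
      IntervalIntegrable (fun τ => d τ ⬝ᵥ (M *ᵥ b τ)) volume (t l.castSucc) (t l.succ) := by
    intro β _ d M h
    simp only [dotProduct, Matrix.mulVec, Finset.mul_sum]
    refine intervalIntegrable_finset_sum fun j => intervalIntegrable_finset_sum fun i => ?_
    exact ((h i j).const_mul (M j i)).congr (fun τ _ => by ring)
  rw [smul_eq_mul, smul_eq_mul, ← intervalIntegral.integral_const_mul,
    ← intervalIntegral.integral_const_mul,
    ← intervalIntegral.integral_add (hmul _ fun i j => ibb i j l)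
      ((hmul _ fun i j => ibu i j l).const_mul 2),
    ← intervalIntegral.integral_add ((hmul _ fun i j => ibb i j l).add
      ((hmul _ fun i j => ibu i j l).const_mul 2)) ((hmul _ fun i j => ibz i j l).const_mul 2)]
  -- The form `bᵀPb` is expanded into the products `b_i b_j`, to which integration by parts applies;
  -- its derivative is reassembled as `2 fᵀPb` by the symmetry of `P`.
  have hprod : ∀ i j, b (t l.succ) i * b (t l.succ) j - b (t l.castSucc) i * b (t l.castSucc) j =
      ∫ τ in (t l.castSucc)..(t l.succ), f τ i * b τ j + b τ i * f τ j := fun i j =>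
    integral_mul_of_primitive (hfi i) (hfi j) (hode i) (hode j) hl1 hl2
  have hI : ∀ i j, IntervalIntegrable (fun τ => f τ i * b τ j + b τ i * f τ j) volume
      (t l.castSucc) (t l.succ) := fun i j => intervalIntegrable_sample ht
        (((hfi i).mul_continuousOn (hbi j)).add ((hfi j).continuousOn_mul (hbi i))) _ _
  simp only [← Finset.sum_sub_distrib, ← mul_sub, hprod, ← intervalIntegral.integral_const_mul]
  have hswap : ∀ i, ∑ j, ∫ τ in (t l.castSucc)..(t l.succ),
      P i j * (f τ i * b τ j + b τ i * f τ j) = ∫ τ in (t l.castSucc)..(t l.succ),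
      ∑ j, P i j * (f τ i * b τ j + b τ i * f τ j) := fun i =>
    (intervalIntegral.integral_finsetSum fun j _ => (hI i j).const_mul (P i j)).symm
  simp only [hswap]
  rw [← intervalIntegral.integral_finsetSum fun i _ =>
      intervalIntegrable_finset_sum fun j => (hI i j).const_mul (P i j)]
  refine intervalIntegral.integral_congr fun τ _ => ?_
  have e1 : ∑ i, ∑ j, P i j * (f τ i * b τ j + b τ i * f τ j) = 2 * (f τ ⬝ᵥ (P *ᵥ b τ)) := by
    have : ∑ i, ∑ j, P i j * (f τ i * b τ j) = f τ ⬝ᵥ (P *ᵥ b τ) := by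
      simp only [dotProduct, Matrix.mulVec, Finset.mul_sum]
      exact Finset.sum_congr rfl fun i _ => Finset.sum_congr rfl fun j _ => by ring
    simp only [mul_add, Finset.sum_add_distrib]
    rw [two_mul, this]
    congr 1
    rw [Finset.sum_comm, ← this]
    exact Finset.sum_congr rfl fun i _ => Finset.sum_congr rfl fun j _ => by
      rw [hP.apply]; ring
  have e2 : ∀ {β : Type} [Fintype β] (M : Matrix (Fin n) β ℝ) (d : β → ℝ),
      (M *ᵥ d) ⬝ᵥ (P *ᵥ b τ) = d ⬝ᵥ ((Mᵀ * P) *ᵥ b τ) := by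
    intro β _ M d
    rw [← Matrix.mulVec_mulVec, Matrix.dotProduct_mulVec d, Matrix.vecMul_transpose]
  have e3 : b τ ⬝ᵥ ((P * A) *ᵥ b τ) = b τ ⬝ᵥ ((Aᵀ * P) *ᵥ b τ) := by
    rw [← Matrix.mulVec_mulVec, Matrix.dotProduct_mulVec, ← Matrix.mulVec_transpose, hP.eq,
      dotProduct_comm, e2]
  refine e1.trans ?_
  simp only [hf, add_dotProduct, e2, Matrix.add_mulVec, dotProduct_add, e3]
  ring

end

theorem IsExosystemTrajectory.continuous {ρ : ℕ} {w : Fin ρ → ℝ} {v : ℝ → ExoIdx ρ → ℝ}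
    (hv : IsExosystemTrajectory w v) : Continuous v :=
  continuous_iff_continuousAt.2 fun t => (hv t).continuousAt

theorem barSignal_continuousOn {n ρ : ℕ} {X : Matrix (Fin n) (ExoIdx ρ) ℝ} {x : ℝ → Fin n → ℝ}
    {z : ℝ → ExoIdx ρ → ℝ} {I : Set ℝ} (hx : ContinuousOn x I) (hz : ContinuousOn z I) :
    ContinuousOn (barSignal X x z) I := by
  have hc : Continuous fun y : ExoIdx ρ → ℝ => X *ᵥ y := by fun_prop
  exact hx.sub (hc.comp_continuousOn hz)

/-- Because `v' = E v`, subtracting `X v` only replaces `D` by `D + AX - XE`. The unknown drift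
matrix is absorbed by the regression variable `W`. The argument relies on `v` being the exact
exostate. -/
theorem barSignal_eq_integral {n m ρ : ℕ} {A : Matrix (Fin n) (Fin n) ℝ}
    {B : Matrix (Fin n) (Fin m) ℝ} {D : Matrix (Fin n) (ExoIdx ρ) ℝ} {w : Fin ρ → ℝ}
    {v : ℝ → ExoIdx ρ → ℝ} (hv : IsExosystemTrajectory w v) {u : ℝ → Fin m → ℝ} {t₁ t₂ : ℝ}
    (h12 : t₁ ≤ t₂) (hu : ∀ j, IntervalIntegrable (fun τ => u τ j) volume t₁ t₂)
    {x : ℝ → Fin n → ℝ} (hx : IsFollowerTrajectory A B D u v t₁ t₂ x)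
    (X : Matrix (Fin n) (ExoIdx ρ) ℝ) (i : Fin n) {τ : ℝ} (hτ : τ ∈ Set.Icc t₁ t₂) :
    barSignal X x v τ i = barSignal X x v t₁ i +
      ∫ σ in t₁..τ, (A *ᵥ barSignal X x v σ + B *ᵥ u σ +
        (D + A * X - X * oscillatorMatrix w) *ᵥ v σ) i := by
  have hvc := hv.continuous
  have hsub : Set.uIcc t₁ τ ⊆ Set.uIcc t₁ t₂ := by
    rw [Set.uIcc_of_le h12]; exact Set.uIcc_subset_Icc (Set.left_mem_Icc.2 h12) hτ
  have hxi : ∀ i, IntervalIntegrable (fun σ => x σ i) volume t₁ τ := fun i =>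
    (((continuous_apply i).comp_continuousOn hx.1).mono
      (by rwa [Set.uIcc_of_le h12] at hsub)).intervalIntegrable
  have hi : ∀ i, IntervalIntegrable (fun σ => (A *ᵥ x σ + B *ᵥ u σ + D *ᵥ v σ) i) volume t₁ τ := by
    intro i
    simp only [Pi.add_apply, Matrix.mulVec, dotProduct]
    refine ((intervalIntegrable_finset_sum fun j => ?_).add
      (intervalIntegrable_finset_sum fun j => ?_)).add
      (intervalIntegrable_finset_sum fun j => ?_)
    · exact (hxi j).const_mul _
    · exact ((hu j).mono_set hsub).const_mul _
    · exact Continuous.intervalIntegrable (by fun_prop) _ _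
  have h1 : x τ i = x t₁ i + ∫ σ in t₁..τ, (A *ᵥ x σ + B *ᵥ u σ + D *ᵥ v σ) i := by
    have := congrFun (hx.2 τ hτ) i
    rw [this, Pi.add_apply]
    congr 1
    rw [intervalIntegral.integral_of_le hτ.1, intervalIntegral.integral_of_le hτ.1]
    exact eval_integral (fun j => ((intervalIntegrable_iff_integrableOn_Ioc_of_le hτ.1).1 (hi j))) i
  let L : (ExoIdx ρ → ℝ) →L[ℝ] ℝ :=
    (ContinuousLinearMap.proj i).comp (LinearMap.toContinuousLinearMap X.mulVecLin)
  have hL : ∀ y, L y = (X *ᵥ y) i := fun y => rfl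
  have hint : IntervalIntegrable (fun σ => (X *ᵥ (oscillatorMatrix w *ᵥ v σ)) i) volume t₁ τ :=
    Continuous.intervalIntegrable (by fun_prop) _ _
  have h2 : ∫ σ in t₁..τ, (X *ᵥ (oscillatorMatrix w *ᵥ v σ)) i =
      (X *ᵥ v τ) i - (X *ᵥ v t₁) i :=
    intervalIntegral.integral_eq_sub_of_hasDerivAt
      (fun σ _ => L.hasFDerivAt.comp_hasDerivAt σ (hv σ)) hint
  have h3 : ∀ σ, (A *ᵥ barSignal X x v σ + B *ᵥ u σ +
      (D + A * X - X * oscillatorMatrix w) *ᵥ v σ) i =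
      (A *ᵥ x σ + B *ᵥ u σ + D *ᵥ v σ) i - (X *ᵥ (oscillatorMatrix w *ᵥ v σ)) i := by
    intro σ
    simp only [barSignal, Matrix.mulVec_sub, Matrix.sub_mulVec, Matrix.add_mulVec,
      Matrix.mulVec_mulVec, Pi.add_apply, Pi.sub_apply]
    ring
  simp only [h3]
  rw [intervalIntegral.integral_sub (hi i) hint, h2]
  simp only [barSignal, Pi.sub_apply, h1]
  ring

theorem input_intervalIntegrable {n m : ℕ} {K₀ : Matrix (Fin m) (Fin n) ℝ} {ζ u : ℝ → Fin m → ℝ}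
    {x : ℝ → Fin n → ℝ} {t₁ t₂ : ℝ} (h12 : t₁ ≤ t₂) (hx : ContinuousOn x (Set.Icc t₁ t₂))
    (hζ : MemLp ζ ⊤ (volume.restrict (Set.Icc t₁ t₂)))
    (hu : ∀ τ, u τ = -(K₀ *ᵥ x τ) + ζ τ) (j : Fin m) :
    IntervalIntegrable (fun τ => u τ j) volume t₁ t₂ := by
  have h1 : IntervalIntegrable ζ volume t₁ t₂ := by
    rw [intervalIntegrable_iff_integrableOn_Icc_of_le h12]
    exact hζ.integrable le_top
  have h2 : IntervalIntegrable (fun τ => ζ τ j) volume t₁ t₂ := by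
    rw [intervalIntegrable_iff_integrableOn_Icc_of_le h12] at h1 ⊢
    exact Integrable.eval h1 j
  have hc : Continuous fun y : Fin n → ℝ => -(K₀ *ᵥ y) j := by fun_prop
  have h3 : IntervalIntegrable (fun τ => -(K₀ *ᵥ x τ) j) volume t₁ t₂ :=
    (hc.comp_continuousOn (by rwa [Set.uIcc_of_le h12])).intervalIntegrable
  simp only [hu]
  exact h3.add h2

/-! ### The rank condition and the exact solution of the regression -/

theorem card_symIdx (n : ℕ) : Fintype.card (SymIdx n) = n * (n + 1) / 2 := by
  rw [← Fintype.card_congr (Sym2.sortEquiv (α := Fin n)), Sym2.card, Fintype.card_fin,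
    Nat.choose_two_right, Nat.add_sub_cancel, Nat.mul_comm]

section
variable {n m p ρ s : ℕ} {A : Matrix (Fin n) (Fin n) ℝ} {B : Matrix (Fin n) (Fin m) ℝ}
  {C : Matrix (Fin p) (Fin n) ℝ} {Q : Matrix (Fin p) (Fin p) ℝ} {R : Matrix (Fin m) (Fin m) ℝ}
  {S : Matrix (Fin n) (ExoIdx ρ) ℝ} {t : Fin (s + 1) → ℝ}
  {b : ℝ → Fin n → ℝ} {u : ℝ → Fin m → ℝ} {z : ℝ → ExoIdx ρ → ℝ}

theorem gammaData_mulVec_vec_transpose (M : Matrix (Fin n) (Fin n) ℝ) :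
    gammaData t b b *ᵥ Mᵀ.vec = gammaData t b b *ᵥ M.vec := by
  funext l
  simp only [Matrix.mulVec, dotProduct]
  rw [← (Equiv.prodComm (Fin n) (Fin n)).sum_comp]
  refine Finset.sum_congr rfl fun p _ => ?_
  simp [gammaData, Matrix.vec, mul_comm]

theorem gammaData_mulVec_vec_symm {M : Matrix (Fin n) (Fin n) ℝ} (hM : M.IsSymm) :
    gammaData t b b *ᵥ M.vec =
      (gammaData t b b).submatrix id (fun ab : SymIdx n => ab.1) *ᵥ vecs M := by
  funext l
  have h := sum_symIdx (f := fun i j => gammaData t b b l (i, j) * M i j) fun i j => by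
    rw [hM.apply j i]; simp [gammaData, mul_comm]
  simp only [Matrix.mulVec, dotProduct]
  rw [Fintype.sum_prod_type]
  simp only [Matrix.vec, fun i j => hM.apply i j]
  rw [← h]
  refine Finset.sum_congr rfl fun ab _ => ?_
  simp only [Matrix.submatrix_apply, id, vecs]
  split_ifs <;> ring

/-- Under the rank condition, the data matrices act injectively on the triples with symmetric first
component. -/
theorem DataRankCondition.eq_zero (h : DataRankCondition t b u z) {M : Matrix (Fin n) (Fin n) ℝ}
    (hM : M.IsSymm) {Y : Matrix (Fin m) (Fin n) ℝ} {Z : Matrix (ExoIdx ρ) (Fin n) ℝ}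
    (h0 : gammaData t b b *ᵥ M.vec + gammaData t b u *ᵥ Y.vec + gammaData t b z *ᵥ Z.vec = 0) :
    M = 0 ∧ Y = 0 ∧ Z = 0 := by
  set G := Matrix.fromCols (gammaData t b b) (Matrix.fromCols (gammaData t b u) (gammaData t b z))
  set G' := Matrix.fromCols ((gammaData t b b).submatrix id (fun ab : SymIdx n => ab.1))
    (Matrix.fromCols (gammaData t b u) (gammaData t b z)) with hG'
  -- The columns `(i, j)` and `(j, i)` of the first block coincide, so keeping `i ≤ j` loses no
  -- rank. The number of remaining columns equals the prescribed rank, so they are independent.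
  have hle : G.rank ≤ G'.rank := by
    rw [Matrix.rank_eq_finrank_span_cols, Matrix.rank_eq_finrank_span_cols]
    refine Submodule.finrank_mono (Submodule.span_mono ?_)
    rintro _ ⟨(⟨i, j⟩ | j), rfl⟩
    · rcases le_total i j with hij | hij
      · exact ⟨Sum.inl ⟨(i, j), hij⟩, rfl⟩
      · refine ⟨Sum.inl ⟨(j, i), hij⟩, ?_⟩
        funext l
        simp [G, G', Matrix.col, gammaData, mul_comm]
    · exact ⟨Sum.inr j, rfl⟩
  have hcard : Fintype.card (SymIdx n ⊕ (Fin n × Fin m ⊕ Fin n × ExoIdx ρ)) =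
      n * (n + 1) / 2 + (m + 2 * ρ) * n := by
    simp only [Fintype.card_sum, card_symIdx, Fintype.card_prod, Fintype.card_fin]
    ring
  have hr : n * (n + 1) / 2 + (m + 2 * ρ) * n ≤ G'.rank := h.symm.le.trans hle
  have hker : LinearMap.ker G'.mulVecLin = ⊥ := by
    have h1 := LinearMap.finrank_range_add_finrank_ker G'.mulVecLin
    rw [Module.finrank_fintype_fun_eq_card, hcard] at h1
    have h2 : G'.rank = Module.finrank ℝ (LinearMap.range G'.mulVecLin) := rfl
    exact Submodule.finrank_eq_zero.1 (by omega)
  have h3 : Sum.elim (vecs M) (Sum.elim Y.vec Z.vec) = 0 := by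
    refine (LinearMap.ker_eq_bot'.1 hker) _ ?_
    rw [Matrix.mulVecLin_apply, hG', Matrix.fromCols_mulVec_sumElim, Matrix.fromCols_mulVec_sumElim,
      ← gammaData_mulVec_vec_symm hM, ← h0, add_assoc]
  have h4 : vecs M = 0 := funext fun i => congrFun h3 (Sum.inl i)
  have h5 : Y.vec = 0 := funext fun i => congrFun h3 (Sum.inr (Sum.inl i))
  have h6 : Z.vec = 0 := funext fun i => congrFun h3 (Sum.inr (Sum.inr i))
  refine ⟨vecs_injective hM Matrix.isSymm_zero (h4.trans ?_), Matrix.vec_eq_zero_iff.1 h5,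
    Matrix.vec_eq_zero_iff.1 h6⟩
  funext ab
  simp [vecs]

theorem regressor_mulVec (K : Matrix (Fin m) (Fin n) ℝ) (σ : SymIdx n → ℝ)
    (K' : Matrix (Fin m) (Fin n) ℝ) (W : Matrix (ExoIdx ρ) (Fin n) ℝ) :
    regressor R t b u z K *ᵥ Sum.elim σ (Sum.elim K'.vec W.vec) =
      deltaData t b *ᵥ σ - (2 : ℝ) • (gammaData t b b *ᵥ (Kᵀ * R * K').vec) -
        (2 : ℝ) • (gammaData t b u *ᵥ (R * K').vec) - (2 : ℝ) • (gammaData t b z *ᵥ W.vec) := by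
  rw [regressor, Matrix.fromCols_mulVec_sumElim, Matrix.fromCols_mulVec_sumElim]
  simp only [Matrix.sub_mulVec, Matrix.smul_mulVec, ← Matrix.mulVec_mulVec,
    Matrix.kronecker_mulVec_vec, Matrix.transpose_one, Matrix.mul_one]
  module

/-- The identity by which the data satisfy the regression. -/
def IsDataIdentity (A : Matrix (Fin n) (Fin n) ℝ) (B : Matrix (Fin n) (Fin m) ℝ)
    (S : Matrix (Fin n) (ExoIdx ρ) ℝ) (t : Fin (s + 1) → ℝ) (b : ℝ → Fin n → ℝ)
    (u : ℝ → Fin m → ℝ) (z : ℝ → ExoIdx ρ → ℝ) : Prop :=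
  ∀ P : Matrix (Fin n) (Fin n) ℝ, P.IsSymm →
    deltaData t b *ᵥ vecs P = gammaData t b b *ᵥ (Aᵀ * P + P * A).vec +
      (2 : ℝ) • (gammaData t b u *ᵥ (Bᵀ * P).vec) + (2 : ℝ) • (gammaData t b z *ᵥ (Sᵀ * P).vec)

/-- The data identity eliminates `δ`. The term `2KᵀRK'` is split into itself and its transpose,
which the symmetric `Γ_{x̄x̄}` cannot distinguish; the coefficient of `Γ_{x̄x̄}` can then be
symmetric, as `DataRankCondition.eq_zero` requires. -/
theorem IsDataIdentity.regressor_mulVec_eq (h : IsDataIdentity A B S t b u z)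
    {P : Matrix (Fin n) (Fin n) ℝ} (hP : P.IsSymm) (hR : R.IsSymm) (K K' : Matrix (Fin m) (Fin n) ℝ)
    (W : Matrix (ExoIdx ρ) (Fin n) ℝ) :
    regressor R t b u z K *ᵥ Sum.elim (vecs P) (Sum.elim K'.vec W.vec) =
      gammaData t b b *ᵥ (Aᵀ * P + P * A - Kᵀ * R * K' - K'ᵀ * R * K).vec +
      gammaData t b u *ᵥ ((2 : ℝ) • (Bᵀ * P - R * K')).vec +
      gammaData t b z *ᵥ ((2 : ℝ) • (Sᵀ * P - W)).vec := by
  have h1 : K'ᵀ * R * K = (Kᵀ * R * K')ᵀ := by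
    simp only [Matrix.transpose_mul, Matrix.transpose_transpose, hR.eq, Matrix.mul_assoc]
  rw [regressor_mulVec, h P hP, h1]
  simp only [Matrix.vec_sub, Matrix.vec_smul, Matrix.mulVec_sub, Matrix.mulVec_smul,
    gammaData_mulVec_vec_transpose]
  module

/-- On a kernel vector the rank condition makes all three coefficients vanish. The last two give
`RK' = BᵀP` and `W = SᵀP`; inserted in the first, they leave the homogeneous Lyapunov equation of
the Hurwitz matrix `A - BK`, so `P = 0` and everything else follows. -/
theorem IsDataIdentity.regressor_injective (h : IsDataIdentity A B S t b u z)
    (hrank : DataRankCondition t b u z) (hR : R.PosDef) {K : Matrix (Fin m) (Fin n) ℝ}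
    (hK : IsStabilizingGain A B K) :
    Function.Injective (regressor R t b u z K).mulVec := by
  have hRs : R.IsSymm := hR.posSemidef.isSymm
  have hu := (Matrix.isUnit_iff_isUnit_det _).1 hR.isUnit
  rw [← Matrix.coe_mulVecLin, ← LinearMap.ker_eq_bot, LinearMap.ker_eq_bot']
  intro θ hθ
  obtain ⟨P, hP, hPθ⟩ : ∃ P : Matrix (Fin n) (Fin n) ℝ, P.IsSymm ∧ vecs P = fun i => θ (Sum.inl i) :=
    ⟨_, unvecs_isSymm _, vecs_unvecs _⟩
  obtain ⟨K', hK'⟩ := Matrix.vec_bijective.2 fun i => θ (Sum.inr (Sum.inl i))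
  obtain ⟨W, hW⟩ := Matrix.vec_bijective.2 fun i => θ (Sum.inr (Sum.inr i))
  have hθ' : θ = Sum.elim (vecs P) (Sum.elim K'.vec W.vec) := by
    rw [hPθ, hK', hW]
    funext i
    rcases i with i | i | i <;> rfl
  rw [Matrix.mulVecLin_apply, hθ', h.regressor_mulVec_eq hP hRs] at hθ
  have hsym : (Aᵀ * P + P * A - Kᵀ * R * K' - K'ᵀ * R * K).IsSymm := by
    rw [Matrix.IsSymm]
    simp only [Matrix.transpose_sub, Matrix.transpose_add, Matrix.transpose_mul,
      Matrix.transpose_transpose, hP.eq, hRs.eq, Matrix.mul_assoc]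
    abel
  obtain ⟨h1, h2, h3⟩ := hrank.eq_zero hsym hθ
  have h2' : R * K' = Bᵀ * P :=
    (sub_eq_zero.1 ((smul_eq_zero.1 h2).resolve_left two_ne_zero)).symm
  have h3' : W = Sᵀ * P :=
    (sub_eq_zero.1 ((smul_eq_zero.1 h3).resolve_left two_ne_zero)).symm
  have h4 : K'ᵀ * R = P * B := by
    have := congrArg Matrix.transpose h2'
    simpa [Matrix.transpose_mul, hRs.eq, hP.eq] using this
  have hP0 : P = 0 := by
    refine IsHurwitz.sylvester_eq_zero hK hK ?_
    rw [← h1, Matrix.mul_assoc Kᵀ, h2', h4]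
    simp only [Matrix.transpose_sub, Matrix.transpose_mul, Matrix.sub_mul, Matrix.mul_sub,
      Matrix.mul_assoc]
    abel
  have hK0 : K' = 0 := by
    have := congrArg (fun T => R⁻¹ * T) h2'
    simpa [hP0, Matrix.nonsing_inv_mul_cancel_left _ _ hu] using this
  rw [hθ', hK0, h3', hP0, Matrix.mul_zero]
  funext i
  rcases i with i | i | i <;> simp [vecs]

/-- The choices of gain and `W` cancel the input and the exostate terms, and what is left is the
policy equation. The regression is thus consistent, with zero residual at Kleinman's step. -/
theorem IsDataIdentity.regressor_mulVec_policyValue (h : IsDataIdentity A B S t b u z)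
    (hR : R.PosDef) {K : Matrix (Fin m) (Fin n) ℝ} {P : Matrix (Fin n) (Fin n) ℝ} (hP : P.IsSymm)
    (hK : IsPolicyValue A B C Q R K P) :
    regressor R t b u z K *ᵥ Sum.elim (vecs P)
      (Sum.elim (R⁻¹ * Bᵀ * P).vec (Sᵀ * P).vec) = regressand C Q R t b K := by
  have hRs : R.IsSymm := hR.posSemidef.isSymm
  have hu := (Matrix.isUnit_iff_isUnit_det _).1 hR.isUnit
  have h1 : R * (R⁻¹ * Bᵀ * P) = Bᵀ * P := by
    rw [Matrix.mul_assoc, Matrix.mul_nonsing_inv_cancel_left _ _ hu]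
  have h2 : (R⁻¹ * Bᵀ * P)ᵀ * R = P * B := by
    have := congrArg Matrix.transpose h1
    rwa [Matrix.transpose_mul, hRs.eq, Matrix.transpose_mul Bᵀ, Matrix.transpose_transpose, hP.eq]
      at this
  rw [h.regressor_mulVec_eq hP hRs, h1, h2, sub_self, sub_self, smul_zero, smul_zero,
    Matrix.vec_zero, Matrix.vec_zero, Matrix.mulVec_zero, Matrix.mulVec_zero, add_zero, add_zero,
    regressand, ← Matrix.mulVec_neg, ← Matrix.vec_neg, ← hK, Matrix.mul_assoc Kᵀ, h1]
  congr 2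
  simp only [Matrix.transpose_sub, Matrix.transpose_mul, Matrix.sub_mul, Matrix.mul_sub,
    Matrix.mul_assoc]
  abel

end

/-! ### Least squares through the normal equations -/

section LeastSquares
variable {s : ℕ} {α : Type} [Fintype α] [DecidableEq α]

/-- The solution of the normal equations. -/
noncomputable def normalSolution (Ψ : Matrix (Fin s) α ℝ) (Φ : Fin s → ℝ) : α → ℝ :=
  (Ψᵀ * Ψ)⁻¹ *ᵥ (Ψᵀ *ᵥ Φ)

theorem det_transpose_mul_self_ne_zero {Ψ : Matrix (Fin s) α ℝ} (h : Function.Injective Ψ.mulVec) :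
    (Ψᵀ * Ψ).det ≠ 0 := by
  intro h0
  obtain ⟨x, hx, hx0⟩ := Matrix.exists_mulVec_eq_zero_iff.2 h0
  have := (Matrix.conjTranspose_mul_self_mulVec_eq_zero Ψ x).1
    (by rwa [Matrix.conjTranspose_eq_transpose_of_trivial])
  exact hx (h (by rw [this, Matrix.mulVec_zero]))

/-- Pythagoras: the residual of the normal solution is orthogonal to the range of `Ψ`, so any other
parameter adds the squared length of `Ψ(θ' - θ₀)`, which vanishes only at `θ' = θ₀`. -/
theorem isLeastSquaresSolution_iff {Ψ : Matrix (Fin s) α ℝ} (h : (Ψᵀ * Ψ).det ≠ 0)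
    {Φ : Fin s → ℝ} {θ : α → ℝ} :
    IsLeastSquaresSolution Ψ Φ θ ↔ θ = normalSolution Ψ Φ := by
  have hu : IsUnit (Ψᵀ * Ψ).det := isUnit_iff_ne_zero.2 h
  set θ₀ := normalSolution Ψ Φ with hθ₀
  have hn : Ψᵀ *ᵥ (Ψ *ᵥ θ₀ - Φ) = 0 := by
    rw [Matrix.mulVec_sub, Matrix.mulVec_mulVec, hθ₀, normalSolution, Matrix.mulVec_mulVec,
      Matrix.mul_nonsing_inv _ hu, Matrix.one_mulVec, sub_self]
  have key : ∀ θ', (Ψ *ᵥ θ' - Φ) ⬝ᵥ (Ψ *ᵥ θ' - Φ) =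
      (Ψ *ᵥ θ₀ - Φ) ⬝ᵥ (Ψ *ᵥ θ₀ - Φ) + (Ψ *ᵥ (θ' - θ₀)) ⬝ᵥ (Ψ *ᵥ (θ' - θ₀)) := by
    intro θ'
    have e1 : Ψ *ᵥ θ' - Φ = (Ψ *ᵥ θ₀ - Φ) + Ψ *ᵥ (θ' - θ₀) := by
      rw [Matrix.mulVec_sub]; abel
    have e2 : (Ψ *ᵥ θ₀ - Φ) ⬝ᵥ (Ψ *ᵥ (θ' - θ₀)) = 0 := by
      rw [Matrix.dotProduct_mulVec, ← Matrix.mulVec_transpose, hn, zero_dotProduct]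
    rw [e1, add_dotProduct, dotProduct_add, dotProduct_add, dotProduct_comm (Ψ *ᵥ (θ' - θ₀)) (_ - _),
      e2]
    ring
  constructor
  · intro hθ
    have h1 := hθ θ₀
    rw [key θ] at h1
    have h2 : (Ψ *ᵥ (θ - θ₀)) ⬝ᵥ (Ψ *ᵥ (θ - θ₀)) = 0 :=
      le_antisymm (by linarith) (Finset.sum_nonneg fun i _ => mul_self_nonneg _)
    rw [dotProduct_self_eq_zero] at h2
    have h3 := congrArg (fun y => (Ψᵀ * Ψ)⁻¹ *ᵥ (Ψᵀ *ᵥ y)) h2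
    simp only [Matrix.mulVec_mulVec, Matrix.nonsing_inv_mul _ hu, Matrix.mulVec_zero] at h3
    rw [Matrix.one_mulVec] at h3
    exact sub_eq_zero.1 h3
  · rintro rfl θ'
    rw [key θ']
    exact le_add_of_nonneg_right (Finset.sum_nonneg fun i _ => mul_self_nonneg _)

theorem normalSolution_of_mulVec_eq {Ψ : Matrix (Fin s) α ℝ} (h : Function.Injective Ψ.mulVec)
    {Φ : Fin s → ℝ} {θ : α → ℝ} (hθ : Ψ *ᵥ θ = Φ) : normalSolution Ψ Φ = θ := by
  symm
  rw [← isLeastSquaresSolution_iff (det_transpose_mul_self_ne_zero h)]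
  intro θ'
  rw [hθ, sub_self, zero_dotProduct]
  exact Finset.sum_nonneg fun i _ => mul_self_nonneg _

/-- Written with the adjugate, the inverse is a polynomial divided by a determinant, hence
continuous wherever the determinant is nonzero. -/
theorem continuousAt_normalSolution {Ψ : Matrix (Fin s) α ℝ} (h : (Ψᵀ * Ψ).det ≠ 0)
    (Φ : Fin s → ℝ) :
    ContinuousAt (fun q : Matrix (Fin s) α ℝ × (Fin s → ℝ) => normalSolution q.1 q.2) (Ψ, Φ) := by
  have h1 : (fun q : Matrix (Fin s) α ℝ × (Fin s → ℝ) => normalSolution q.1 q.2) =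
      fun q => ((q.1ᵀ * q.1).det)⁻¹ • ((q.1ᵀ * q.1).adjugate *ᵥ (q.1ᵀ *ᵥ q.2)) := by
    funext q
    rw [normalSolution, Matrix.inv_def, Ring.inverse_eq_inv', Matrix.smul_mulVec]
  rw [h1]
  have hd : Continuous fun q : Matrix (Fin s) α ℝ × (Fin s → ℝ) => (q.1ᵀ * q.1).det := by fun_prop
  have hv : Continuous fun q : Matrix (Fin s) α ℝ × (Fin s → ℝ) =>
      (q.1ᵀ * q.1).adjugate *ᵥ (q.1ᵀ *ᵥ q.2) := by fun_prop
  exact (hd.continuousAt.inv₀ h).smul hv.continuousAt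

end LeastSquares

/-! ### Continuity of the learning algorithm in the data -/

section
variable {n m p ρ s : ℕ}

/-- The data matrices `δ`, `Γ_{x̄x̄}`, `Γ_{x̄u}`, `Γ_{x̄z}`. -/
abbrev LearningData (n m ρ s : ℕ) : Type :=
  Matrix (Fin s) (SymIdx n) ℝ × Matrix (Fin s) (Fin n × Fin n) ℝ ×
    Matrix (Fin s) (Fin n × Fin m) ℝ × Matrix (Fin s) (Fin n × ExoIdx ρ) ℝ

noncomputable def learningData (t : Fin (s + 1) → ℝ) (b : ℝ → Fin n → ℝ) (u : ℝ → Fin m → ℝ)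
    (z : ℝ → ExoIdx ρ → ℝ) : LearningData n m ρ s :=
  (deltaData t b, gammaData t b b, gammaData t b u, gammaData t b z)

/-- Here the data matrices are free variables, detached from any trajectory, so that continuity in
them makes sense. -/
noncomputable def dataRegressor (R : Matrix (Fin m) (Fin m) ℝ) (d : LearningData n m ρ s)
    (K : Matrix (Fin m) (Fin n) ℝ) :
    Matrix (Fin s) (SymIdx n ⊕ (Fin n × Fin m ⊕ Fin n × ExoIdx ρ)) ℝ :=
  Matrix.fromCols d.1 (Matrix.fromCols
    (-(2 : ℝ) • (d.2.1 * ((1 : Matrix (Fin n) (Fin n) ℝ) ⊗ₖ (Kᵀ * R)))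
      - (2 : ℝ) • (d.2.2.1 * ((1 : Matrix (Fin n) (Fin n) ℝ) ⊗ₖ R)))
    (-(2 : ℝ) • d.2.2.2))

noncomputable def dataRegressand (C : Matrix (Fin p) (Fin n) ℝ) (Q : Matrix (Fin p) (Fin p) ℝ)
    (R : Matrix (Fin m) (Fin m) ℝ) (d : LearningData n m ρ s) (K : Matrix (Fin m) (Fin n) ℝ) :
    Fin s → ℝ :=
  -(d.2.1 *ᵥ (Cᵀ * Q * C + Kᵀ * R * K).vec)

variable (C : Matrix (Fin p) (Fin n) ℝ) (Q : Matrix (Fin p) (Fin p) ℝ)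
  (R : Matrix (Fin m) (Fin m) ℝ)

theorem continuous_dataRegressor :
    Continuous fun q : LearningData n m ρ s × Matrix (Fin m) (Fin n) ℝ =>
      dataRegressor R q.1 q.2 := by
  have hk : Continuous fun q : LearningData n m ρ s × Matrix (Fin m) (Fin n) ℝ =>
      (1 : Matrix (Fin n) (Fin n) ℝ) ⊗ₖ (q.2ᵀ * R) := by
    refine continuous_matrix fun i j => ?_
    simp only [Matrix.kroneckerMap_apply]
    have : Continuous fun q : LearningData n m ρ s × Matrix (Fin m) (Fin n) ℝ => q.2ᵀ * R := by
      fun_prop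
    exact continuous_const.mul (this.matrix_elem _ _)
  have h2 : Continuous fun q : LearningData n m ρ s × Matrix (Fin m) (Fin n) ℝ =>
      (-(2 : ℝ) • (q.1.2.1 * ((1 : Matrix (Fin n) (Fin n) ℝ) ⊗ₖ (q.2ᵀ * R)))
        - (2 : ℝ) • (q.1.2.2.1 * ((1 : Matrix (Fin n) (Fin n) ℝ) ⊗ₖ R))) := by
    have h1 : Continuous fun q : LearningData n m ρ s × Matrix (Fin m) (Fin n) ℝ => q.1.2.1 := by
      fun_prop
    have h3 : Continuous fun q : LearningData n m ρ s × Matrix (Fin m) (Fin n) ℝ =>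
        (2 : ℝ) • (q.1.2.2.1 * ((1 : Matrix (Fin n) (Fin n) ℝ) ⊗ₖ R)) := by fun_prop
    exact ((h1.matrix_mul hk).const_smul (-(2 : ℝ))).sub h3
  refine continuous_matrix fun l c => ?_
  rcases c with c | c | c
  · exact Continuous.matrix_elem (A := fun q : LearningData n m ρ s × Matrix (Fin m) (Fin n) ℝ =>
      q.1.1) (by fun_prop) l c
  · exact h2.matrix_elem l c
  · exact Continuous.matrix_elem (A := fun q : LearningData n m ρ s × Matrix (Fin m) (Fin n) ℝ =>
      -(2 : ℝ) • q.1.2.2.2) (by fun_prop) l c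

theorem continuous_dataRegressand :
    Continuous fun q : LearningData n m ρ s × Matrix (Fin m) (Fin n) ℝ =>
      dataRegressand C Q R q.1 q.2 := by
  have hv : Continuous fun q : LearningData n m ρ s × Matrix (Fin m) (Fin n) ℝ =>
      (Cᵀ * Q * C + q.2ᵀ * R * q.2).vec := by
    have h0 : Continuous fun q : LearningData n m ρ s × Matrix (Fin m) (Fin n) ℝ =>
      Cᵀ * Q * C + q.2ᵀ * R * q.2 := by fun_prop
    exact continuous_pi fun i => h0.matrix_elem _ _
  have h1 : Continuous fun q : LearningData n m ρ s × Matrix (Fin m) (Fin n) ℝ => q.1.2.1 := by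
    fun_prop
  exact (h1.matrix_mulVec hv).neg

/-- One step of policy iteration from data. -/
noncomputable def learningStep (d : LearningData n m ρ s) (K : Matrix (Fin m) (Fin n) ℝ) :
    SymIdx n ⊕ (Fin n × Fin m ⊕ Fin n × ExoIdx ρ) → ℝ :=
  normalSolution (dataRegressor R d K) (dataRegressand C Q R d K)

variable (K₀ : Matrix (Fin m) (Fin n) ℝ)

/-- Defined for all data; meaningful only while the normal equations are nonsingular. The swapped
indices reflect that `vec` is indexed by column first. -/
noncomputable def learnedGain (d : LearningData n m ρ s) : ℕ → Matrix (Fin m) (Fin n) ℝ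
  | 0 => K₀
  | k + 1 => Matrix.of fun i j => learningStep C Q R d (learnedGain d k) (Sum.inr (Sum.inl (j, i)))

noncomputable def learnedValue (d : LearningData n m ρ s) (k : ℕ) : Matrix (Fin n) (Fin n) ℝ :=
  unvecs fun i => learningStep C Q R d (learnedGain C Q R K₀ d k) (Sum.inl i)

variable {C Q R K₀}

/-- While the normal equations are nonsingular, policy iteration returns exactly `learnedValue` and
`learnedGain`. -/
theorem learnsWithin_of_det_ne_zero {t : Fin (s + 1) → ℝ} {b : ℝ → Fin n → ℝ} {u : ℝ → Fin m → ℝ}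
    {z : ℝ → ExoIdx ρ → ℝ} {k : ℕ} {c : ℝ} {Pstar : Matrix (Fin n) (Fin n) ℝ}
    {Kstar : Matrix (Fin m) (Fin n) ℝ} {d : LearningData n m ρ s} (hd : learningData t b u z = d)
    (hdet : ∀ j ≤ k, ((dataRegressor R d (learnedGain C Q R K₀ d j))ᵀ *
      dataRegressor R d (learnedGain C Q R K₀ d j)).det ≠ 0)
    (hP : ‖learnedValue C Q R K₀ d k - Pstar‖ < c)
    (hK : ‖learnedGain C Q R K₀ d k - Kstar‖ < c) :
    LearnsWithin C Q R t b u z K₀ k c Pstar Kstar := by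
  have hreg : ∀ K, regressor R t b u z K = dataRegressor R d K := fun K => by rw [← hd]; rfl
  have hrhs : ∀ K, regressand C Q R t b K = dataRegressand C Q R d K := fun K => by rw [← hd]; rfl
  refine ⟨⟨learnedValue C Q R K₀ d, learnedGain C Q R K₀ d, rfl, fun j hj =>
    ⟨unvecs_isSymm _, Matrix.of fun i l => learningStep C Q R d (learnedGain C Q R K₀ d j)
      (Sum.inr (Sum.inr (l, i))), ?_⟩⟩, fun P K h => ?_⟩
  · rw [hreg, hrhs, isLeastSquaresSolution_iff (hdet j hj), learnedValue, vecs_unvecs]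
    funext i
    rcases i with i | i | i <;> rfl
  · obtain ⟨h0, h⟩ := h
    have hsol : ∀ j ≤ k, K j = learnedGain C Q R K₀ d j →
        P j = learnedValue C Q R K₀ d j ∧ K (j + 1) = learnedGain C Q R K₀ d (j + 1) := by
      intro j hj hKj
      obtain ⟨hs, W, hW⟩ := h j hj
      rw [hreg, hrhs, hKj, isLeastSquaresSolution_iff (hdet j hj)] at hW
      constructor
      · refine vecs_injective hs (unvecs_isSymm _) ?_
        rw [learnedValue, vecs_unvecs]
        exact funext fun i => congrFun hW (Sum.inl i)
      · ext i l
        exact congrFun hW (Sum.inr (Sum.inl (l, i)))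
    have hgain : ∀ j ≤ k, K j = learnedGain C Q R K₀ d j := by
      intro j
      induction j with
      | zero => exact fun _ => h0
      | succ j ih => exact fun hj => (hsol j (by omega) (ih (by omega))).2
    rw [(hsol k le_rfl (hgain k le_rfl)).1, hgain k le_rfl]
    exact ⟨hP, hK⟩

/-- Policy iteration depends continuously on the data. -/
theorem eventually_learnsWithin {d₀ : LearningData n m ρ s} {P : ℕ → Matrix (Fin n) (Fin n) ℝ}
    {K : ℕ → Matrix (Fin m) (Fin n) ℝ} (hK0 : K 0 = K₀) (hPs : ∀ k, (P k).IsSymm)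
    (hinj : ∀ k, Function.Injective (dataRegressor R d₀ (K k)).mulVec)
    (hsol : ∀ k, ∃ W : Matrix (ExoIdx ρ) (Fin n) ℝ, dataRegressor R d₀ (K k) *ᵥ
      Sum.elim (vecs (P k)) (Sum.elim (K (k + 1)).vec W.vec) = dataRegressand C Q R d₀ (K k))
    {k : ℕ} {c : ℝ} {Pstar : Matrix (Fin n) (Fin n) ℝ} {Kstar : Matrix (Fin m) (Fin n) ℝ}
    (hP : ‖P k - Pstar‖ < c) (hK : ‖K k - Kstar‖ < c) :
    ∀ᶠ d in 𝓝 d₀, ∀ (t : Fin (s + 1) → ℝ) (b : ℝ → Fin n → ℝ) (u : ℝ → Fin m → ℝ)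
      (z : ℝ → ExoIdx ρ → ℝ), learningData t b u z = d →
      LearnsWithin C Q R t b u z K₀ k c Pstar Kstar := by
  have hstep : ∀ j, ContinuousAt (fun q : LearningData n m ρ s × Matrix (Fin m) (Fin n) ℝ =>
      learningStep C Q R q.1 q.2) (d₀, K j) := fun j =>
    ContinuousAt.comp (x := (d₀, K j))
      (f := fun q : LearningData n m ρ s × Matrix (Fin m) (Fin n) ℝ =>
        (dataRegressor R q.1 q.2, dataRegressand C Q R q.1 q.2))
      (g := fun q : Matrix (Fin s) (SymIdx n ⊕ (Fin n × Fin m ⊕ Fin n × ExoIdx ρ)) ℝ ×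
        (Fin s → ℝ) => normalSolution q.1 q.2)
      (continuousAt_normalSolution (det_transpose_mul_self_ne_zero (hinj j)) _)
      ((continuous_dataRegressor R).prodMk (continuous_dataRegressand C Q R)).continuousAt
  have hval : ∀ j, ∃ W : Matrix (ExoIdx ρ) (Fin n) ℝ, learningStep C Q R d₀ (K j) =
      Sum.elim (vecs (P j)) (Sum.elim (K (j + 1)).vec W.vec) := fun j =>
    (hsol j).imp fun W hW => normalSolution_of_mulVec_eq (hinj j) hW
  have hcomp : ∀ j, learnedGain C Q R K₀ d₀ j = K j →
      ContinuousAt (fun d => learnedGain C Q R K₀ d j) d₀ →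
      ContinuousAt (fun d => learningStep C Q R d (learnedGain C Q R K₀ d j)) d₀ :=
    fun j h1 h2 => ContinuousAt.comp (x := d₀) (f := fun d => (d, learnedGain C Q R K₀ d j))
      (g := fun q : LearningData n m ρ s × Matrix (Fin m) (Fin n) ℝ => learningStep C Q R q.1 q.2)
      (by rw [h1]; exact hstep j) (continuousAt_id.prodMk h2)
  -- Value and continuity are proved in one induction: a step is known to be continuous only at the
  -- exact gain `K j`, so the learned gain at `d₀` must first be identified with it.
  have hgain : ∀ j, learnedGain C Q R K₀ d₀ j = K j ∧
      ContinuousAt (fun d => learnedGain C Q R K₀ d j) d₀ := by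
    intro j
    induction j with
    | zero => exact ⟨hK0.symm, continuousAt_const⟩
    | succ j ih =>
      constructor
      · obtain ⟨W, hW⟩ := hval j
        ext i l
        simp only [learnedGain, ih.1, hW]
        rfl
      · refine continuousAt_pi.2 fun i => continuousAt_pi.2 fun l => ?_
        exact continuousAt_pi.1 (hcomp j ih.1 ih.2) _
  have hstep' : ∀ j, ContinuousAt (fun d => learningStep C Q R d (learnedGain C Q R K₀ d j)) d₀ :=
    fun j => hcomp j (hgain j).1 (hgain j).2
  have hvalue : learnedValue C Q R K₀ d₀ k = P k := by
    obtain ⟨W, hW⟩ := hval k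
    refine vecs_injective (unvecs_isSymm _) (hPs k) ?_
    rw [learnedValue, vecs_unvecs, (hgain k).1, hW]
    rfl
  have hvc : ContinuousAt (fun d => learnedValue C Q R K₀ d k) d₀ :=
    ContinuousAt.comp (g := unvecs) continuous_unvecs.continuousAt
      (continuousAt_pi.2 fun i => continuousAt_pi.1 (hstep' k) _)
  have e1 : ∀ᶠ d in 𝓝 d₀, ‖learnedValue C Q R K₀ d k - Pstar‖ < c := by
    have : Tendsto (fun d => ‖learnedValue C Q R K₀ d k - Pstar‖) (𝓝 d₀) (𝓝 ‖P k - Pstar‖) := by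
      rw [← hvalue]; exact (hvc.tendsto.sub_const _).norm
    exact this.eventually_lt_const hP
  have e2 : ∀ᶠ d in 𝓝 d₀, ‖learnedGain C Q R K₀ d k - Kstar‖ < c := by
    have : Tendsto (fun d => ‖learnedGain C Q R K₀ d k - Kstar‖) (𝓝 d₀) (𝓝 ‖K k - Kstar‖) := by
      rw [← (hgain k).1]; exact ((hgain k).2.tendsto.sub_const _).norm
    exact this.eventually_lt_const hK
  have e3 : ∀ j, ∀ᶠ d in 𝓝 d₀, ((dataRegressor R d (learnedGain C Q R K₀ d j))ᵀ *
      dataRegressor R d (learnedGain C Q R K₀ d j)).det ≠ 0 := by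
    intro j
    have h1 : ContinuousAt (fun d => dataRegressor R d (learnedGain C Q R K₀ d j)) d₀ :=
      ContinuousAt.comp (f := fun d => (d, learnedGain C Q R K₀ d j))
        (continuous_dataRegressor R).continuousAt (continuousAt_id.prodMk (hgain j).2)
    have h2 : Continuous fun Ψ : Matrix (Fin s) (SymIdx n ⊕ (Fin n × Fin m ⊕ Fin n × ExoIdx ρ)) ℝ =>
        (Ψᵀ * Ψ).det := by fun_prop
    have h3 := ContinuousAt.comp (g := fun Ψ : Matrix (Fin s)
      (SymIdx n ⊕ (Fin n × Fin m ⊕ Fin n × ExoIdx ρ)) ℝ => (Ψᵀ * Ψ).det) h2.continuousAt h1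
    refine h3.eventually_ne ?_
    simp only [Function.comp, (hgain j).1]
    exact det_transpose_mul_self_ne_zero (hinj j)
  -- Only the steps `0, …, k` have to stay nonsingular, a finite intersection of neighbourhoods; the
  -- neighbourhood depends on `k`.
  have e4 : ∀ᶠ d in 𝓝 d₀, ∀ j ∈ Finset.range (k + 1),
      ((dataRegressor R d (learnedGain C Q R K₀ d j))ᵀ *
      dataRegressor R d (learnedGain C Q R K₀ d j)).det ≠ 0 :=
    (eventually_all_finset _).2 fun j _ => e3 j
  filter_upwards [e1, e2, e4] with d h1 h2 h4 t b u z hd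
  exact learnsWithin_of_det_ne_zero hd (fun j hj => h4 j (Finset.mem_range.2 (by omega))) h1 h2

end

/-! ### Learning from signals uniformly close to the exostate -/

/-- Integrals of products converge under uniform convergence of the factors. -/
theorem tendsto_integral_mul {α β : ℝ} {f g : ℝ → ℝ} {F G : ℕ → ℝ → ℝ} {δ ε : ℕ → ℝ}
    (hδ : Tendsto δ atTop (𝓝 0)) (hε : Tendsto ε atTop (𝓝 0))
    (hf : ContinuousOn f (Set.uIcc α β)) (hg : IntervalIntegrable g volume α β)
    (hF : ∀ k, ContinuousOn (F k) (Set.uIcc α β)) (hG : ∀ k, IntervalIntegrable (G k) volume α β)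
    (hFf : ∀ k, ∀ τ ∈ Set.uIcc α β, |F k τ - f τ| ≤ δ k)
    (hGg : ∀ k, ∀ τ ∈ Set.uIcc α β, |G k τ - g τ| ≤ ε k) :
    Tendsto (fun k => ∫ τ in α..β, F k τ * G k τ) atTop (𝓝 (∫ τ in α..β, f τ * g τ)) := by
  refine intervalIntegral.tendsto_integral_filter_of_dominated_convergence
    -- Once both errors are below 1 this dominates the products; it is integrable although `g` need
    -- not be bounded.
    (fun τ => (|f τ| + 1) * (|g τ| + 1)) (Eventually.of_forall fun k => ?_) ?_ ?_ ?_
  · exact ((hG k).continuousOn_mul (hF k)).def'.aestronglyMeasurable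
  · filter_upwards [hδ.eventually_lt_const one_pos, hε.eventually_lt_const one_pos] with k h1 h2
    refine Eventually.of_forall fun τ hτ => ?_
    have hτ' := Set.uIoc_subset_uIcc hτ
    rw [Real.norm_eq_abs, abs_mul]
    have e1 : |F k τ| ≤ |f τ| + 1 := by
      have := abs_add_le (F k τ - f τ) (f τ)
      rw [sub_add_cancel] at this
      linarith [hFf k τ hτ']
    have e2 : |G k τ| ≤ |g τ| + 1 := by
      have := abs_add_le (G k τ - g τ) (g τ)
      rw [sub_add_cancel] at this
      linarith [hGg k τ hτ']
    exact mul_le_mul e1 e2 (abs_nonneg _) (by positivity)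
  · refine (hg.abs.add (_root_.intervalIntegrable_const)).continuousOn_mul ?_
    exact hf.abs.add continuousOn_const
  · refine Eventually.of_forall fun τ hτ => ?_
    have hτ' := Set.uIoc_subset_uIcc hτ
    refine Tendsto.mul ?_ ?_
    · exact tendsto_iff_norm_sub_tendsto_zero.2
        (squeeze_zero (fun _ => norm_nonneg _) (fun k => hFf k τ hτ') hδ)
    · exact tendsto_iff_norm_sub_tendsto_zero.2
        (squeeze_zero (fun _ => norm_nonneg _) (fun k => hGg k τ hτ') hε)

section
variable {n m p ρ s : ℕ}

/-- The state and the input do not depend on the signal `z`; only `X z` does, and it does so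
linearly. The error of `x̄` is therefore at most a row sum of `|X|` times the error of `z`. -/
theorem tendsto_learningData {t : Fin (s + 1) → ℝ} (ht : StrictMono t)
    {X : Matrix (Fin n) (ExoIdx ρ) ℝ} {x : ℝ → Fin n → ℝ} {u : ℝ → Fin m → ℝ}
    {v : ℝ → ExoIdx ρ → ℝ} {z : ℕ → ℝ → ExoIdx ρ → ℝ} {δ : ℕ → ℝ}
    (hx : ContinuousOn x (Set.Icc (t 0) (t (Fin.last s))))
    (hu : ∀ j, IntervalIntegrable (fun τ => u τ j) volume (t 0) (t (Fin.last s)))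
    (hv : ContinuousOn v (Set.Icc (t 0) (t (Fin.last s))))
    (hz : ∀ k, ContinuousOn (z k) (Set.Icc (t 0) (t (Fin.last s))))
    (hδ : Tendsto δ atTop (𝓝 0))
    (hzv : ∀ k, ∀ τ ∈ Set.Icc (t 0) (t (Fin.last s)), ∀ j, |z k τ j - v τ j| ≤ δ k) :
    Tendsto (fun k => learningData t (barSignal X x (z k)) u (z k)) atTop
      (𝓝 (learningData t (barSignal X x v) u v)) := by
  have hsub : ∀ l l' : Fin (s + 1), Set.uIcc (t l) (t l') ⊆ Set.Icc (t 0) (t (Fin.last s)) :=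
    fun l l' => Set.uIcc_subset_Icc (strictMono_mem_Icc ht l) (strictMono_mem_Icc ht l')
  set ε : Fin n → ℕ → ℝ := fun i k => (∑ j, |X i j|) * δ k with hε
  have hε0 : ∀ i, Tendsto (ε i) atTop (𝓝 0) := fun i => by
    simpa using hδ.const_mul (∑ j, |X i j|)
  have hb : ∀ i k, ∀ τ ∈ Set.Icc (t 0) (t (Fin.last s)),
      |barSignal X x (z k) τ i - barSignal X x v τ i| ≤ ε i k := by
    intro i k τ hτ
    have e : barSignal X x (z k) τ i - barSignal X x v τ i = -∑ j, X i j * (z k τ j - v τ j) := by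
      simp only [barSignal, Pi.sub_apply, Matrix.mulVec, dotProduct, mul_sub,
        Finset.sum_sub_distrib]
      ring
    rw [e, abs_neg, hε]
    simp only
    rw [Finset.sum_mul]
    refine (Finset.abs_sum_le_sum_abs _ _).trans (Finset.sum_le_sum fun j _ => ?_)
    rw [abs_mul]
    exact mul_le_mul_of_nonneg_left (hzv k τ hτ j) (abs_nonneg _)
  have cb : ∀ i, ∀ {y : ℝ → ExoIdx ρ → ℝ}, ContinuousOn y (Set.Icc (t 0) (t (Fin.last s))) →
      ContinuousOn (fun τ => barSignal X x y τ i) (Set.Icc (t 0) (t (Fin.last s))) :=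
    fun i y hy => (continuous_apply i).comp_continuousOn (barSignal_continuousOn hx hy)
  have cz : ∀ i, ∀ {y : ℝ → ExoIdx ρ → ℝ}, ContinuousOn y (Set.Icc (t 0) (t (Fin.last s))) →
      ContinuousOn (fun τ => y τ i) (Set.Icc (t 0) (t (Fin.last s))) :=
    fun i y hy => (continuous_apply i).comp_continuousOn hy
  have lim : ∀ i, ∀ τ ∈ Set.Icc (t 0) (t (Fin.last s)),
      Tendsto (fun k => barSignal X x (z k) τ i) atTop (𝓝 (barSignal X x v τ i)) :=
    fun i τ hτ => tendsto_iff_norm_sub_tendsto_zero.2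
        (squeeze_zero (fun _ => norm_nonneg _) (fun k => hb i k τ hτ) (hε0 i))
  refine Tendsto.prodMk_nhds ?_ (Tendsto.prodMk_nhds ?_ (Tendsto.prodMk_nhds ?_ ?_)) <;>
    refine tendsto_pi_nhds.2 fun l => tendsto_pi_nhds.2 fun c => ?_
  · have h1 := fun i => lim i _ (strictMono_mem_Icc ht l.succ)
    have h2 := fun i => lim i _ (strictMono_mem_Icc ht l.castSucc)
    exact ((h1 c.1.1).mul (h1 c.1.2)).sub ((h2 c.1.1).mul (h2 c.1.2))
  · exact tendsto_integral_mul (hε0 c.1) (hε0 c.2) ((cb _ hv).mono (hsub _ _))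
      ((cb _ hv).mono (hsub _ _)).intervalIntegrable (fun k => (cb _ (hz k)).mono (hsub _ _))
      (fun k => ((cb _ (hz k)).mono (hsub _ _)).intervalIntegrable)
      (fun k τ hτ => hb _ k τ (hsub _ _ hτ)) (fun k τ hτ => hb _ k τ (hsub _ _ hτ))
  · exact tendsto_integral_mul (ε := fun _ => 0) (hε0 c.1) tendsto_const_nhds
      ((cb _ hv).mono (hsub _ _))
      (intervalIntegrable_sample ht (hu _) _ _) (fun k => (cb _ (hz k)).mono (hsub _ _))
      (fun k => intervalIntegrable_sample ht (hu _) _ _)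
      (fun k τ hτ => hb _ k τ (hsub _ _ hτ)) (fun k τ hτ => by simp)
  · exact tendsto_integral_mul (hε0 c.1) hδ ((cb _ hv).mono (hsub _ _))
      ((cz _ hv).mono (hsub _ _)).intervalIntegrable (fun k => (cb _ (hz k)).mono (hsub _ _))
      (fun k => ((cz _ (hz k)).mono (hsub _ _)).intervalIntegrable)
      (fun k τ hτ => hb _ k τ (hsub _ _ hτ)) (fun k τ hτ => hzv k τ (hsub _ _ hτ) _)

/-- Learning from the exostate succeeds after finitely many steps, and for each large step number
also learning from any signal uniformly close enough to the exostate does. -/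
theorem exists_eventually_learnsWithin {A : Matrix (Fin n) (Fin n) ℝ}
    {B : Matrix (Fin n) (Fin m) ℝ} {C : Matrix (Fin p) (Fin n) ℝ} {D : Matrix (Fin n) (ExoIdx ρ) ℝ}
    {Q : Matrix (Fin p) (Fin p) ℝ} {R : Matrix (Fin m) (Fin m) ℝ} (hQ : Q.PosSemidef)
    (hR : R.PosDef) (hobs : IsObservable (CFC.sqrt Q * C) A) {w : Fin ρ → ℝ}
    {v : ℝ → ExoIdx ρ → ℝ} (hv : IsExosystemTrajectory w v) {t : Fin (s + 1) → ℝ}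
    (ht : StrictMono t) {K₀ : Matrix (Fin m) (Fin n) ℝ} (hK₀ : IsStabilizingGain A B K₀)
    {ζ u : ℝ → Fin m → ℝ} {x : ℝ → Fin n → ℝ}
    (hζ : MemLp ζ ⊤ (volume.restrict (Set.Icc (t 0) (t (Fin.last s)))))
    (hu : ∀ τ, u τ = -(K₀ *ᵥ x τ) + ζ τ)
    (hx : IsFollowerTrajectory A B D u v (t 0) (t (Fin.last s)) x) :
    ∃ Pstar, IsStabilizingRiccatiSolution A B C Q R Pstar ∧ ∀ c : ℝ, 0 < c →
      ∀ᶠ k in atTop, ∀ X : Matrix (Fin n) (ExoIdx ρ) ℝ,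
        DataRankCondition t (barSignal X x v) u v →
        LearnsWithin C Q R t (barSignal X x v) u v K₀ k c Pstar (R⁻¹ * Bᵀ * Pstar) ∧
        ∃ δ > 0, ∀ z : ℝ → ExoIdx ρ → ℝ, ContinuousOn z (Set.Icc (t 0) (t (Fin.last s))) →
          (∀ τ ∈ Set.Icc (t 0) (t (Fin.last s)), ∀ j, |z τ j - v τ j| ≤ δ) →
          LearnsWithin C Q R t (barSignal X x z) u z K₀ k c Pstar (R⁻¹ * Bᵀ * Pstar) := by
  obtain ⟨P, K, Pstar, hK0, hKs, hPs, hst, hval, hstar, hPlim, hKlim⟩ :=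
    exists_policyIteration hQ hR hobs hK₀
  refine ⟨Pstar, hstar, fun c hc => ?_⟩
  have e1 := (tendsto_iff_norm_sub_tendsto_zero.1 hPlim).eventually_lt_const hc
  have e2 := (tendsto_iff_norm_sub_tendsto_zero.1 hKlim).eventually_lt_const hc
  -- The index `k` is chosen from Kleinman's limit alone, before the trial matrix, so one index
  -- serves all of them.
  filter_upwards [e1, e2] with k h1 h2 X hrank
  have h0 : t 0 ≤ t (Fin.last s) := ht.monotone (Fin.zero_le _)
  have hui := input_intervalIntegrable h0 hx.1 hζ hu
  have hid : IsDataIdentity A B (D + A * X - X * oscillatorMatrix w) t (barSignal X x v) u v :=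
    fun P hP => deltaData_mulVec_vecs_eq ht (barSignal_continuousOn hx.1 hv.continuous.continuousOn)
      hui hv.continuous.continuousOn
      (fun i τ hτ => barSignal_eq_integral hv h0 hui hx X i hτ) hP
  have key := eventually_learnsWithin (C := C) (Q := Q) (R := R)
    (d₀ := learningData t (barSignal X x v) u v) hK0 hPs
    (fun j => hid.regressor_injective hrank hR (hst j))
    (fun j => ⟨_, by rw [hKs]; exact hid.regressor_mulVec_policyValue hR (hPs j) (hval j)⟩) h1 h2
  refine ⟨key.self_of_nhds _ _ _ _ rfl, ?_⟩
  -- If no `δ` works, signals with error `1 / (k + 1)` give data converging to the exact data while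
  -- the learning fails, against `key`.
  by_contra! hcon
  choose z hz hzv hbad using fun k : ℕ => hcon (1 / ((k : ℝ) + 1)) (by positivity)
  have hlim := tendsto_learningData (X := X) ht hx.1 hui hv.continuous.continuousOn hz
    tendsto_one_div_add_atTop_nhds_zero_nat hzv
  obtain ⟨j, hj⟩ := (hlim.eventually key).exists
  exact hbad j (hj _ _ _ _ rfl)

end

/-! ### Quadratic bounds for the coupling matrix -/

section Coupling
variable {N : ℕ} {H : Matrix (Fin N) (Fin N) ℝ}

theorem sum_sq_mulVec_le (M : Matrix (Fin N) (Fin N) ℝ) (y : Fin N → ℝ) :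
    ∑ i, (M *ᵥ y) i ^ 2 ≤ (∑ i, ∑ j, M i j ^ 2) * ∑ i, y i ^ 2 := by
  rw [Finset.sum_mul]
  exact Finset.sum_le_sum fun i _ => Finset.sum_mul_sq_le_sq_mul_sq Finset.univ (M i) y

/-- Factor `H = SᵀS` with `S` invertible; then `yᵀHy = |Sy|²`, and `y = S⁻¹(Sy)` is bounded through
the Frobenius norm of `S⁻¹`. -/
theorem Matrix.PosDef.exists_sum_sq_le (hH : H.PosDef) :
    ∃ μ > 0, ∀ y : Fin N → ℝ, ∑ i, y i ^ 2 ≤ μ * ∑ i, y i * (H *ᵥ y) i := by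
  obtain ⟨S, hS⟩ := CStarAlgebra.nonneg_iff_eq_star_mul_self.1
    (Matrix.nonneg_iff_posSemidef.2 hH.posSemidef)
  rw [Matrix.star_eq_conjTranspose, Matrix.conjTranspose_eq_transpose_of_trivial] at hS
  have hdet : IsUnit S.det := by
    have h1 := (Matrix.isUnit_iff_isUnit_det _).1 hH.isUnit
    rw [hS, Matrix.det_mul] at h1
    exact isUnit_of_mul_isUnit_right h1
  -- The added 1 keeps the constant positive even for `N = 0`.
  refine ⟨(∑ i, ∑ j, S⁻¹ i j ^ 2) + 1, by positivity, fun y => ?_⟩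
  have h2 := sum_sq_mulVec_le S⁻¹ (S *ᵥ y)
  rw [Matrix.mulVec_mulVec, Matrix.nonsing_inv_mul _ hdet, Matrix.one_mulVec] at h2
  have h3 : ∑ i, y i * (H *ᵥ y) i = ∑ i, (S *ᵥ y) i ^ 2 := by
    change y ⬝ᵥ (H *ᵥ y) = _
    rw [hS, ← Matrix.mulVec_mulVec, Matrix.dotProduct_mulVec, Matrix.vecMul_transpose]
    exact Finset.sum_congr rfl fun i _ => (sq _).symm
  rw [h3]
  refine h2.trans (mul_le_mul_of_nonneg_right (by linarith) (Finset.sum_nonneg fun i _ => sq_nonneg _))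

theorem Matrix.PosDef.exists_sum_sq_le_sum_sq_mulVec (hH : H.PosDef) :
    ∃ ν > 0, ∀ y : Fin N → ℝ, ∑ i, y i ^ 2 ≤ ν * ∑ i, (H *ᵥ y) i ^ 2 := by
  have hdet := (Matrix.isUnit_iff_isUnit_det _).1 hH.isUnit
  refine ⟨(∑ i, ∑ j, H⁻¹ i j ^ 2) + 1, by positivity, fun y => ?_⟩
  have h2 := sum_sq_mulVec_le H⁻¹ (H *ᵥ y)
  rw [Matrix.mulVec_mulVec, Matrix.nonsing_inv_mul _ hdet, Matrix.one_mulVec] at h2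
  refine h2.trans (mul_le_mul_of_nonneg_right (by linarith) (Finset.sum_nonneg fun i _ => sq_nonneg _))

theorem Matrix.IsSymm.sum_mul_mulVec_comm (hH : H.IsSymm) (x y : Fin N → ℝ) :
    ∑ i, x i * (H *ᵥ y) i = ∑ i, y i * (H *ᵥ x) i := by
  change x ⬝ᵥ (H *ᵥ y) = y ⬝ᵥ (H *ᵥ x)
  rw [Matrix.dotProduct_mulVec, ← Matrix.mulVec_transpose, hH.eq, dotProduct_comm]

end Coupling

/-! ### Energy and correlation of the observer error -/

theorem sub_le_of_hasDerivWithinAt_le {f f' : ℝ → ℝ} {s T c : ℝ}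
    (hf : ∀ t ∈ Set.Icc s T, HasDerivWithinAt f (f' t) (Set.Icc s T) t)
    (hc : ∀ t ∈ Set.Icc s T, f' t ≤ c) {t₁ t₂ : ℝ} (h1 : t₁ ∈ Set.Icc s T) (h2 : t₂ ∈ Set.Icc s T)
    (h12 : t₁ ≤ t₂) : f t₂ - f t₁ ≤ c * (t₂ - t₁) := by
  have hd : ∀ t ∈ interior (Set.Icc s T), HasDerivAt f (f' t) t := fun t ht =>
    (hf t (interior_subset ht)).hasDerivAt (mem_interior_iff_mem_nhds.1 ht)
  exact (convex_Icc s T).image_sub_le_mul_sub_of_deriv_le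
    (fun t ht => (hf t ht).continuousWithinAt)
    (fun t ht => (hd t ht).differentiableAt.differentiableWithinAt)
    (fun t ht => by rw [(hd t ht).deriv]; exact hc t (interior_subset ht)) t₁ h1 t₂ h2 h12

/-- One oscillator of the observer in the error coordinates `(x, y, θ)`: the errors of the estimates
of the two coordinates `(v₁, v₂)` and of the frequency, with coupling matrix `H`. -/
structure IsErrorTrajectory {N : ℕ} (H : Matrix (Fin N) (Fin N) ℝ) (a w : ℝ) (v₁ v₂ : ℝ → ℝ)
    (s T : ℝ) (x y θ : ℝ → Fin N → ℝ) : Prop where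
  deriv_fst : ∀ t ∈ Set.Icc s T, ∀ i, HasDerivWithinAt (fun τ => x τ i)
    (w * (y t i - (H *ᵥ y t) i) + θ t i * (v₂ t + y t i - (H *ᵥ y t) i) - a * (H *ᵥ x t) i)
    (Set.Icc s T) t
  deriv_snd : ∀ t ∈ Set.Icc s T, ∀ i, HasDerivWithinAt (fun τ => y τ i)
    (-(w * (x t i - (H *ᵥ x t) i)) - θ t i * (v₁ t + x t i - (H *ᵥ x t) i) - a * (H *ᵥ y t) i)
    (Set.Icc s T) t
  deriv_freq : ∀ t ∈ Set.Icc s T, ∀ i, HasDerivWithinAt (fun τ => θ τ i)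
    ((v₁ t + x t i) * (H *ᵥ y t) i - (v₂ t + y t i) * (H *ᵥ x t) i) (Set.Icc s T) t

/-- The Lyapunov function of the observer. -/
noncomputable def errorEnergy {N : ℕ} (H : Matrix (Fin N) (Fin N) ℝ) (x y θ : Fin N → ℝ) : ℝ :=
  (∑ i, x i * (H *ᵥ x) i + ∑ i, y i * (H *ᵥ y) i + ∑ i, θ i ^ 2) / 2

section
variable {N : ℕ} {H : Matrix (Fin N) (Fin N) ℝ} {a w : ℝ} {v₁ v₂ : ℝ → ℝ} {s T : ℝ}
  {x y θ : ℝ → Fin N → ℝ}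

theorem hasDerivWithinAt_sum_mul_mulVec (hH : H.IsSymm) {I : Set ℝ} {t : ℝ} {x' : Fin N → ℝ}
    (hx : ∀ i, HasDerivWithinAt (fun τ => x τ i) (x' i) I t) :
    HasDerivWithinAt (fun τ => ∑ i, x τ i * (H *ᵥ x τ) i) (2 * ∑ i, x' i * (H *ᵥ x t) i) I t := by
  have h1 : ∀ i, HasDerivWithinAt (fun τ => (H *ᵥ x τ) i) ((H *ᵥ x') i) I t := fun i =>
    HasDerivWithinAt.fun_sum (u := Finset.univ) fun j _ => (hx j).const_mul (H i j)
  refine (HasDerivWithinAt.fun_sum fun i _ => (hx i).mul (h1 i)).congr_deriv ?_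
  rw [Finset.sum_add_distrib, hH.sum_mul_mulVec_comm (x t) x', two_mul]

/-- The frequency update is designed to cancel every term containing `θ`, and the symmetry of `H`
cancels the terms with `w`. Only the damping remains, and it does not see `θ`. -/
theorem IsErrorTrajectory.hasDerivWithinAt_energy (h : IsErrorTrajectory H a w v₁ v₂ s T x y θ)
    (hH : H.IsSymm) {t : ℝ} (ht : t ∈ Set.Icc s T) :
    HasDerivWithinAt (fun τ => errorEnergy H (x τ) (y τ) (θ τ))
      (-a * (∑ i, (H *ᵥ x t) i ^ 2 + ∑ i, (H *ᵥ y t) i ^ 2)) (Set.Icc s T) t := by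
  have h1 := hasDerivWithinAt_sum_mul_mulVec hH (h.deriv_fst t ht)
  have h2 := hasDerivWithinAt_sum_mul_mulVec hH (h.deriv_snd t ht)
  have h3 : HasDerivWithinAt (fun τ => ∑ i, θ τ i ^ 2) _ (Set.Icc s T) t :=
    HasDerivWithinAt.fun_sum fun i _ => (h.deriv_freq t ht i).pow 2
  refine (((h1.add h2).add h3).div_const 2).congr_deriv ?_
  have e := hH.sum_mul_mulVec_comm (x t) (y t)
  have e' : w * (∑ i, y t i * (H *ᵥ x t) i - ∑ i, x t i * (H *ᵥ y t) i) = 0 := by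
    rw [e, sub_self, mul_zero]
  rw [← add_zero (-a * _), ← e', Finset.mul_sum, Finset.mul_sum, ← Finset.sum_add_distrib,
    ← Finset.sum_add_distrib, Finset.sum_div, ← Finset.sum_add_distrib, Finset.mul_sum,
    ← Finset.sum_sub_distrib, Finset.mul_sum, ← Finset.sum_add_distrib]
  refine Finset.sum_congr rfl fun i _ => ?_
  push_cast
  ring

theorem IsErrorTrajectory.energy_antitone (h : IsErrorTrajectory H a w v₁ v₂ s T x y θ)
    (hH : H.IsSymm) (ha : 0 < a) {t₁ t₂ : ℝ} (h1 : t₁ ∈ Set.Icc s T) (h2 : t₂ ∈ Set.Icc s T)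
    (h12 : t₁ ≤ t₂) :
    errorEnergy H (x t₂) (y t₂) (θ t₂) ≤ errorEnergy H (x t₁) (y t₁) (θ t₁) := by
  have := sub_le_of_hasDerivWithinAt_le (c := 0) (fun t ht => h.hasDerivWithinAt_energy hH ht)
    (fun t _ => by
      have : 0 ≤ ∑ i, (H *ᵥ x t) i ^ 2 + ∑ i, (H *ᵥ y t) i ^ 2 := by positivity
      nlinarith) h1 h2 h12
  linarith

theorem sum_sq_le_errorEnergy {μ : ℝ} (hμ : ∀ y : Fin N → ℝ, ∑ i, y i ^ 2 ≤ μ * ∑ i, y i * (H *ᵥ y) i)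
    (hμ0 : 0 < μ) (x y θ : Fin N → ℝ) :
    ∑ i, x i ^ 2 + ∑ i, y i ^ 2 ≤ 2 * μ * errorEnergy H x y θ := by
  have h1 := hμ x
  have h2 := hμ y
  have h3 : 0 ≤ μ * ∑ i, θ i ^ 2 := by positivity
  rw [errorEnergy]
  linarith

theorem sum_sq_freq_le_errorEnergy (hH : H.PosSemidef) (x y θ : Fin N → ℝ) :
    ∑ i, θ i ^ 2 ≤ 2 * errorEnergy H x y θ := by
  have h1 : 0 ≤ ∑ i, x i * (H *ᵥ x) i := by
    have := hH.dotProduct_mulVec_nonneg x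
    rwa [star_trivial] at this
  have h2 : 0 ≤ ∑ i, y i * (H *ᵥ y) i := by
    have := hH.dotProduct_mulVec_nonneg y
    rwa [star_trivial] at this
  rw [errorEnergy]
  linarith

theorem errorEnergy_nonneg (hH : H.PosSemidef) (x y θ : Fin N → ℝ) : 0 ≤ errorEnergy H x y θ := by
  have := sum_sq_freq_le_errorEnergy hH x y θ
  have h0 : 0 ≤ ∑ i, θ i ^ 2 := by positivity
  linarith

/-- The correlation of the frequency error with the state error. -/
noncomputable def errorCorrelation {N : ℕ} (v₁ v₂ : ℝ) (x y θ : Fin N → ℝ) : ℝ :=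
  ∑ i, θ i * (x i * v₂ - y i * v₁)

/-- The gain is the term `θ²(v₁² + v₂²)`, which the derivative of the energy lacks. The terms `w x
v₁` and `w y v₂` drop out because error and exostate rotate at the same frequency. -/
theorem IsErrorTrajectory.hasDerivWithinAt_correlation
    (h : IsErrorTrajectory H a w v₁ v₂ s T x y θ)
    (hv₁ : ∀ t, HasDerivAt v₁ (w * v₂ t) t) (hv₂ : ∀ t, HasDerivAt v₂ (-(w * v₁ t)) t)
    {t : ℝ} (ht : t ∈ Set.Icc s T) :
    HasDerivWithinAt (fun τ => errorCorrelation (v₁ τ) (v₂ τ) (x τ) (y τ) (θ τ))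
      (∑ i, (θ t i ^ 2 * (v₁ t ^ 2 + v₂ t ^ 2) +
        θ t i * (θ t i * (x t i * v₁ t + y t i * v₂ t - (H *ᵥ y t) i * v₂ t - (H *ᵥ x t) i * v₁ t) -
          w * ((H *ᵥ y t) i * v₂ t + (H *ᵥ x t) i * v₁ t) -
          a * ((H *ᵥ x t) i * v₂ t - (H *ᵥ y t) i * v₁ t)) +
        ((v₁ t + x t i) * (H *ᵥ y t) i - (v₂ t + y t i) * (H *ᵥ x t) i) *
          (x t i * v₂ t - y t i * v₁ t)))
      (Set.Icc s T) t := by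
  have h1 : HasDerivWithinAt (fun τ => errorCorrelation (v₁ τ) (v₂ τ) (x τ) (y τ) (θ τ)) _
      (Set.Icc s T) t :=
    HasDerivWithinAt.fun_sum fun i _ => (h.deriv_freq t ht i).mul
      (((h.deriv_fst t ht i).mul (hv₂ t).hasDerivWithinAt).sub
        ((h.deriv_snd t ht i).mul (hv₁ t).hasDerivWithinAt))
  refine h1.congr_deriv (Finset.sum_congr rfl fun i _ => ?_)
  ring

theorem add_four_sq_le (p q r s : ℝ) :
    (p + q + r + s) ^ 2 ≤ 4 * (p ^ 2 + q ^ 2 + r ^ 2 + s ^ 2) := by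
  linarith [sq_nonneg (p - q), sq_nonneg (p - r), sq_nonneg (p - s), sq_nonneg (q - r),
    sq_nonneg (q - s), sq_nonneg (r - s)]

/-- The pointwise estimate behind the strict Lyapunov function. -/
theorem correlation_rate_lower_bound {r B Θ Z w a v₁ v₂ x y e f θ : ℝ} (hr : 0 < r)
    (ha : 0 < a) (hv : v₁ ^ 2 + v₂ ^ 2 = r) (h1 : |v₁| ≤ B) (h2 : |v₂| ≤ B) (hθ : |θ| ≤ Θ)
    (hx : |x| ≤ Z) (hy : |y| ≤ Z) :
    r / 2 * θ ^ 2 - 4 * ((B * (Θ + |w| + a)) ^ 2 / (2 * r) + B * (B + Z)) *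
        (x ^ 2 + y ^ 2 + e ^ 2 + f ^ 2) ≤
      θ ^ 2 * (v₁ ^ 2 + v₂ ^ 2) + θ * (θ * (x * v₁ + y * v₂ - f * v₂ - e * v₁) -
        w * (f * v₂ + e * v₁) - a * (e * v₂ - f * v₁)) +
        ((v₁ + x) * f - (v₂ + y) * e) * (x * v₂ - y * v₁) := by
  set q := |x| + |y| + |e| + |f| with hq
  have hB : 0 ≤ B := (abs_nonneg _).trans h1
  have hZ : 0 ≤ Z := (abs_nonneg _).trans hx
  have hΘ : 0 ≤ Θ := (abs_nonneg _).trans hθ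
  have hq0 : 0 ≤ q := by positivity
  have b1 : |x * v₁ + y * v₂ - f * v₂ - e * v₁| ≤ B * q := by
    calc _ ≤ |x * v₁| + |y * v₂| + |f * v₂| + |e * v₁| := by
          refine (abs_sub _ _).trans (add_le_add_left ((abs_sub _ _).trans
            (add_le_add_left (abs_add_le _ _) _)) _)
      _ ≤ |x| * B + |y| * B + |f| * B + |e| * B := by
          simp only [abs_mul]; gcongr
      _ = _ := by rw [hq]; ring
  have b2 : |f * v₂ + e * v₁| ≤ B * q := by
    calc _ ≤ |f * v₂| + |e * v₁| := abs_add_le _ _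
      _ ≤ |f| * B + |e| * B := by simp only [abs_mul]; gcongr
      _ ≤ _ := by rw [hq]; nlinarith [abs_nonneg x, abs_nonneg y]
  have b3 : |e * v₂ - f * v₁| ≤ B * q := by
    calc _ ≤ |e * v₂| + |f * v₁| := abs_sub _ _
      _ ≤ |e| * B + |f| * B := by simp only [abs_mul]; gcongr
      _ ≤ _ := by rw [hq]; nlinarith [abs_nonneg x, abs_nonneg y]
  have b4 : |x * v₂ - y * v₁| ≤ B * q := by
    calc _ ≤ |x * v₂| + |y * v₁| := abs_sub _ _
      _ ≤ |x| * B + |y| * B := by simp only [abs_mul]; gcongr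
      _ ≤ _ := by rw [hq]; nlinarith [abs_nonneg e, abs_nonneg f]
  have b5 : |(v₁ + x) * f - (v₂ + y) * e| ≤ (B + Z) * q := by
    calc _ ≤ |(v₁ + x) * f| + |(v₂ + y) * e| := abs_sub _ _
      _ ≤ (B + Z) * |f| + (B + Z) * |e| := by
          simp only [abs_mul]
          have := (abs_add_le v₁ x).trans (add_le_add h1 hx)
          have := (abs_add_le v₂ y).trans (add_le_add h2 hy)
          gcongr
      _ ≤ _ := by
          have : 0 ≤ (B + Z) * (|x| + |y|) := by positivity
          rw [hq]; linarith
  set L := B * (Θ + |w| + a) with hL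
  have b6 : |θ * (x * v₁ + y * v₂ - f * v₂ - e * v₁) - w * (f * v₂ + e * v₁) -
      a * (e * v₂ - f * v₁)| ≤ L * q := by
    calc _ ≤ |θ * (x * v₁ + y * v₂ - f * v₂ - e * v₁)| + |w * (f * v₂ + e * v₁)| +
          |a * (e * v₂ - f * v₁)| :=
          (abs_sub _ _).trans (add_le_add_left (abs_sub _ _) _)
      _ ≤ Θ * (B * q) + |w| * (B * q) + a * (B * q) := by
          simp only [abs_mul, abs_of_pos ha]
          gcongr
      _ = _ := by rw [hL]; ring
  have b7 : -(|θ| * (L * q)) ≤ θ * (θ * (x * v₁ + y * v₂ - f * v₂ - e * v₁) -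
      w * (f * v₂ + e * v₁) - a * (e * v₂ - f * v₁)) := by
    refine neg_le_of_abs_le ?_
    rw [abs_mul]; gcongr
  have b8 : -(((B + Z) * q) * (B * q)) ≤
      ((v₁ + x) * f - (v₂ + y) * e) * (x * v₂ - y * v₁) := by
    refine neg_le_of_abs_le ?_
    rw [abs_mul]; gcongr
  -- Young's inequality, weighted so that the cross term uses up only half of the excitation `r θ²`.
  have b9 : |θ| * (L * q) ≤ r / 2 * θ ^ 2 + L ^ 2 / (2 * r) * q ^ 2 := by
    have h3 : 0 ≤ (r * |θ| - L * q) ^ 2 / (2 * r) := by positivity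
    have h4 : (r * |θ| - L * q) ^ 2 / (2 * r) =
        r / 2 * |θ| ^ 2 + L ^ 2 / (2 * r) * q ^ 2 - |θ| * (L * q) := by
      field_simp; ring
    rw [sq_abs] at h4
    linarith
  have b10 : q ^ 2 ≤ 4 * (x ^ 2 + y ^ 2 + e ^ 2 + f ^ 2) := by
    rw [hq, ← sq_abs x, ← sq_abs y, ← sq_abs e, ← sq_abs f]
    exact add_four_sq_le _ _ _ _
  have b11 : (L ^ 2 / (2 * r) + B * (B + Z)) * q ^ 2 ≤
      (L ^ 2 / (2 * r) + B * (B + Z)) * (4 * (x ^ 2 + y ^ 2 + e ^ 2 + f ^ 2)) := by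
    gcongr
  rw [hv]
  linarith

end

/-! ### Settling times of the observer -/

section
variable {N : ℕ} {H : Matrix (Fin N) (Fin N) ℝ} {a w : ℝ} {v₁ v₂ : ℝ → ℝ} {s T : ℝ}
  {x y θ : ℝ → Fin N → ℝ}

theorem IsErrorTrajectory.mono (h : IsErrorTrajectory H a w v₁ v₂ s T x y θ) {s' T' : ℝ}
    (hs : s ≤ s') (hT : T' ≤ T) : IsErrorTrajectory H a w v₁ v₂ s' T' x y θ :=
  have hsub : Set.Icc s' T' ⊆ Set.Icc s T := Set.Icc_subset_Icc hs hT
  ⟨fun t ht i => (h.deriv_fst t (hsub ht) i).mono hsub,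
    fun t ht i => (h.deriv_snd t (hsub ht) i).mono hsub,
    fun t ht i => (h.deriv_freq t (hsub ht) i).mono hsub⟩

theorem hasDerivWithinAt_comp_add {f : ℝ → ℝ} {f' c s T t : ℝ}
    (h : HasDerivWithinAt f f' (Set.Icc s T) (t + c)) :
    HasDerivWithinAt (fun τ => f (τ + c)) f' (Set.Icc (s - c) (T - c)) t := by
  have h1 := HasDerivWithinAt.comp (h := fun τ => τ + c) (h' := 1) t h
    ((hasDerivAt_id t).add_const c).hasDerivWithinAt
    (s := Set.Icc (s - c) (T - c)) fun τ hτ => ⟨by linarith [hτ.1], by linarith [hτ.2]⟩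
  rwa [mul_one] at h1

theorem IsErrorTrajectory.shift (h : IsErrorTrajectory H a w v₁ v₂ s T x y θ) (c : ℝ) :
    IsErrorTrajectory H a w (fun t => v₁ (t + c)) (fun t => v₂ (t + c)) (s - c) (T - c)
      (fun t => x (t + c)) (fun t => y (t + c)) (fun t => θ (t + c)) := by
  have hsub : ∀ t ∈ Set.Icc (s - c) (T - c), t + c ∈ Set.Icc s T := fun t ht =>
    ⟨by linarith [ht.1], by linarith [ht.2]⟩
  exact ⟨fun t ht i => hasDerivWithinAt_comp_add (h.deriv_fst _ (hsub t ht) i),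
    fun t ht i => hasDerivWithinAt_comp_add (h.deriv_snd _ (hsub t ht) i),
    fun t ht i => hasDerivWithinAt_comp_add (h.deriv_freq _ (hsub t ht) i)⟩

/-- The crude bound `1 + c` in place of `√c` avoids square roots in the constants that follow. -/
theorem abs_le_one_add_of_sum_sq_le {ι : Type*} [Fintype ι] {y : ι → ℝ} {c : ℝ} (hc : 0 ≤ c)
    (h : ∑ i, y i ^ 2 ≤ c) (i : ι) : |y i| ≤ 1 + c := by
  have h1 : y i ^ 2 ≤ ∑ j, y j ^ 2 :=
    Finset.single_le_sum (f := fun j => y j ^ 2) (fun j _ => sq_nonneg _) (Finset.mem_univ i)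
  exact abs_le_of_sq_le_sq (by nlinarith) (by linarith)

theorem abs_le_one_add_of_sq_add_sq_eq {b c r : ℝ} (h : b ^ 2 + c ^ 2 = r) :
    |b| ≤ 1 + r ∧ |c| ≤ 1 + r := by
  have hb := sq_nonneg b
  have hc := sq_nonneg c
  exact ⟨abs_le_of_sq_le_sq (by nlinarith) (by linarith),
    abs_le_of_sq_le_sq (by nlinarith) (by linarith)⟩

theorem abs_mul_add_le (p q r : ℝ) : |p| * (|q| + |r|) ≤ p ^ 2 + (q ^ 2 + r ^ 2) := by
  rw [← sq_abs p, ← sq_abs q, ← sq_abs r]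
  nlinarith [sq_nonneg (|p| - |q|), sq_nonneg (|p| - |r|)]

set_option maxHeartbeats 800000 in
/-- Uniform settling time of the observer while the exosystem oscillates. -/
theorem exists_settlingTime_of_oscillating (hH : H.PosDef) (ha : 0 < a) (w : ℝ) {r E δ : ℝ}
    (hr : 0 < r) (hE : 0 ≤ E) (hδ : 0 < δ) :
    ∃ L : ℝ, 0 ≤ L ∧ ∀ (v₁ v₂ : ℝ → ℝ) (s T : ℝ) (x y θ : ℝ → Fin N → ℝ),
      (∀ t, HasDerivAt v₁ (w * v₂ t) t) → (∀ t, HasDerivAt v₂ (-(w * v₁ t)) t) →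
      (∀ t, v₁ t ^ 2 + v₂ t ^ 2 = r) → IsErrorTrajectory H a w v₁ v₂ s T x y θ →
      errorEnergy H (x s) (y s) (θ s) ≤ E → ∀ τ ∈ Set.Icc s T, s + L ≤ τ →
      errorEnergy H (x τ) (y τ) (θ τ) ≤ δ := by
  have hHs : H.IsSymm := hH.posSemidef.isSymm
  obtain ⟨μ, hμ0, hμ⟩ := hH.exists_sum_sq_le
  obtain ⟨ν, hν0, hν⟩ := hH.exists_sum_sq_le_sum_sq_mulVec
  -- `B`, `Θ` and `Z` bound the exostate, the frequency errors and the state errors at energy at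
  -- most `E`; `G` is the resulting loss coefficient in `correlation_rate_lower_bound`.
  set B := 1 + r with hB
  set Θ := 1 + 2 * E with hΘ
  set Z := 1 + 2 * μ * E with hZ
  set G := 4 * ((B * (Θ + |w| + a)) ^ 2 / (2 * r) + B * (B + Z)) with hG
  have hG0 : 0 ≤ G := by positivity
  -- The first summand lets the damping absorb the loss from the correlation with a unit to spare;
  -- the second makes `M V` dominate `|g|`, so that `0 ≤ M V - g ≤ 2 M V`.
  set M := (G * (1 + ν) + 1) / a + 2 * B * (1 + μ) with hM
  have hM0 : 0 < M := by positivity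
  -- With this `k` the energy is at most `k` times the guaranteed decay rate of `M V - g`.
  set k := (1 + ν) / 4 + 1 / r with hk
  have hk0 : 0 < k := by positivity
  have hL0 : 0 ≤ k * (2 * M * E + 1) / δ := by positivity
  refine ⟨k * (2 * M * E + 1) / δ, hL0, fun v₁ v₂ s T x y θ hv₁ hv₂ hv h hs τ hτ hsτ => ?_⟩
  -- If the energy still exceeds `δ` at `τ`, monotonicity keeps it above `δ` on all of `[s, τ]`.
  -- Then `M V - g`, which starts at most at `2 M E`, falls at rate at least `δ / k` and would be
  -- negative at `τ`.
  by_contra! hcon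
  have hsT : s ∈ Set.Icc s T := Set.left_mem_Icc.2 (hτ.1.trans hτ.2)
  have hs' : s ≤ τ := hτ.1
  set V := fun t => errorEnergy H (x t) (y t) (θ t) with hV
  set g := fun t => errorCorrelation (v₁ t) (v₂ t) (x t) (y t) (θ t) with hg
  have hVE : ∀ t ∈ Set.Icc s τ, V t ≤ E := fun t ht =>
    (h.energy_antitone hHs ha hsT ⟨ht.1, ht.2.trans hτ.2⟩ ht.1).trans hs
  have hVδ : ∀ t ∈ Set.Icc s τ, δ ≤ V t := fun t ht =>
    hcon.le.trans (h.energy_antitone hHs ha ⟨ht.1, ht.2.trans hτ.2⟩ hτ ht.2)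
  have hvB : ∀ t, |v₁ t| ≤ B ∧ |v₂ t| ≤ B := fun t => abs_le_one_add_of_sq_add_sq_eq (hv t)
  have hpos := fun t => sum_sq_le_errorEnergy hμ hμ0 (x t) (y t) (θ t)
  have hfreq := fun t => sum_sq_freq_le_errorEnergy hH.posSemidef (x t) (y t) (θ t)
  have hV0 : ∀ t, 0 ≤ V t := fun t => errorEnergy_nonneg hH.posSemidef _ _ _
  have hgb : ∀ t, |g t| ≤ M * V t := by
    intro t
    have h1 : |g t| ≤ B * (∑ i, θ t i ^ 2 + (∑ i, x t i ^ 2 + ∑ i, y t i ^ 2)) := by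
      rw [← Finset.sum_add_distrib, ← Finset.sum_add_distrib, Finset.mul_sum]
      refine (Finset.abs_sum_le_sum_abs _ _).trans (Finset.sum_le_sum fun i _ => ?_)
      have h2 : |x t i * v₂ t - y t i * v₁ t| ≤ B * (|x t i| + |y t i|) := by
        calc _ ≤ |x t i * v₂ t| + |y t i * v₁ t| := abs_sub _ _
          _ ≤ |x t i| * B + |y t i| * B := by
              simp only [abs_mul]
              have := hvB t
              gcongr
              exacts [this.2, this.1]
          _ = _ := by ring
      rw [abs_mul]
      have h3 := abs_mul_add_le (θ t i) (x t i) (y t i)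
      calc _ ≤ |θ t i| * (B * (|x t i| + |y t i|)) := by gcongr
        _ = B * (|θ t i| * (|x t i| + |y t i|)) := by ring
        _ ≤ _ := by gcongr
    have h4 : B * (∑ i, θ t i ^ 2 + (∑ i, x t i ^ 2 + ∑ i, y t i ^ 2)) ≤
        B * (2 * V t + 2 * μ * V t) := by
      have := hpos t
      have := hfreq t
      gcongr
    have h5 : 0 ≤ (G * (1 + ν) + 1) / a * V t := mul_nonneg (by positivity) (hV0 t)
    rw [hM]
    linarith
  set U := fun t => M * V t - g t with hU
  set U' : ℝ → ℝ := fun t => M * (-a * (∑ i, (H *ᵥ x t) i ^ 2 + ∑ i, (H *ᵥ y t) i ^ 2)) -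
      (∑ i, (θ t i ^ 2 * (v₁ t ^ 2 + v₂ t ^ 2) +
        θ t i * (θ t i * (x t i * v₁ t + y t i * v₂ t - (H *ᵥ y t) i * v₂ t - (H *ᵥ x t) i * v₁ t) -
          w * ((H *ᵥ y t) i * v₂ t + (H *ᵥ x t) i * v₁ t) -
          a * ((H *ᵥ x t) i * v₂ t - (H *ᵥ y t) i * v₁ t)) +
        ((v₁ t + x t i) * (H *ᵥ y t) i - (v₂ t + y t i) * (H *ᵥ x t) i) *
          (x t i * v₂ t - y t i * v₁ t))) with hU'
  have h' := h.mono le_rfl hτ.2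
  have hUd : ∀ t ∈ Set.Icc s τ, HasDerivWithinAt U (U' t) (Set.Icc s τ) t := fun t ht =>
    ((h'.hasDerivWithinAt_energy hHs ht).const_mul M).sub
      (h'.hasDerivWithinAt_correlation hv₁ hv₂ ht)
  have hUle : ∀ t ∈ Set.Icc s τ, U' t ≤ -(δ / k) := by
    intro t ht
    have e1 : ∑ i, x t i ^ 2 + ∑ i, y t i ^ 2 ≤ 2 * μ * E :=
      (hpos t).trans (by have := hVE t ht; gcongr)
    have e2 : ∑ i, θ t i ^ 2 ≤ 2 * E := (hfreq t).trans (by have := hVE t ht; gcongr)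
    have px : 0 ≤ ∑ i, x t i ^ 2 := by positivity
    have py : 0 ≤ ∑ i, y t i ^ 2 := by positivity
    have hsum := Finset.sum_le_sum fun i (_ : i ∈ Finset.univ) =>
      correlation_rate_lower_bound (w := w) (e := (H *ᵥ x t) i) (f := (H *ᵥ y t) i) hr ha (hv t)
        (hvB t).1 (hvB t).2
        (abs_le_one_add_of_sum_sq_le (by positivity) e2 i)
        (abs_le_one_add_of_sum_sq_le (y := x t) (by positivity) (by linarith : _ ≤ 2 * μ * E) i)
        (abs_le_one_add_of_sum_sq_le (y := y t) (by positivity) (by linarith : _ ≤ 2 * μ * E) i)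
    rw [Finset.sum_sub_distrib, ← Finset.mul_sum, ← Finset.mul_sum, Finset.sum_add_distrib,
      Finset.sum_add_distrib, Finset.sum_add_distrib] at hsum
    have nx := hν (x t)
    have ny := hν (y t)
    set Sx := ∑ i, (H *ᵥ x t) i ^ 2
    set Sy := ∑ i, (H *ᵥ y t) i ^ 2
    set Qx := ∑ i, x t i ^ 2
    set Qy := ∑ i, y t i ^ 2
    set Qθ := ∑ i, θ t i ^ 2 with hQθ
    have hSx : 0 ≤ Sx := by positivity
    have hSy : 0 ≤ Sy := by positivity
    have hQ : 0 ≤ Qθ := by positivity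
    have e3 : G * (Qx + Qy + Sx + Sy) ≤ G * ((1 + ν) * (Sx + Sy)) := by
      gcongr; linarith
    have e4 : U' t ≤ -(Sx + Sy + r / 2 * Qθ) := by
      have e5 : M * (-a * (Sx + Sy)) ≤ -(G * (1 + ν) + 1) * (Sx + Sy) := by
        have e6 : G * (1 + ν) + 1 ≤ M * a := by
          have : 0 ≤ 2 * B * (1 + μ) * a := by positivity
          rw [hM, add_mul, div_mul_cancel₀ _ ha.ne']
          linarith
        have e8 := mul_le_mul_of_nonneg_right e6 (add_nonneg hSx hSy)
        linarith
      rw [hU']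
      simp only
      linarith
    have e7 : V t ≤ k * (Sx + Sy + r / 2 * Qθ) := by
      have c1 : ∀ z : Fin N → ℝ, ∑ i, z i * (H *ᵥ z) i ≤ (1 + ν) / 2 * ∑ i, (H *ᵥ z) i ^ 2 := by
        intro z
        have : ∑ i, z i * (H *ᵥ z) i ≤ ∑ i, (z i ^ 2 + (H *ᵥ z) i ^ 2) / 2 :=
          Finset.sum_le_sum fun i _ => by nlinarith [sq_nonneg (z i - (H *ᵥ z) i)]
        rw [← Finset.sum_div, Finset.sum_add_distrib] at this
        linarith [hν z]
      have c2 := c1 (x t)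
      have c3 := c1 (y t)
      have c4 : k * (Sx + Sy + r / 2 * Qθ) = (1 + ν) / 4 * (Sx + Sy) + Qθ / 2 +
          ((1 + ν) / 4 * (r / 2 * Qθ) + 1 / r * (Sx + Sy)) := by
        rw [hk]; field_simp; ring
      have c5 : 0 ≤ (1 + ν) / 4 * (r / 2 * Qθ) + 1 / r * (Sx + Sy) := by positivity
      rw [c4, hV]
      simp only [errorEnergy]
      linarith
    have e8 : δ / k ≤ Sx + Sy + r / 2 * Qθ := by
      rw [div_le_iff₀' hk0]
      exact (hVδ t ht).trans e7
    linarith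
  have hfin := sub_le_of_hasDerivWithinAt_le hUd hUle (Set.left_mem_Icc.2 hs')
    (Set.right_mem_Icc.2 hs') hs'
  have f1 : 0 ≤ U τ := sub_nonneg.2 ((le_abs_self _).trans (hgb τ))
  have f2 : U s ≤ 2 * M * E := by
    have := (neg_le_abs _).trans (hgb s)
    have : M * V s ≤ M * E := by have := hs; gcongr
    simp only [hU]
    linarith
  have f3 : 2 * M * E + 1 ≤ δ / k * (τ - s) := by
    have : δ / k * (k * (2 * M * E + 1) / δ) ≤ δ / k * (τ - s) := by
      gcongr; linarith
    calc 2 * M * E + 1 = δ / k * (k * (2 * M * E + 1) / δ) := by field_simp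
      _ ≤ _ := this
  linarith

/-- The vector field of the observer error while the exosystem is at rest. -/
noncomputable def restField (H : Matrix (Fin N) (Fin N) ℝ) (a w : ℝ)
    (q : (Fin N → ℝ) × (Fin N → ℝ) × (Fin N → ℝ)) :
    (Fin N → ℝ) × (Fin N → ℝ) × (Fin N → ℝ) :=
  (fun i => w * (q.2.1 i - (H *ᵥ q.2.1) i) + q.2.2 i * (q.2.1 i - (H *ᵥ q.2.1) i) -
      a * (H *ᵥ q.1) i,
    fun i => -(w * (q.1 i - (H *ᵥ q.1) i)) - q.2.2 i * (q.1 i - (H *ᵥ q.1) i) - a * (H *ᵥ q.2.1) i,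
    fun i => q.1 i * (H *ᵥ q.2.1) i - q.2.1 i * (H *ᵥ q.1) i)

theorem contDiff_restField (H : Matrix (Fin N) (Fin N) ℝ) (a w : ℝ) :
    ContDiff ℝ 1 (restField H a w) := by
  unfold restField
  simp only [Matrix.mulVec, dotProduct]
  refine ContDiff.prodMk (contDiff_pi.2 fun i => ?_) (ContDiff.prodMk (contDiff_pi.2 fun i => ?_)
    (contDiff_pi.2 fun i => ?_)) <;> fun_prop

theorem IsErrorTrajectory.hasDerivWithinAt_rest
    (h : IsErrorTrajectory H a w (fun _ => 0) (fun _ => 0) s T x y θ) {t : ℝ}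
    (ht : t ∈ Set.Icc s T) :
    HasDerivWithinAt (fun τ => (x τ, y τ, θ τ)) (restField H a w (x t, y t, θ t))
      (Set.Icc s T) t := by
  refine HasDerivWithinAt.prodMk (hasDerivWithinAt_pi.2 fun i => ?_)
    (HasDerivWithinAt.prodMk (hasDerivWithinAt_pi.2 fun i => ?_) (hasDerivWithinAt_pi.2 fun i => ?_))
  · simpa only [zero_add] using h.deriv_fst t ht i
  · simpa only [zero_add] using h.deriv_snd t ht i
  · simpa only [zero_add] using h.deriv_freq t ht i

/-- Both trajectories stay in a common ball, on which the autonomous `C¹` field is Lipschitz.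
Uniqueness allows trajectories with different horizons to be compared. -/
theorem IsErrorTrajectory.rest_unique
    (h : IsErrorTrajectory H a w (fun _ => 0) (fun _ => 0) s T x y θ) {x' y' θ' : ℝ → Fin N → ℝ}
    (h' : IsErrorTrajectory H a w (fun _ => 0) (fun _ => 0) s T x' y' θ')
    (h0 : (x s, y s, θ s) = (x' s, y' s, θ' s)) {t : ℝ} (ht : t ∈ Set.Icc s T) :
    (x t, y t, θ t) = (x' t, y' t, θ' t) := by
  have hc : ContinuousOn (fun τ => (x τ, y τ, θ τ)) (Set.Icc s T) := fun τ hτ =>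
    (h.hasDerivWithinAt_rest hτ).continuousWithinAt
  have hc' : ContinuousOn (fun τ => (x' τ, y' τ, θ' τ)) (Set.Icc s T) := fun τ hτ =>
    (h'.hasDerivWithinAt_rest hτ).continuousWithinAt
  obtain ⟨ρ₁, hρ₁⟩ := isCompact_Icc.exists_bound_of_continuousOn hc
  obtain ⟨ρ₂, hρ₂⟩ := isCompact_Icc.exists_bound_of_continuousOn hc'
  set D := Metric.closedBall (0 : (Fin N → ℝ) × (Fin N → ℝ) × (Fin N → ℝ)) (max ρ₁ ρ₂)
  obtain ⟨K, hK⟩ := LocallyLipschitzOn.exists_lipschitzOnWith_of_compact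
    (isCompact_closedBall (0 : (Fin N → ℝ) × (Fin N → ℝ) × (Fin N → ℝ)) (max ρ₁ ρ₂))
    ((contDiff_restField H a w).locallyLipschitz.locallyLipschitzOn)
  have hnhds : ∀ τ ∈ Set.Ico s T, Set.Icc s T ∈ 𝓝[≥] τ := fun τ hτ => Icc_mem_nhdsGE_of_mem hτ
  exact ODE_solution_unique_of_mem_Icc_right (v := fun _ => restField H a w) (s := fun _ => D)
    (fun _ _ => hK) hc
    (fun τ hτ => (h.hasDerivWithinAt_rest (Set.Ico_subset_Icc_self hτ)).mono_of_mem_nhdsWithin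
      (hnhds τ hτ))
    (fun τ hτ => mem_closedBall_zero_iff.2 ((hρ₁ τ (Set.Ico_subset_Icc_self hτ)).trans
      (le_max_left _ _))) hc'
    (fun τ hτ => (h'.hasDerivWithinAt_rest (Set.Ico_subset_Icc_self hτ)).mono_of_mem_nhdsWithin
      (hnhds τ hτ))
    (fun τ hτ => mem_closedBall_zero_iff.2 ((hρ₂ τ (Set.Ico_subset_Icc_self hτ)).trans
      (le_max_right _ _))) h0 ht

/-- While the exosystem is at rest, each time at which the error is not small costs energy. -/
theorem exists_energy_drop_of_rest (hH : H.PosDef) (ha : 0 < a) (w : ℝ) {E δ : ℝ} (hE : 0 ≤ E)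
    (hδ : 0 < δ) :
    ∃ γ > 0, ∀ (T : ℝ) (x y θ : ℝ → Fin N → ℝ),
      IsErrorTrajectory H a w (fun _ => 0) (fun _ => 0) 0 T x y θ →
      errorEnergy H (x 0) (y 0) (θ 0) ≤ E → ∀ τ ∈ Set.Icc 1 T,
      δ ≤ ∑ i, x τ i ^ 2 + ∑ i, y τ i ^ 2 →
      errorEnergy H (x τ) (y τ) (θ τ) ≤ errorEnergy H (x (τ - 1)) (y (τ - 1)) (θ (τ - 1)) - γ := by
  have hHs : H.IsSymm := hH.posSemidef.isSymm
  obtain ⟨μ, hμ0, hμ⟩ := hH.exists_sum_sq_le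
  obtain ⟨ν, hν0, hν⟩ := hH.exists_sum_sq_le_sum_sq_mulVec
  -- The derivative of the squared state error along the field, bounded on the ball that energy at
  -- most `E` allows.
  let rate : (Fin N → ℝ) × (Fin N → ℝ) × (Fin N → ℝ) → ℝ := fun q =>
    ∑ i, 2 * q.1 i * (restField H a w q).1 i + ∑ i, 2 * q.2.1 i * (restField H a w q).2.1 i
  have hrate : Continuous rate := by
    have := (contDiff_restField H a w).continuous
    fun_prop
  set Z := 1 + (2 * μ * E + 2 * E) with hZ
  obtain ⟨Rb, hRb⟩ := (isCompact_closedBall (0 : (Fin N → ℝ) × (Fin N → ℝ) × (Fin N → ℝ))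
    Z).exists_bound_of_continuousOn hrate.continuousOn
  set R := max Rb 0 + 1 with hR
  have hR0 : 0 < R := by positivity
  -- Squared state error `δ` at `τ`, growing at rate at most `R`, was at least `δ / 2` during the
  -- preceding time `l`; the damping on that interval costs the energy `γ`. The cap 1 keeps the
  -- interval inside `[τ - 1, τ]`.
  set l := min 1 (δ / (2 * R)) with hl
  have hl0 : 0 < l := by positivity
  refine ⟨a * (δ / 2 / ν) * l, by positivity, fun T x y θ h hE0 τ hτ hδτ => ?_⟩
  have h0T : (0 : ℝ) ∈ Set.Icc 0 T := ⟨le_rfl, by linarith [hτ.1, hτ.2]⟩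
  have hτ0 : τ ∈ Set.Icc 0 T := ⟨by linarith [hτ.1], hτ.2⟩
  have hVE : ∀ t ∈ Set.Icc 0 T, errorEnergy H (x t) (y t) (θ t) ≤ E := fun t ht =>
    (h.energy_antitone hHs ha h0T ht ht.1).trans hE0
  have hmem : ∀ t ∈ Set.Icc 0 T, ‖(x t, y t, θ t)‖ ≤ Z := by
    intro t ht
    have e1 : ∑ i, x t i ^ 2 + ∑ i, y t i ^ 2 ≤ 2 * μ * E :=
      (sum_sq_le_errorEnergy hμ hμ0 (x t) (y t) (θ t)).trans (by have := hVE t ht; gcongr)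
    have e2 : ∑ i, θ t i ^ 2 ≤ 2 * E :=
      (sum_sq_freq_le_errorEnergy hH.posSemidef (x t) (y t) (θ t)).trans
        (by have := hVE t ht; gcongr)
    have px : 0 ≤ ∑ i, x t i ^ 2 := by positivity
    have py : 0 ≤ ∑ i, y t i ^ 2 := by positivity
    have pμ : 0 ≤ 2 * μ * E := by positivity
    refine norm_prod_le_iff.2 ⟨?_, norm_prod_le_iff.2 ⟨?_, ?_⟩⟩ <;>
      refine (pi_norm_le_iff_of_nonneg (by positivity)).2 fun i =>
        abs_le_one_add_of_sum_sq_le (by positivity) ?_ i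
    · linarith
    · linarith
    · linarith
  have hWd : ∀ t ∈ Set.Icc 0 T, HasDerivWithinAt (fun t => ∑ i, x t i ^ 2 + ∑ i, y t i ^ 2)
      (rate (x t, y t, θ t)) (Set.Icc 0 T) t := by
    intro t ht
    have hd := h.hasDerivWithinAt_rest ht
    have hd1 := fun i => hasDerivWithinAt_pi.1
      ((ContinuousLinearMap.fst ℝ _ _).hasFDerivAt.comp_hasDerivWithinAt t hd) i
    have hd2 := fun i => hasDerivWithinAt_pi.1 ((ContinuousLinearMap.fst ℝ _ _).hasFDerivAt.comp_hasDerivWithinAt t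
      ((ContinuousLinearMap.snd ℝ _ _).hasFDerivAt.comp_hasDerivWithinAt t hd)) i
    refine (HasDerivWithinAt.add (HasDerivWithinAt.fun_sum fun i _ => (hd1 i).pow 2)
      (HasDerivWithinAt.fun_sum fun i _ => (hd2 i).pow 2)).congr_deriv ?_
    simp [rate]
  have hl1 : l ≤ 1 := min_le_left _ _
  have hτl : τ - l ∈ Set.Icc 0 T := ⟨by linarith [hτ.1], by linarith [hτ.2]⟩
  have hW : ∀ t ∈ Set.Icc (τ - l) τ, δ / 2 ≤ ∑ i, x t i ^ 2 + ∑ i, y t i ^ 2 := by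
    intro t ht
    have ht0 : t ∈ Set.Icc 0 T := ⟨by linarith [hτl.1, ht.1], ht.2.trans hτ.2⟩
    have h1 := sub_le_of_hasDerivWithinAt_le (c := R) hWd (fun t ht => by
      have := (le_abs_self _).trans (hRb _ (mem_closedBall_zero_iff.2 (hmem t ht)))
      exact this.trans ((le_max_left _ _).trans (by linarith))) ht0 hτ0 ht.2
    have h2 : R * (τ - t) ≤ R * (δ / (2 * R)) := by
      have : τ - t ≤ δ / (2 * R) := by linarith [ht.1, min_le_right 1 (δ / (2 * R))]
      gcongr
    have h3 : R * (δ / (2 * R)) = δ / 2 := by field_simp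
    linarith
  have hτ1 : τ - 1 ∈ Set.Icc 0 T := ⟨by linarith [hτ.1], by linarith [hτ.2]⟩
  have hd1 := h.energy_antitone hHs ha hτ1 hτl (by linarith)
  have h' := h.mono hτl.1 hτ.2
  have hττ : τ - l ≤ τ := by linarith
  have hd2 := sub_le_of_hasDerivWithinAt_le (c := -(a * (δ / 2 / ν)))
    (fun t ht => h'.hasDerivWithinAt_energy hHs ht) (fun t ht => by
      have n1 := hν (x t)
      have n2 := hν (y t)
      have n3 : δ / 2 / ν ≤ ∑ i, (H *ᵥ x t) i ^ 2 + ∑ i, (H *ᵥ y t) i ^ 2 := by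
        rw [div_le_iff₀' hν0]
        linarith [hW t ht]
      nlinarith) (Set.left_mem_Icc.2 hττ) (Set.right_mem_Icc.2 hττ) hττ
  rw [sub_sub_cancel] at hd2
  linarith

/-- Settling time of the observer from a given initial value while the exosystem is at rest. -/
theorem exists_settlingTime_of_rest (hH : H.PosDef) (ha : 0 < a) (w : ℝ) {δ : ℝ} (hδ : 0 < δ)
    (x₀ y₀ θ₀ : Fin N → ℝ) :
    ∃ L : ℝ, 0 ≤ L ∧ ∀ (T : ℝ) (x y θ : ℝ → Fin N → ℝ),
      IsErrorTrajectory H a w (fun _ => 0) (fun _ => 0) 0 T x y θ →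
      (x 0, y 0, θ 0) = (x₀, y₀, θ₀) → ∀ τ ∈ Set.Icc 0 T, L ≤ τ →
      ∑ i, x τ i ^ 2 + ∑ i, y τ i ^ 2 ≤ δ := by
  have hHs : H.IsSymm := hH.posSemidef.isSymm
  set E := errorEnergy H x₀ y₀ θ₀ with hE
  obtain ⟨γ, hγ, hdrop⟩ := exists_energy_drop_of_rest hH ha w
    (errorEnergy_nonneg hH.posSemidef x₀ y₀ θ₀) hδ
  by_contra! hcon
  have hbad : ∀ L : ℝ, 0 ≤ L → ∃ (τ : ℝ) (x y θ : ℝ → Fin N → ℝ), L ≤ τ ∧ 0 ≤ τ ∧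
      IsErrorTrajectory H a w (fun _ => 0) (fun _ => 0) 0 τ x y θ ∧
      (x 0, y 0, θ 0) = (x₀, y₀, θ₀) ∧ δ ≤ ∑ i, x τ i ^ 2 + ∑ i, y τ i ^ 2 := by
    intro L hL
    obtain ⟨T, x, y, θ, h, h0, τ, hτ, hLτ, hbig⟩ := hcon L hL
    exact ⟨τ, x, y, θ, hLτ, hτ.1, h.mono le_rfl hτ.2, h0, hbig.le⟩
  -- No solution for all time is assumed. A counterexample with a later bad time agrees, by
  -- uniqueness, with the previous one on its whole interval and loses a further `γ`; the
  -- nonnegative energy can pay for only finitely many such losses.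
  have hind : ∀ k : ℕ, ∃ (τ : ℝ) (x y θ : ℝ → Fin N → ℝ), 0 ≤ τ ∧
      IsErrorTrajectory H a w (fun _ => 0) (fun _ => 0) 0 τ x y θ ∧
      (x 0, y 0, θ 0) = (x₀, y₀, θ₀) ∧ errorEnergy H (x τ) (y τ) (θ τ) ≤ E - k * γ := by
    intro k
    induction k with
    | zero =>
      obtain ⟨τ, x, y, θ, -, hτ, h, h0, -⟩ := hbad 0 le_rfl
      refine ⟨τ, x, y, θ, hτ, h, h0, ?_⟩
      have := h.energy_antitone hHs ha (Set.left_mem_Icc.2 hτ) (Set.right_mem_Icc.2 hτ) hτ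
      simp only [Prod.mk.injEq] at h0
      rw [h0.1, h0.2.1, h0.2.2] at this
      simpa using this
    | succ k ih =>
      obtain ⟨τ, x, y, θ, hτ, h, h0, hle⟩ := ih
      obtain ⟨τ', x', y', θ', hτ', hτ'0, h', h0', hbig⟩ := hbad (τ + 1) (by linarith)
      refine ⟨τ', x', y', θ', hτ'0, h', h0', ?_⟩
      have hE' : errorEnergy H (x' 0) (y' 0) (θ' 0) ≤ E := by
        have h1 := h0'
        simp only [Prod.mk.injEq] at h1
        rw [h1.1, h1.2.1, h1.2.2]
      have d1 := hdrop τ' x' y' θ' h' hE' τ' ⟨by linarith, le_rfl⟩ hbig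
      have d2 := h'.energy_antitone hHs ha (t₁ := τ) (t₂ := τ' - 1) ⟨hτ, by linarith⟩
        ⟨by linarith, by linarith⟩ (by linarith)
      have d3 := (h'.mono le_rfl (by linarith : τ ≤ τ')).rest_unique h (h0'.trans h0.symm)
        (Set.right_mem_Icc.2 hτ)
      simp only [Prod.mk.injEq] at d3
      rw [d3.1, d3.2.1, d3.2.2] at d2
      push_cast
      linarith
  obtain ⟨k, hk⟩ := exists_nat_gt (E / γ)
  obtain ⟨τ, x, y, θ, -, -, -, hle⟩ := hind k
  have := errorEnergy_nonneg hH.posSemidef (x τ) (y τ) (θ τ)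
  rw [div_lt_iff₀ hγ] at hk
  linarith

end

/-! ### The communication graph and the observer error -/

section
variable {N ρ : ℕ}

/-- The matrix of the communication graph together with the links to the leader. -/
noncomputable def couplingMatrix (adj : Matrix (Fin N) (Fin N) ℝ) (target : Finset (Fin N)) :
    Matrix (Fin N) (Fin N) ℝ :=
  Matrix.diagonal (fun i => ∑ j, adj i j + if i ∈ target then (1 : ℝ) else 0) - adj

theorem couplingMatrix_mulVec (adj : Matrix (Fin N) (Fin N) ℝ) (target : Finset (Fin N))
    (y : Fin N → ℝ) (i : Fin N) : (couplingMatrix adj target *ᵥ y) i =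
      ∑ j, adj i j * (y i - y j) + (if i ∈ target then (1 : ℝ) else 0) * y i := by
  rw [couplingMatrix, Matrix.sub_mulVec, Pi.sub_apply, Matrix.mulVec_diagonal]
  simp only [Matrix.mulVec, dotProduct, mul_sub, Finset.sum_sub_distrib, ← Finset.sum_mul]
  ring

theorem localError_apply (adj : Matrix (Fin N) (Fin N) ℝ) (target : Finset (Fin N))
    (η : Fin N → ExoIdx ρ → ℝ) (v : ExoIdx ρ → ℝ) (i : Fin N) (k : ExoIdx ρ) :
    localError adj target η v i k = (couplingMatrix adj target *ᵥ fun j => η j k - v k) i := by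
  rw [couplingMatrix_mulVec, localError]
  simp only [Pi.add_apply, Finset.sum_apply, Pi.smul_apply, Pi.sub_apply, smul_eq_mul,
    sub_sub_sub_cancel_right]

/-- The quadratic form is half the sum of `a_ij (y_i - y_j)²` plus the sum of `y_i²` over the
followers in contact with the leader. If it vanishes, `y` is constant by connectedness, and zero at
some follower in `target`. -/
theorem posDef_couplingMatrix {adj : Matrix (Fin N) (Fin N) ℝ} (hadj : IsConnectedWeights adj)
    {target : Finset (Fin N)} (htarget : target.Nonempty) :
    (couplingMatrix adj target).PosDef := by
  obtain ⟨hsym, -, hnonneg, hconn⟩ := hadj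
  have hform : ∀ y : Fin N → ℝ, y ⬝ᵥ (couplingMatrix adj target *ᵥ y) =
      (∑ i, ∑ j, adj i j * (y i - y j) ^ 2) / 2 +
        ∑ i, (if i ∈ target then (1 : ℝ) else 0) * y i ^ 2 := by
    intro y
    have h1 : ∑ i, ∑ j, adj i j * (y i * (y i - y j)) = ∑ i, ∑ j, adj i j * (y j * (y j - y i)) := by
      rw [Finset.sum_comm]
      exact Finset.sum_congr rfl fun i _ => Finset.sum_congr rfl fun j _ => by rw [hsym.apply]
    have h2 : ∑ i, ∑ j, adj i j * (y i - y j) ^ 2 =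
        ∑ i, ∑ j, adj i j * (y i * (y i - y j)) + ∑ i, ∑ j, adj i j * (y j * (y j - y i)) := by
      simp only [← Finset.sum_add_distrib]
      exact Finset.sum_congr rfl fun i _ => Finset.sum_congr rfl fun j _ => by ring
    rw [h2, ← h1, add_self_div_two]
    simp only [dotProduct, couplingMatrix_mulVec, mul_add, Finset.sum_add_distrib, Finset.mul_sum]
    congr 1
    · exact Finset.sum_congr rfl fun i _ => Finset.sum_congr rfl fun j _ => by ring
    · exact Finset.sum_congr rfl fun i _ => by ring
  refine Matrix.PosDef.of_dotProduct_mulVec_pos ?_ fun y hy => ?_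
  · rw [Matrix.IsHermitian, Matrix.conjTranspose_eq_transpose_of_trivial, couplingMatrix,
      Matrix.transpose_sub, Matrix.diagonal_transpose, hsym.eq]
  · rw [star_trivial, hform]
    have p1 : 0 ≤ ∑ i, ∑ j, adj i j * (y i - y j) ^ 2 :=
      Finset.sum_nonneg fun i _ => Finset.sum_nonneg fun j _ =>
        mul_nonneg (hnonneg i j) (sq_nonneg _)
    have p2 : 0 ≤ ∑ i, (if i ∈ target then (1 : ℝ) else 0) * y i ^ 2 :=
      Finset.sum_nonneg fun i _ => by positivity
    by_contra! hle
    apply hy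
    have z1 : ∑ i, ∑ j, adj i j * (y i - y j) ^ 2 = 0 := by linarith
    have z2 : ∑ i, (if i ∈ target then (1 : ℝ) else 0) * y i ^ 2 = 0 := by linarith
    have hadj' : ∀ i j, 0 < adj i j → y i = y j := by
      intro i j hij
      rw [Finset.sum_eq_zero_iff_of_nonneg fun i _ => Finset.sum_nonneg fun j _ =>
        mul_nonneg (hnonneg i j) (sq_nonneg _)] at z1
      have z3 := (Finset.sum_eq_zero_iff_of_nonneg fun j _ =>
        mul_nonneg (hnonneg i j) (sq_nonneg _)).1 (z1 i (Finset.mem_univ _)) j (Finset.mem_univ _)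
      exact sub_eq_zero.1 (pow_eq_zero_iff two_ne_zero |>.1
        ((mul_eq_zero.1 z3).resolve_left hij.ne'))
    have hconst : ∀ i j, y i = y j := by
      intro i j
      obtain ⟨p⟩ := hconn.preconnected i j
      induction p with
      | nil => rfl
      | cons h _ ih =>
        refine Eq.trans ?_ ih
        rcases h.2 with h | h
        · exact hadj' _ _ h
        · exact (hadj' _ _ h).symm
    obtain ⟨i₀, hi₀⟩ := htarget
    have z4 := (Finset.sum_eq_zero_iff_of_nonneg fun i _ => by positivity).1 z2 i₀
      (Finset.mem_univ _)
    rw [if_pos hi₀, one_mul, pow_eq_zero_iff two_ne_zero] at z4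
    funext i
    rw [hconst i i₀, z4]
    rfl

theorem oscillatorMatrix_mulVec_fst (w : Fin ρ → ℝ) (y : ExoIdx ρ → ℝ) (r : Fin ρ) :
    (oscillatorMatrix w *ᵥ y) (0, r) = w r * y (1, r) := by
  simp [oscillatorMatrix, Matrix.mulVec, dotProduct, Fintype.sum_prod_type,
    Matrix.blockDiagonal_apply]

theorem oscillatorMatrix_mulVec_snd (w : Fin ρ → ℝ) (y : ExoIdx ρ → ℝ) (r : Fin ρ) :
    (oscillatorMatrix w *ᵥ y) (1, r) = -(w r * y (0, r)) := by
  simp [oscillatorMatrix, Matrix.mulVec, dotProduct, Fintype.sum_prod_type,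
    Matrix.blockDiagonal_apply]

theorem observerMatrix_mulVec (a : Fin ρ → ℝ) (y : ExoIdx ρ → ℝ) (k : Fin 2) (r : Fin ρ) :
    (observerMatrix a *ᵥ y) (k, r) = -(a r * y (k, r)) := by
  fin_cases k <;>
  simp [observerMatrix, Matrix.mulVec, dotProduct, Fintype.sum_prod_type,
    Matrix.blockDiagonal_apply]

theorem IsExosystemTrajectory.hasDerivAt_fst {w : Fin ρ → ℝ} {v : ℝ → ExoIdx ρ → ℝ}
    (hv : IsExosystemTrajectory w v) (r : Fin ρ) (t : ℝ) :
    HasDerivAt (fun τ => v τ (0, r)) (w r * v t (1, r)) t :=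
  (hasDerivAt_pi.1 (hv t) (0, r)).congr_deriv (oscillatorMatrix_mulVec_fst w _ r)

theorem IsExosystemTrajectory.hasDerivAt_snd {w : Fin ρ → ℝ} {v : ℝ → ExoIdx ρ → ℝ}
    (hv : IsExosystemTrajectory w v) (r : Fin ρ) (t : ℝ) :
    HasDerivAt (fun τ => v τ (1, r)) (-(w r * v t (0, r))) t :=
  (hasDerivAt_pi.1 (hv t) (1, r)).congr_deriv (oscillatorMatrix_mulVec_snd w _ r)

/-- Each oscillator rotates with constant amplitude: it either excites the observer with constant
strength or rests forever. -/
theorem IsExosystemTrajectory.sq_add_sq_eq {w : Fin ρ → ℝ} {v : ℝ → ExoIdx ρ → ℝ}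
    (hv : IsExosystemTrajectory w v) (r : Fin ρ) (t t' : ℝ) :
    v t (0, r) ^ 2 + v t (1, r) ^ 2 = v t' (0, r) ^ 2 + v t' (1, r) ^ 2 := by
  have hd : ∀ τ, HasDerivAt (fun τ => v τ (0, r) ^ 2 + v τ (1, r) ^ 2) 0 τ := fun τ =>
    (((hv.hasDerivAt_fst r τ).pow 2).add ((hv.hasDerivAt_snd r τ).pow 2)).congr_deriv (by
      push_cast; ring)
  exact is_const_of_deriv_eq_zero (fun τ => (hd τ).differentiableAt) (fun τ => (hd τ).deriv) t t'

/-- All matrices are block diagonal, so the observer splits into `ρ` independent error systems. Unit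
gains match the weight 1 of the frequency errors in `errorEnergy`. -/
theorem IsObserverTrajectory.isErrorTrajectory {adj : Matrix (Fin N) (Fin N) ℝ}
    {target : Finset (Fin N)} {a : Fin ρ → ℝ} {w : Fin ρ → ℝ} {v : ℝ → ExoIdx ρ → ℝ}
    (hv : IsExosystemTrajectory w v) {η₀ : Fin N → ExoIdx ρ → ℝ} {ω₀ : Fin N → Fin ρ → ℝ}
    {s T : ℝ} {η : Fin N → ℝ → ExoIdx ρ → ℝ} {ω : Fin N → ℝ → Fin ρ → ℝ}
    (h : IsObserverTrajectory adj target a (fun _ => 1) v η₀ ω₀ s T η ω) (r : Fin ρ) :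
    IsErrorTrajectory (couplingMatrix adj target) (a r) (w r) (fun t => v t (0, r))
      (fun t => v t (1, r)) s T (fun t i => η i t (0, r) - v t (0, r))
      (fun t i => η i t (1, r) - v t (1, r)) (fun t i => ω i t r - w r) := by
  obtain ⟨-, -, h⟩ := h
  refine ⟨fun t ht i => ?_, fun t ht i => ?_, fun t ht i => ?_⟩
  · refine ((hasDerivWithinAt_pi.1 (h i t ht).1 (0, r)).sub
      (hv.hasDerivAt_fst r t).hasDerivWithinAt).congr_deriv ?_
    simp only [Pi.add_apply, Pi.sub_apply, Matrix.sub_mulVec, oscillatorMatrix_mulVec_fst,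
      observerMatrix_mulVec, localError_apply]
    ring
  · refine ((hasDerivWithinAt_pi.1 (h i t ht).1 (1, r)).sub
      (hv.hasDerivAt_snd r t).hasDerivWithinAt).congr_deriv ?_
    simp only [Pi.add_apply, Pi.sub_apply, Matrix.sub_mulVec, oscillatorMatrix_mulVec_snd,
      observerMatrix_mulVec, localError_apply]
    ring
  · refine ((hasDerivWithinAt_pi.1 (h i t ht).2 r).sub_const (w r)).congr_deriv ?_
    simp only [localError_apply]
    ring

/-- The observer with unit gains settles within a time that depends only on the required accuracy,
not on the starting time. -/
theorem exists_observer_settlingTime {adj : Matrix (Fin N) (Fin N) ℝ}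
    (hadj : IsConnectedWeights adj) {target : Finset (Fin N)} (htarget : target.Nonempty)
    {a : Fin ρ → ℝ} (ha : ∀ r, 0 < a r) {w : Fin ρ → ℝ} {v : ℝ → ExoIdx ρ → ℝ}
    (hv : IsExosystemTrajectory w v) (η₀ : Fin N → ExoIdx ρ → ℝ) (ω₀ : Fin N → Fin ρ → ℝ) {δ : ℝ}
    (hδ : 0 < δ) :
    ∃ L : ℝ, 0 ≤ L ∧ ∀ (s T : ℝ) (η : Fin N → ℝ → ExoIdx ρ → ℝ) (ω : Fin N → ℝ → Fin ρ → ℝ),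
      IsObserverTrajectory adj target a (fun _ => 1) v η₀ ω₀ s T η ω →
      ∀ τ ∈ Set.Icc s T, s + L ≤ τ → ∀ i k, |η i τ k - v τ k| ≤ δ := by
  have hH := posDef_couplingMatrix hadj htarget
  set H := couplingMatrix adj target with hHdef
  have hblock : ∀ r : Fin ρ, ∃ L : ℝ, 0 ≤ L ∧ ∀ (s T : ℝ) (η : Fin N → ℝ → ExoIdx ρ → ℝ)
      (ω : Fin N → ℝ → Fin ρ → ℝ),
      IsObserverTrajectory adj target a (fun _ => 1) v η₀ ω₀ s T η ω →
      ∀ τ ∈ Set.Icc s T, s + L ≤ τ →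
      ∑ i, (η i τ (0, r) - v τ (0, r)) ^ 2 + ∑ i, (η i τ (1, r) - v τ (1, r)) ^ 2 ≤ δ ^ 2 := by
    intro r
    have hcst := fun t => hv.sq_add_sq_eq r t 0
    rcases (add_nonneg (sq_nonneg (v 0 (0, r))) (sq_nonneg (v 0 (1, r)))).eq_or_lt' with h0 | hpos
    · have hz : ∀ t, v t (0, r) = 0 ∧ v t (1, r) = 0 := fun t => by
        have := hcst t
        rw [h0] at this
        exact ⟨by nlinarith [sq_nonneg (v t (0, r)), sq_nonneg (v t (1, r))],
          by nlinarith [sq_nonneg (v t (0, r)), sq_nonneg (v t (1, r))]⟩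
      -- With `v = 0` in this block the initial error does not depend on the starting time, and the
      -- autonomous system can be shifted to start at 0.
      obtain ⟨L, hL0, hL⟩ := exists_settlingTime_of_rest hH (ha r) (w r) (δ := δ ^ 2)
        (by positivity) (fun i => η₀ i (0, r)) (fun i => η₀ i (1, r)) (fun i => ω₀ i r - w r)
      refine ⟨L, hL0, fun s T η ω h τ hτ hsτ => ?_⟩
      have h1 := (h.isErrorTrajectory hv r).shift s
      simp only [sub_self, fun t => (hz t).1, fun t => (hz t).2, sub_zero] at h1
      have h2 := hL (T - s) _ _ _ h1 (by
        simp only [zero_add, h.1, h.2.1]) (τ - s) ⟨by linarith [hτ.1], by linarith [hτ.2]⟩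
        (by linarith)
      simp only [sub_add_cancel] at h2
      simpa only [fun t => (hz t).1, fun t => (hz t).2, sub_zero] using h2
    · obtain ⟨μ, hμ0, hμ⟩ := hH.exists_sum_sq_le
      set q := v 0 (0, r) ^ 2 + v 0 (1, r) ^ 2 with hq
      have hcont : Continuous fun c : ℝ × ℝ => errorEnergy H (fun i => η₀ i (0, r) - c.1)
          (fun i => η₀ i (1, r) - c.2) (fun i => ω₀ i r - w r) := by
        unfold errorEnergy
        simp only [Matrix.mulVec, dotProduct]
        fun_prop
      -- The initial error depends on the phase of `v` at the start, but that phase ranges in a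
      -- compact set, so the initial energy is bounded uniformly in the starting time.
      obtain ⟨E, hE⟩ := (isCompact_closedBall (0 : ℝ × ℝ) (1 + q)).exists_bound_of_continuousOn
        hcont.continuousOn
      obtain ⟨L, hL0, hL⟩ := exists_settlingTime_of_oscillating hH (ha r) (w r) hpos
        (le_max_right E 0) (δ := δ ^ 2 / (2 * μ)) (by positivity)
      refine ⟨L, hL0, fun s T η ω h τ hτ hsτ => ?_⟩
      have h1 := hL _ _ s T _ _ _ (hv.hasDerivAt_fst r) (hv.hasDerivAt_snd r) hcst
        (h.isErrorTrajectory hv r) (by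
          refine le_trans ?_ (le_max_left E 0)
          have hb : (v s (0, r), v s (1, r)) ∈ Metric.closedBall (0 : ℝ × ℝ) (1 + q) := by
            rw [mem_closedBall_zero_iff, norm_prod_le_iff]
            exact abs_le_one_add_of_sq_add_sq_eq (hcst s)
          have := (le_abs_self _).trans (hE _ hb)
          simpa only [h.1, h.2.1] using this) τ hτ hsτ
      refine (sum_sq_le_errorEnergy hμ hμ0 _ _ _).trans
        ((mul_le_mul_of_nonneg_left h1 (by positivity)).trans_eq ?_)
      field_simp
  choose L hL0 hL using hblock
  -- The sum serves as an upper bound for the settling times of all blocks.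
  refine ⟨∑ r, L r, Finset.sum_nonneg fun r _ => hL0 r, fun s T η ω h τ hτ hsτ i k => ?_⟩
  obtain ⟨b, r⟩ := k
  have h1 := hL r s T η ω h τ hτ
    (le_trans (by have := Finset.single_le_sum (fun r _ => hL0 r) (Finset.mem_univ r); linarith) hsτ)
  have h2 := Finset.single_le_sum (f := fun i => (η i τ (0, r) - v τ (0, r)) ^ 2)
    (fun i _ => sq_nonneg _) (Finset.mem_univ i)
  have h3 := Finset.single_le_sum (f := fun i => (η i τ (1, r) - v τ (1, r)) ^ 2)
    (fun i _ => sq_nonneg _) (Finset.mem_univ i)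
  have p0 : 0 ≤ ∑ i, (η i τ (0, r) - v τ (0, r)) ^ 2 := by positivity
  have p1 : 0 ≤ ∑ i, (η i τ (1, r) - v τ (1, r)) ^ 2 := by positivity
  refine abs_le_of_sq_le_sq ?_ hδ.le
  fin_cases b
  · exact h2.trans (by linarith)
  · exact h3.trans (by linarith)

end

/-! ### Assembly -/

theorem theorem2 {N ρ s : ℕ} (n m p h : Fin N → ℕ)
    -- the followers
    (A : ∀ i, Matrix (Fin (n i)) (Fin (n i)) ℝ) (B : ∀ i, Matrix (Fin (n i)) (Fin (m i)) ℝ)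
    (C : ∀ i, Matrix (Fin (p i)) (Fin (n i)) ℝ) (D : ∀ i, Matrix (Fin (n i)) (ExoIdx ρ) ℝ)
    (F : ∀ i, Matrix (Fin (p i)) (ExoIdx ρ) ℝ)
    -- the exosystem
    (w : Fin ρ → ℝ) (hw : ∀ r, 0 < w r) (hw_inj : Function.Injective w)
    (v : ℝ → ExoIdx ρ → ℝ) (hv : IsExosystemTrajectory w v)
    -- the standing assumptions
    (hstab : ∀ i, IsStabilizable (A i) (B i)) (hobs : ∀ i, IsObservable (C i) (A i))
    (adj : Matrix (Fin N) (Fin N) ℝ) (hadj : IsConnectedWeights adj)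
    (target : Finset (Fin N)) (htarget : target.Nonempty)
    (hreg : ∀ i, ∀ μ ∈ spectrum ℂ ((oscillatorMatrix w).map (algebraMap ℝ ℂ)),
      (Matrix.fromBlocks ((A i).map (algebraMap ℝ ℂ) - μ • 1) ((B i).map (algebraMap ℝ ℂ))
        ((C i).map (algebraMap ℝ ℂ)) 0).rank = n i + p i)
    -- the weights of the cost
    (Q : ∀ i, Matrix (Fin (p i)) (Fin (p i)) ℝ) (hQ : ∀ i, (Q i).PosSemidef)
    (R : ∀ i, Matrix (Fin (m i)) (Fin (m i)) ℝ) (hR : ∀ i, (R i).PosDef)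
    (hQobs : ∀ i, IsObservable (CFC.sqrt (Q i) * C i) (A i))
    -- the observer
    (a : Fin ρ → ℝ) (ha : ∀ r, 0 < a r)
    (η₀ : Fin N → ExoIdx ρ → ℝ) (ω₀ : Fin N → Fin ρ → ℝ)
    -- the trial matrices
    (X : ∀ i, Fin (h i + 2) → Matrix (Fin (n i)) (ExoIdx ρ) ℝ)
    (hX : ∀ i, IsTrialFamily (C i) (F i) (X i))
    -- the learning phase: initial gains, exploration noise, inputs, states
    (t : Fin (s + 1) → ℝ) (ht : StrictMono t)
    (K₀ : ∀ i, Matrix (Fin (m i)) (Fin (n i)) ℝ)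
    (hK₀ : ∀ i, IsStabilizingGain (A i) (B i) (K₀ i))
    (ζ u : ∀ i, ℝ → Fin (m i) → ℝ) (x : ∀ i, ℝ → Fin (n i) → ℝ)
    (hζ : ∀ i, MemLp (ζ i) ⊤ (volume.restrict (Set.Icc (t 0) (t (Fin.last s)))))
    (hu : ∀ i τ, u i τ = -(K₀ i *ᵥ x i τ) + ζ i τ)
    (hx : ∀ i, IsFollowerTrajectory (A i) (B i) (D i) (u i) v (t 0) (t (Fin.last s)) (x i))
    -- the data rank condition
    (hrank : ∀ i j, DataRankCondition t (barSignal (X i j) (x i) v) (u i) v) :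
    ∃ Pstar : ∀ i, Matrix (Fin (n i)) (Fin (n i)) ℝ,
      (∀ i, IsStabilizingRiccatiSolution (A i) (B i) (C i) (Q i) (R i) (Pstar i) ∧
        ∀ P', IsStabilizingRiccatiSolution (A i) (B i) (C i) (Q i) (R i) P' → P' = Pstar i) ∧
      ∀ c : ℝ, 0 < c → ∃ κ : Fin ρ → ℝ, (∀ r, 0 < κ r) ∧ ∃ kstar : ℕ,
        -- learning from the exostate itself
        (∀ i j, LearnsWithin (C i) (Q i) (R i) t (barSignal (X i j) (x i) v) (u i) v (K₀ i) kstar c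
          (Pstar i) ((R i)⁻¹ * (B i)ᵀ * Pstar i)) ∧
        -- learning from the estimates of the observer, started at least `Tstar` before the data
        ∃ Tstar : ℝ, 0 ≤ Tstar ∧ ∀ T ≥ Tstar, ∀ η ω,
          IsObserverTrajectory adj target a κ v η₀ ω₀ (t 0 - T) (t (Fin.last s)) η ω →
          ∀ i j, LearnsWithin (C i) (Q i) (R i) t (barSignal (X i j) (x i) (η i)) (u i) (η i)
            (K₀ i) kstar c (Pstar i) ((R i)⁻¹ * (B i)ᵀ * Pstar i) := by
  choose Pstar hPstar hlearn using fun i =>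
    exists_eventually_learnsWithin (C := C i) (hQ i) (hR i) (hQobs i) hv ht (hK₀ i) (hζ i) (hu i)
      (hx i)
  refine ⟨Pstar, fun i => ⟨hPstar i, fun P' hP' => (hPstar i).unique (hR i) hP'⟩, fun c hc => ?_⟩
  -- There are finitely many followers, so one step index works for all, with and without the
  -- observer.
  obtain ⟨k, hk⟩ := (eventually_all.2 fun i => hlearn i c hc).exists
  refine ⟨fun _ => 1, fun _ => one_pos, k, fun i j => (hk i (X i j) (hrank i j)).1, ?_⟩
  choose δ hδ hδlearn using fun i j => (hk i (X i j) (hrank i j)).2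
  -- A common positive tolerance, taken close to 0 from the right so that no minimum over possibly
  -- empty families is needed.
  obtain ⟨d, hd, hd0⟩ : ∃ d : ℝ, (∀ i j, d ≤ δ i j) ∧ 0 < d :=
    ((eventually_all.2 fun i => eventually_all.2 fun j =>
      (eventually_nhdsWithin_of_eventually_nhds (eventually_le_nhds (hδ i j)))).and
      (eventually_mem_nhdsWithin (a := (0 : ℝ)) (s := Set.Ioi 0))).exists
  obtain ⟨L, hL0, hL⟩ := exists_observer_settlingTime hadj htarget ha hv η₀ ω₀ hd0
  refine ⟨L, hL0, fun T hT η ω hη i j => hδlearn i j (η i) ?_ fun τ hτ r => ?_⟩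
  · intro τ hτ
    have hsub : Set.Icc (t 0) (t (Fin.last s)) ⊆ Set.Icc (t 0 - T) (t (Fin.last s)) :=
      Set.Icc_subset_Icc (by linarith) le_rfl
    exact ((hη.2.2 i τ (hsub hτ)).1.continuousWithinAt).mono hsub
  -- Starting at `t 0 - T` with `T ≥ L`, the observer has settled before the data window opens.
  · exact (hL _ _ η ω hη τ ⟨by linarith [hτ.1], hτ.2⟩ (by linarith [hτ.1]) i r).trans (hd i j)
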